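/- **Conventions.** $\mathrm{Br}_2=\pi_1(\mathrm{Conf}^2(\mathbb C))\cong\mathbb Z$ is generated by the clockwise half turn of two points. Let $M=\mathbb C\setminus\{X^-,X^+,Y\}$, with the three punctures on the real axis. For a loop $\gamma$ in $M$ and a puncture $V$ let $\Psi^1_V(\gamma)\in\mathbb Z$ be the class in $\mathrm{Br}_2$ of the pair ($\gamma$, constant loop at $V$), and for a set $W$ of punctures put $\Psi_W=\tfrac12\sum_{V\in W}\Psi^1_V$, the sum of the clockwise winding numbers of $\gamma$ about the points of $W$. For a loop $\gamma$ in $\mathrm{Conf}^2(M)$ let $\Phi(\gamma)\in\mathbb Z$ be its image in $\mathrm{Br}_2$. **Exchange rule.** Let $c$ be a curve in $M$, let $p,q$ be points of $c$ on two disjoint curves $\ell$ and $\ell'$, let $q'$ be the point corresponding to $q$ on $\ell$, and let $r$ be a path from $q'$ back to $p$. This gives a loop in $\mathrm{Conf}^2(M)$ based at $\{p,q\}$: if $q$ is not between $p$ and $q'$ on $c$, then $p$ moves along $c$ to $q'$ and back by $r$, while $q$ rests; if it is, then the first point moves along $c$ from $p$ to $q$, and the second one moves along $c$ from $q$ to $q'$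 and then by $r$ to $p$ (the second one moving first along $c$). **The tangle matrix.** Let $N\ge 1$ be odd, and place the punctures in the order $X^-,Y,X^+$ from left to right. Let $\alpha_{N/1}$ be the arc that starts at $X^-$, leaves it upwards, spirals clockwise outwards around $X^-$ and $Y$, crossing the vertical line between $X^-$ and $Y$ exactly $N$ times, alternately above and below the real axis and the first and the last time above it, and after the last crossing passes above $Y$ to $X^+$, which it reaches from above. It meets the vertical line between $X^-$ and $Y$ (the active axis) in $N$ points $\xi_1,\dots,\xi_N$, numbered from $X^-$ on along the arc, and the vertical line between $Y$ and $X^+$ (the inactive axis) in one point $\xi_{N+1}=\xi_\omega$. Let $\gamma_{i,j}$ be the loop that runs from $\xi_i$ along the arc to $\xi_j$ and returns to $\xi_i$ along their common axis or, if they lie on different axes, along the axis of $\xi_j$ to its topmost intersection point, along the arc to the topmost intersection point of the other axis, and along that axis to $\xi_i$. For $i\ne j$, replace each axis by two parallel copies and put $\xi_i,\xi_j$ on different copies: the lower one on the left copy and the other one on the right copy if they lie on the same axis, and the active one on the left copy of its axis and the inactive one on the right copy of its axis otherwise. Let $\gamma^{(2)}_{i,j}$ be the loop in $\mathrm{Conf}^2(M)$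 given by the exchange rule for $c=\alpha_{N/1}$, $p=\xi_i$, $q=\xi_j$, with $q'$ the point on the copies containing $\xi_i$ that corresponds to $\xi_j$, and with $r$ the return path of $\gamma_{i,j}$ on those copies. The $(N+1)\times(N+1)$ matrix $Q^T_{N/1}$ is $$Q^T_{ii}=\bigl(\Psi_{\{X^-,Y\}}-3\Psi_{\{X^+\}}\bigr)(\gamma_{i,\omega}),\qquad Q^T_{ij}=Q^T_{ii}+\Phi(\gamma^{(2)}_{j,i})-2\Psi_{\{X^+\}}(\gamma_{j,i})\quad(i\ne j).$$ (The further terms of the general formula carry a factor $\delta_{Z,X^+}$, $Z$ being the middle puncture, and vanish here since $Z=Y$.) Write it in blocks $Q_{++},Q_{+-},Q_{-+},Q_{--}$ according to the active points $\xi_1,\dots,\xi_N$ and the inactive point $\xi_{N+1}$. **The closure matrix.** The tangle $\tau_{(2n-1)/1}$ has orientation $UP$. Applying $\mathrm{Cl}(T-)$ to $Q^T_{(2n-1)/1}$ gives, by definition, the $4n\times4n$ matrix $$Q_{2n/1}=\begin{bmatrix}Q_{++}-1&Q_{++}+U&Q_{+-}&Q_{+-}-1\\ Q_{++}+L&Q_{++}+2&Q_{+-}+1&Q_{+-}\\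 Q_{-+}&Q_{-+}+1&Q_{--}+1&Q_{--}+L\\ Q_{-+}-1&Q_{-+}&Q_{--}+U&Q_{--}\end{bmatrix},$$ where an integer stands for the matrix all of whose entries are that integer, and $U$ (resp. $L$) has entries $1$ strictly above (resp. strictly below) the diagonal and $0$ elsewhere. **The link matrix.** Place the punctures in the order $Y,X^-,X^+$. Let $\alpha_{2n/1}$ be the arc that starts at $X^-$, spirals clockwise outwards through $n$ full turns around $Y$ and $X^-$, leaving $X^-$ to the left between $Y$ and $X^-$ and passing below $Y$ first, and ends at $X^+$, which it reaches from the right. The blue curve is the boundary of a thin band around this arc, cut open at its end around $X^-$; it consists of an outer strand (on the left of the arc oriented from $X^-$ to $X^+$) and an inner strand. The red curve is the boundary of a thin neighbourhood of the segment from $X^-$ to $X^+$, cut open where the arc meets it next to $X^+$. Each strand meets the red curve in $2n$ points. Order them along each strand from $X^-$ to $X^+$ and number all $4n$ of them in the standard ordering: block $\mathfrak A$ consists of the first $2n-1$ points of the outer strand, block $\mathfrak B$ of the first $2n-1$ points of the inner strand, $\mathfrak C$ of the last point of the inner strand, and $\mathfrak D=\{\lambda_\omega\}$, $\omega=4n$,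 of the last point of the outer strand. Let $\gamma_{i,j}$ be the loop in $M$ that runs from $\lambda_i$ along the cut blue curve to $\lambda_j$ and returns to $\lambda_i$ along the cut red curve. For $i\neq j$, replace the red curve by two parallel copies, put on the outer copy the one of $\lambda_i,\lambda_j$ that comes first when the cut red curve is run through clockwise starting from $\lambda_\omega$, and the other one on the inner copy. Let $\gamma^{(2)}_{i,j}$ be the loop in $\mathrm{Conf}^2(M)$ given by the exchange rule for the cut blue curve $c$, $p=\lambda_i$, $q=\lambda_j$, with $q'$ and $r$ on the red copy that contains $\lambda_i$. The $4n\times 4n$ matrix $Q^L_{2n/1}$ is $$Q^L_{ii}=\bigl(\Psi_{\{X^-,Y\}}-3\Psi_{\{X^+\}}\bigr)(\gamma_{i,\omega})+\mu_3,\qquad Q^L_{ij}=Q^L_{ii}+\Phi(\gamma^{(2)}_{j,i})-2\Psi_{\{X^+\}}(\gamma_{j,i})\quad(i\ne j),$$ where the correction term $\mu_3$ counts the twists that build $\tau_{(2n-1)/1}=T^{2n-1}\tau_{0/1}$ by type, as $\#\{RUP,ROP^-\}-\#\{TOP^+,TRI,RRI\}$; all of them are top twists of $UP$ tangles, so that $\mu_3=0$.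 **Proposition.** For every $n\ge1$, the listed points are exactly the intersection points of the curves, all the loops above lie in $M$ and $\mathrm{Conf}^2(M)$ respectively, and $$Q^L_{2n/1}=Q_{2n/1}.$$ -/

import Mathlib

open scoped unitInterval

noncomputable section

namespace RationalTorusLink

/-! ## Half turns, and the homomorphisms `Ψ` and `Φ` -/

/-- `f` is a path in `ℂ \ {0}` whose argument, followed continuously and measured clockwise,
grows by `k * π`. For `f = σ¹ - σ²`, with `(σ¹, σ²)` a loop in the unordered configuration space
`Conf²(ℂ)`, the integer `k` is the image of the loop under `π₁(Conf²(ℂ)) ≅ Br₂ ≅ ℤ`, where the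
generator is the exchange of two points by a clockwise half turn. -/
def IsHalfTurns (f : C(I, ℂ)) (k : ℤ) : Prop :=
  (∀ t, f t ≠ 0) ∧ ∃ θ : C(I, ℝ),
    (∀ t, f t = ‖f t‖ * Complex.exp (-(θ t : ℂ) * Complex.I)) ∧ θ 1 - θ 0 = k * Real.pi

theorem IsHalfTurns.unique {f : C(I, ℂ)} {k l : ℤ} (hk : IsHalfTurns f k)
    (hl : IsHalfTurns f l) : k = l := by
  obtain ⟨h0, θ, hθ, hk⟩ := hk
  obtain ⟨-, η, hη, hl⟩ := hl
  have hpi := Real.pi_pos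
  have key : ∀ t, ∃ m : ℤ, (m : ℝ) = (θ t - η t) / (2 * Real.pi) := by
    intro t
    have h1 : (‖f t‖ : ℂ) ≠ 0 := by simpa using h0 t
    have h2 := mul_left_cancel₀ h1 ((hθ t).symm.trans (hη t))
    rw [Complex.exp_eq_exp_iff_exists_int] at h2
    obtain ⟨m, hm⟩ := h2
    refine ⟨-m, ?_⟩
    have h3 := congrArg Complex.im hm
    simp at h3
    rw [eq_div_iff (by positivity)]
    push_cast
    linarith
  have hc : Continuous fun t : I => (θ t - η t) / (2 * Real.pi) := by fun_prop
  have hd : IsDiscrete (Set.range ((↑) : ℤ → ℝ)) :=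
    ⟨Int.isClosedEmbedding_coe_real.isEmbedding.toHomeomorph.discreteTopology⟩
  have h := (isPreconnected_univ (α := I)).constant_of_mapsTo hd hc.continuousOn
    (fun t _ => key t) (Set.mem_univ 1) (Set.mem_univ 0)
  have h' : θ 1 - η 1 = θ 0 - η 0 := by
    field_simp at h
    linarith
  have h4 : ((k : ℝ) - l) * Real.pi = 0 := by linarith
  have h5 : (k : ℝ) = l := by
    rcases mul_eq_zero.mp h4 with h6 | h6 <;> linarith
  exact_mod_cast h5

open Classical in
/-- The number of clockwise half turns about the origin (`0` if it is undefined). -/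
def halfTurns (f : C(I, ℂ)) : ℤ :=
  if h : ∃ k, IsHalfTurns f k then h.choose else 0

/-- The names of the three punctures. -/
inductive Puncture
  | Xminus
  | Xplus
  | Y
  deriving DecidableEq

/-- `Ψ¹_V` of a loop `γ`: the class in `Br₂ ≅ ℤ` of the pair `(γ, constant loop at V)`. -/
def psiOne {x : ℂ} (V : ℂ) (γ : Path x x) : ℤ :=
  halfTurns ⟨fun t => γ t - V, by fun_prop⟩

/-- `Ψ_W = (1/2) ∑_{V ∈ W} Ψ¹_V` for a set `W` of punctures placed at `loc`. Each `Ψ¹_V` of a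
loop is even, so the division is exact, and `Ψ_W` is the sum of the clockwise winding numbers. -/
def psi (loc : Puncture → ℂ) (W : Finset Puncture) {x : ℂ} (γ : Path x x) : ℤ :=
  (∑ V ∈ W, psiOne (loc V) γ) / 2

/-- `Φ` of a loop in `Conf²`, given as a pair of paths. -/
def phi (p : C(I, ℂ × ℂ)) : ℤ :=
  halfTurns ⟨fun t => (p t).1 - (p t).2, by fun_prop⟩

/-- The punctured plane `M`. -/
def puncturedPlane (loc : Puncture → ℂ) : Set ℂ := {z | ∀ V, z ≠ loc V}

/-- Pairs of distinct points of `M`; such a pair represents a point of `Conf²(M)`. -/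
def confTwo (loc : Puncture → ℂ) : Set (ℂ × ℂ) :=
  {z | z.1 ∈ puncturedPlane loc ∧ z.2 ∈ puncturedPlane loc ∧ z.1 ≠ z.2}

/-! ## Polygonal curves, and loops made of pieces of curves -/

/-- The polygonal curve with vertices `v 0, …, v m`; it is at `v k` at time `k`, moves at constant
speed along the segment from `v k` to `v (k + 1)` during `[k, k + 1]`, and is constant outside
`[0, m]`. -/
def polyline (v : ℕ → ℂ) (m : ℕ) : C(ℝ, ℂ) where
  toFun t := v 0 + ∑ k ∈ Finset.range m, ((max 0 (min 1 (t - k)) : ℝ) : ℂ) * (v (k + 1) - v k)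
  continuous_toFun := by fun_prop

theorem polyline_apply (v : ℕ → ℂ) {m k : ℕ} (hk : k < m) {t x : ℝ} (ht : t = k + x)
    (h0 : 0 ≤ x) (h1 : x ≤ 1) : polyline v m t = v k + x * (v (k + 1) - v k) := by
  subst ht
  have hL : ∀ j ∈ Finset.range k,
      ((max 0 (min 1 ((k : ℝ) + x - j)) : ℝ) : ℂ) * (v (j + 1) - v j) = v (j + 1) - v j := by
    intro j hj
    have : (j : ℝ) + 1 ≤ k := by exact_mod_cast Finset.mem_range.mp hj
    rw [min_eq_left (by linarith), max_eq_right (by norm_num)]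
    simp
  have hR : ∀ j ∈ Finset.Ico (k + 1) m,
      ((max 0 (min 1 ((k : ℝ) + x - j)) : ℝ) : ℂ) * (v (j + 1) - v j) = 0 := by
    intro j hj
    have : (k : ℝ) + 1 ≤ j := by exact_mod_cast (Finset.mem_Ico.mp hj).1
    rw [max_eq_left ((min_le_right _ _).trans (by linarith))]
    simp
  change v 0 + ∑ j ∈ Finset.range m, _ = _
  rw [← Finset.sum_range_add_sum_Ico _ (show k + 1 ≤ m from hk), Finset.sum_eq_zero hR,
    Finset.sum_range_succ, Finset.sum_congr rfl hL, Finset.sum_range_sub]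
  rw [show (k : ℝ) + x - k = x by ring, min_eq_right h1, max_eq_right h0]
  ring

theorem polyline_mk (v : ℕ → ℂ) {m k : ℕ} {t x a b a' b' : ℝ} (h : v k = ⟨a, b⟩)
    (h' : v (k + 1) = ⟨a', b'⟩) (hk : k < m) (ht : t = k + x) (h0 : 0 ≤ x) (h1 : x ≤ 1) :
    polyline v m t = ⟨a + x * (a' - a), b + x * (b' - b)⟩ := by
  rw [polyline_apply v hk ht h0 h1, h, h']
  apply Complex.ext <;> simp

/-- The piece of the parametrized curve `c` from parameter `a` to parameter `b`. -/
def along (c : C(ℝ, ℂ)) (a b : ℝ) : Path (c a) (c b) where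
  toFun t := c (a + t * (b - a))
  source' := by simp
  target' := by simp

open Classical in
/-- The loop in `Conf²` used for the off-diagonal entries. The first point starts at `c s₀`, the
second one at `c s₂`, and `ret` is a path back from `c s₁` to `c s₀`. The first point moves along
the curve `c` from `c s₀` towards `c s₁`. If `c s₂` is not passed on the way, then the first point
goes on to `c s₁` and comes back by `ret`, while the second point rests. If `c s₂` is passed, then
the first point stops there; the second point moves on in the same direction from `c s₂` to `c s₁`
and then by `ret` to `c s₀`, so that the two points are exchanged. -/
def twoPointLoop (c : C(ℝ, ℂ)) (s₀ s₁ s₂ : ℝ) (ret : Path (c s₁) (c s₀)) : C(I, ℂ × ℂ) :=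
  if (s₀ < s₂ ∧ s₂ < s₁) ∨ (s₁ < s₂ ∧ s₂ < s₀) then
    (((Path.refl (c s₀)).prod (along c s₂ s₁)).trans
      (((along c s₀ s₂).prod (Path.refl (c s₁))).trans
        ((Path.refl (c s₂)).prod ret))).toContinuousMap
  else
    (((along c s₀ s₁).prod (Path.refl (c s₂))).trans
      (ret.prod (Path.refl (c s₂)))).toContinuousMap

/-! ## The tangle `τ_{N/1} = T^N τ_{0/1}`

The arc spirals clockwise, in `N` half turns, out of `X⁻` around the left and the middle puncture
and ends at the right puncture `X⁺`. The active axis is the vertical line between the left and the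
middle puncture, the inactive axis is the one between the middle and the right puncture. -/

/-- The positions of the punctures: they are `Y | X⁻ | X⁺` from left to right if `N` is even, and
`X⁻ | Y | X⁺` if `N` is odd. -/
def tangleLoc (N : ℕ) : Puncture → ℂ
  | .Xminus => ((-1) ^ N * 4 : ℝ)
  | .Y => (-(-1) ^ N * 4 : ℝ)
  | .Xplus => (4 * (N + 1) : ℝ)

/-- The middle puncture `Z`. -/
def middle (N : ℕ) : Puncture := if Even N then .Xminus else .Y

/-- Vertices of the arc: `X⁻`, then alternately a vertical and a horizontal step, up to `X⁺`. -/
def arcVertex (N m : ℕ) : ℂ :=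
  let s : ℝ := (-1) ^ (N + m / 2)
  let k : ℝ := (m / 2 : ℕ)
  if m = 2 * N + 1 then ⟨4 * (N + 1), 0⟩
  else if m % 2 = 0 then ⟨s * (4 * (k + 1)), s * (4 * k)⟩
  else ⟨s * (4 * (k + 1)), -s * (4 * (k + 1))⟩

/-- The arc `α_{N/1}`, parametrized from `X⁻` to `X⁺`. -/
def arc (N : ℕ) : C(ℝ, ℂ) := polyline (arcVertex N) (2 * N + 1)

/-- Indices of the intersection points: active points in the order in which the arc meets them,
followed by the one inactive point. -/
abbrev TangleIdx (N : ℕ) : Type := Fin N ⊕ Fin 1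

/-- The abscissa of the axis of a point. The vertical axes have three copies: `0` stands for the
axis itself, and `-1` and `1` for parallel copies to its left and to its right. -/
def axisX (N : ℕ) (c : SignType) : TangleIdx N → ℝ
  | .inl _ => c
  | .inr _ => 4 * N + 2 + c

/-- The ordinate of an intersection point (the same on all copies of the axis). -/
def height (N : ℕ) : TangleIdx N → ℝ
  | .inl k => -(-1) ^ (N + (k : ℕ)) * (4 * ((k : ℕ) + 1))
  | .inr _ => 4 * N

/-- The parameter on the arc of an intersection point with copy `c` of its axis. -/
def arcParam (N : ℕ) (c : SignType) : TangleIdx N → ℝ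
  | .inl k => 2 * (k : ℕ) + 1 +
      (4 * ((k : ℕ) + 1) - (-1) ^ (N + (k : ℕ)) * (c : ℝ)) / (8 * (k : ℕ) + 12)
  | .inr _ => 2 * N - 1 + (8 * N + 2 + c) / (8 * N + 4)

/-- The vertical line with abscissa `x`, parametrized by height. -/
def vertical (x : ℝ) : C(ℝ, ℂ) where
  toFun y := x + y * Complex.I
  continuous_toFun := by fun_prop

theorem vertical_apply (x y : ℝ) : vertical x y = ⟨x, y⟩ := by
  apply Complex.ext <;> simp [vertical]

theorem signType_mem (c : SignType) : (-1 : ℝ) ≤ c ∧ (c : ℝ) ≤ 1 := by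
  cases c <;> simp

theorem arc_arcParam (N : ℕ) (hN : 1 ≤ N) (c : SignType) (i : TangleIdx N) :
    arc N (arcParam N c i) = vertical (axisX N c i) (height N i) := by
  obtain ⟨hc, hc'⟩ := signType_mem c
  rcases i with ⟨k, hk⟩ | k
  · have hs : ((-1 : ℝ) ^ (N + k)) = 1 ∨ ((-1 : ℝ) ^ (N + k)) = -1 := neg_one_pow_eq_or ℝ _
    have hk0 : (0 : ℝ) ≤ k := Nat.cast_nonneg k
    have hd : (0 : ℝ) < 8 * k + 12 := by positivity
    have h0 : (0 : ℝ) ≤ (4 * (k + 1) - (-1) ^ (N + k) * (c : ℝ)) / (8 * k + 12) := by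
      apply div_nonneg _ hd.le
      rcases hs with h | h <;> rw [h] <;> linarith
    have h1 : (4 * ((k : ℝ) + 1) - (-1) ^ (N + k) * (c : ℝ)) / (8 * k + 12) ≤ 1 := by
      rw [div_le_one hd]
      rcases hs with h | h <;> rw [h] <;> linarith
    have e1 : arcVertex N (2 * k + 1) =
        ⟨(-1) ^ (N + k) * (4 * (k + 1)), -(-1) ^ (N + k) * (4 * (k + 1))⟩ := by
      have a1 : (2 * k + 1) / 2 = k := by omega
      simp [arcVertex, a1, show k ≠ N by omega]
    have e2 : arcVertex N (2 * k + 1 + 1) =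
        ⟨-(-1) ^ (N + k) * (4 * (k + 2)), -(-1) ^ (N + k) * (4 * (k + 1))⟩ := by
      have a1 : (2 * k + 1 + 1) / 2 = k + 1 := by omega
      have a2 : (2 * k + 1 + 1) % 2 = 0 := by omega
      have a3 : ¬ 2 * k + 1 + 1 = 2 * N + 1 := by omega
      simp only [arcVertex, a1, a2, a3, if_true, if_false]
      rw [← add_assoc, pow_succ]
      push_cast
      congr 1 <;> ring
    rw [arc, polyline_mk (arcVertex N) e1 e2 (show 2 * k + 1 < 2 * N + 1 by omega)
      (x := (4 * ((k : ℝ) + 1) - (-1) ^ (N + k) * (c : ℝ)) / (8 * k + 12))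
      (by simp [arcParam]) h0 h1, vertical_apply]
    apply Complex.ext
    · simp only [axisX]
      rcases hs with h | h <;> rw [h] <;> field_simp <;> ring
    · simp [height]
  · have hN' : (1 : ℝ) ≤ N := by exact_mod_cast hN
    have hd : (0 : ℝ) < 8 * N + 4 := by positivity
    obtain ⟨M, rfl⟩ : ∃ M, N = M + 1 := ⟨N - 1, by omega⟩
    have h0 : (0 : ℝ) ≤ (8 * (M + 1 : ℕ) + 2 + c) / (8 * (M + 1 : ℕ) + 4) :=
      div_nonneg (by linarith) hd.le
    have h1 : (8 * (M + 1 : ℕ) + 2 + (c : ℝ)) / (8 * (M + 1 : ℕ) + 4) ≤ 1 := by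
      rw [div_le_one hd]
      linarith
    have e1 : arcVertex (M + 1) (2 * M + 1) = ⟨-(4 * (M + 1)), 4 * (M + 1)⟩ := by
      have a1 : (2 * M + 1) / 2 = M := by omega
      have a4 : ((-1 : ℝ)) ^ (M + 1 + M) = -1 := Odd.neg_one_pow ⟨M, by ring⟩
      simp [arcVertex, a1, a4]
    have e2 : arcVertex (M + 1) (2 * M + 1 + 1) = ⟨4 * (M + 2), 4 * (M + 1)⟩ := by
      have a1 : (2 * M + 1 + 1) / 2 = M + 1 := by omega
      have a2 : (2 * M + 1 + 1) % 2 = 0 := by omega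
      have a3 : ¬ 2 * M + 1 + 1 = 2 * (M + 1) + 1 := by omega
      have a4 : ((-1 : ℝ)) ^ (M + 1 + (M + 1)) = 1 := Even.neg_one_pow ⟨M + 1, rfl⟩
      simp only [arcVertex, a1, a2, a3, a4, if_true, if_false]
      push_cast
      congr 1 <;> ring
    rw [arc, polyline_mk (arcVertex (M + 1)) e1 e2 (show 2 * M + 1 < 2 * (M + 1) + 1 by omega)
      (x := (8 * (M + 1 : ℕ) + 2 + (c : ℝ)) / (8 * (M + 1 : ℕ) + 4))
      (by simp only [arcParam]; push_cast; ring) h0 h1, vertical_apply]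
    apply Complex.ext
    · simp only [axisX]
      push_cast at hd ⊢
      field_simp
      ring
    · simp [height]

/-- The path along copy `c` of their common axis between two points of the same axis. -/
def axisPath (N : ℕ) (hN : 1 ≤ N) (c : SignType) (i j : TangleIdx N)
    (h : axisX N c i = axisX N c j) : Path (arc N (arcParam N c i)) (arc N (arcParam N c j)) :=
  (along (vertical (axisX N c i)) (height N i) (height N j)).cast
    (arc_arcParam N hN c i) (by rw [arc_arcParam N hN c j, h])

/-- The topmost active point; the topmost inactive point is the only one. -/
def topActive (N : ℕ) (hN : 1 ≤ N) : TangleIdx N := .inl ⟨N - 1, by omega⟩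

/-- The path from `ξ_j` back to `ξ_i`: along their axis if both are active or both inactive, and
otherwise along the axis of `ξ_j` to its topmost point, along the arc to the topmost point of the
other axis, and along that axis to `ξ_i`. -/
def returnPath (N : ℕ) (hN : 1 ≤ N) (c : SignType) : (j i : TangleIdx N) →
    Path (arc N (arcParam N c j)) (arc N (arcParam N c i))
  | .inl j, .inl i => axisPath N hN c (.inl j) (.inl i) rfl
  | .inr j, .inr i => axisPath N hN c (.inr j) (.inr i) rfl
  | .inr j, .inl i => ((axisPath N hN c (.inr j) (.inr 0) rfl).trans
      (along (arc N) (arcParam N c (.inr 0)) (arcParam N c (topActive N hN)))).trans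
        (axisPath N hN c (topActive N hN) (.inl i) rfl)
  | .inl j, .inr i => ((axisPath N hN c (.inl j) (topActive N hN) rfl).trans
      (along (arc N) (arcParam N c (topActive N hN)) (arcParam N c (.inr 0)))).trans
        (axisPath N hN c (.inr 0) (.inr i) rfl)

/-- The loop `γ^T_{i,j}` in `M`. -/
def tangleLoop (N : ℕ) (hN : 1 ≤ N) (i j : TangleIdx N) :
    Path (arc N (arcParam N 0 i)) (arc N (arcParam N 0 i)) :=
  (along (arc N) (arcParam N 0 i) (arcParam N 0 j)).trans (returnPath N hN 0 j i)

open Classical in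
/-- The copy of its axis on which `ξ_i` is placed in the loop in `Conf²` belonging to `ξ_i` and
`ξ_j`: of two points on the same axis the lower one is placed on the left copy, and of two points
on different axes the active one is. -/
def tangleCopy (N : ℕ) : (i j : TangleIdx N) → SignType
  | .inl _, .inr _ => -1
  | .inr _, .inl _ => 1
  | i, j => if height N i < height N j then -1 else 1

/-- The loop in `Conf²(M)` belonging to `ξ_i` and `ξ_j`. -/
def tangleLoop₂ (N : ℕ) (hN : 1 ≤ N) (i j : TangleIdx N) : C(I, ℂ × ℂ) :=
  twoPointLoop (arc N) (arcParam N (tangleCopy N i j) i) (arcParam N (tangleCopy N i j) j)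
    (arcParam N (tangleCopy N j i) j) (returnPath N hN (tangleCopy N i j) j i)

/-- `δ_{i,A}`. -/
def isActive {N : ℕ} : TangleIdx N → ℤ
  | .inl _ => 1
  | .inr _ => 0

/-- `δ_{i,I}`. -/
def isInactive {N : ℕ} : TangleIdx N → ℤ
  | .inl _ => 0
  | .inr _ => 1

/-- The quadratic form `Q^T_{N/1}` of the tangle `τ_{N/1}`. The last point before `X⁺` on the arc,
`ξ_ω`, is the inactive one. -/
def tangleMatrix (N : ℕ) (hN : 1 ≤ N) : Matrix (TangleIdx N) (TangleIdx N) ℤ :=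
  let ω : TangleIdx N := .inr 0
  let Ψ (W : Finset Puncture) (i j : TangleIdx N) : ℤ := psi (tangleLoc N) W (tangleLoop N hN i j)
  let δZ : ℤ := if middle N = .Xplus then 1 else 0
  let diag (i : TangleIdx N) : ℤ := Ψ {.Xminus, .Y} i ω - 3 * Ψ {.Xplus} i ω
    + 2 * δZ * (isInactive i * isActive ω - isActive i * isInactive ω)
  fun i j => if i = j then diag i
    else diag i + (phi (tangleLoop₂ N hN j i) - 2 * Ψ {.Xplus} j i)
      + δZ * (isActive i * isInactive j - isActive j * isInactive i)

/-! ## The closure operation `Cl(T-)` for tangles with orientation `UP` -/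

/-- The strictly upper triangular matrix with all entries above the diagonal equal to `1`. -/
def upper (p : ℕ) : Matrix (Fin p) (Fin p) ℤ := fun i j => if i < j then 1 else 0

/-- The strictly lower triangular matrix with all entries below the diagonal equal to `1`. -/
def lower (p : ℕ) : Matrix (Fin p) (Fin p) ℤ := fun i j => if j < i then 1 else 0

/-- Indices for `4 × 4` block matrices with blocks `𝔄`, `𝔅`, `ℭ`, `𝔇`, in this order. -/
abbrev BlockIdx (p q : ℕ) : Type := (Fin p ⊕ Fin p) ⊕ (Fin q ⊕ Fin q)

/-- The matrix all of whose entries are `1`. -/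
def ones (p q : ℕ) : Matrix (Fin p) (Fin q) ℤ := fun _ _ => 1

/-- The effect of `Cl(T-)` on the quadratic form of a tangle with orientation `UP`, with `p`
active and `q` inactive indices. -/
def closureUP {p q : ℕ} (Q : Matrix (Fin p ⊕ Fin q) (Fin p ⊕ Fin q) ℤ) :
    Matrix (BlockIdx p q) (BlockIdx p q) ℤ :=
  let A := Q.toBlocks₁₁
  let B := Q.toBlocks₁₂
  let C := Q.toBlocks₂₁
  let D := Q.toBlocks₂₂
  Matrix.fromBlocks
    (Matrix.fromBlocks (A - ones p p) (A + upper p) (A + lower p) (A + 2 • ones p p))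
    (Matrix.fromBlocks B (B - ones p q) (B + ones p q) B)
    (Matrix.fromBlocks C (C + ones q p) (C - ones q p) C)
    (Matrix.fromBlocks (D + ones q q) (D + lower q) (D + upper q) D)

/-- The matrix `Q_{2n/1}`, obtained by applying `Cl(T-)` to the data of `τ_{(2n-1)/1}`. -/
def closureMatrix (n : ℕ) (hn : 1 ≤ n) :
    Matrix (BlockIdx (2 * n - 1) 1) (BlockIdx (2 * n - 1) 1) ℤ :=
  closureUP (tangleMatrix (2 * n - 1) (by omega))

/-! ## The link `L_{2n/1}`

The arc `α_{2n/1}` spirals clockwise, in `n` full turns, out of the middle puncture `X⁻` around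
`Y` (left) and `X⁻`, and ends at the right puncture `X⁺`. The blue curve is the boundary of a thin
band around this arc, and the red curve `β'` is the boundary of a band around the segment from
`X⁻` to `X⁺`. -/

/-- The positions of the punctures `Y | X⁻ | X⁺`. -/
def linkLoc (n : ℕ) : Puncture → ℂ
  | .Y => 0
  | .Xminus => 9
  | .Xplus => (16 * n - 1 : ℝ)

/-- The two strands of the blue curve along the arc: `true` is the outer strand (on the left of the
arc oriented from `X⁻` to `X⁺`), `false` is the inner one. -/
def strandSign (b : Bool) : ℝ := if b then 1 else -1

/-- Vertices `0, …, 4n + 5` of a strand, from the end of the band at `X⁻` to the end at `X⁺`. -/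
def strandVertex (n : ℕ) (b : Bool) (m : ℕ) : ℂ :=
  let e := strandSign b
  let r : ℝ := 16 * ((m + 1) / 4 : ℕ) + e
  if m = 0 then ⟨10, 0⟩
  else if m = 1 then ⟨10, -e⟩
  else if m = 2 then ⟨4 + e, -e⟩
  else if m ≤ 4 * n + 2 then
    if (m + 1) % 4 = 0 then ⟨r - 12, -r⟩
    else if (m + 1) % 4 = 1 then ⟨-r, -r⟩
    else if (m + 1) % 4 = 2 then ⟨-r, r⟩
    else ⟨r + 4, r⟩
  else if m = 4 * n + 3 then ⟨16 * n + 4 + e, -e⟩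
  else if m = 4 * n + 4 then ⟨16 * n - 2, -e⟩
  else ⟨16 * n - 2, 0⟩

/-- The blue curve, cut open at the end of the band at `X⁻`: the outer strand from `X⁻` to `X⁺`,
followed by the inner strand back from `X⁺` to `X⁻`. -/
def blue (n : ℕ) : C(ℝ, ℂ) :=
  polyline (fun m => if m ≤ 4 * n + 5 then strandVertex n true m
    else strandVertex n false (8 * n + 10 - m)) (8 * n + 10)

/-- Vertices of copy `d` of the red curve. -/
def redVertex (n : ℕ) (d : SignType) : ℕ → ℂ
  | 1 => ⟨16 * n + 1 + d, -(3 + d)⟩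
  | 2 => ⟨7 - d, -(3 + d)⟩
  | 3 => ⟨7 - d, 3 + d⟩
  | 4 => ⟨16 * n + 1 + d, 3 + d⟩
  | _ => ⟨16 * n + 1 + d, 0⟩

/-- The red curve `β'` (`d = 0`), its inner parallel copy `β'₁` (`d = -1`) and its outer parallel
copy `β'₂` (`d = 1`), cut open at the point where the arc meets it next to `X⁺`, and run through
clockwise from there. -/
def red (n : ℕ) (d : SignType) : C(ℝ, ℂ) := polyline (redVertex n d) 5

/-- Indices of the intersection points of the blue curve with the red one, in the standard
ordering: `𝔄` and `𝔅` are indexed by `Fin (2n - 1)`, and `ℭ` and `𝔇` have one element each. -/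
abbrev LinkIdx (n : ℕ) : Type := BlockIdx (2 * n - 1) 1

/-- The strand of an intersection point: `𝔄` and `𝔇` lie on the outer strand, which contains the
lower one of the two points next to `X⁻` (this is `λ_1`) and the lower one of the two points next
to `X⁺` (this is `λ_ω = λ_{4n}`). `𝔅` and `ℭ` lie on the inner strand. -/
def strand (n : ℕ) : LinkIdx n → Bool
  | .inl (.inl _) => true
  | .inl (.inr _) => false
  | .inr (.inl _) => false
  | .inr (.inr _) => true

/-- The position of an intersection point among the `2n` intersection points on its strand,
counted from `0` and from `X⁻` to `X⁺`. -/
def position (n : ℕ) : LinkIdx n → ℕ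
  | .inl (.inl i) => i
  | .inl (.inr i) => i
  | .inr _ => 2 * n - 1

/-- The parameter, on the strand `b`, of its intersection point number `j` with copy `d` of the red
curve. -/
def strandParam (n : ℕ) (d : SignType) (b : Bool) (j : ℕ) : ℝ :=
  let e := strandSign b
  let k : ℝ := ((j + 1) / 2 : ℕ)
  if j = 2 * n - 1 then 4 * n + 3 + (3 + e - d) / (6 + e)
  else if j = 0 then 1 + (3 + d) / (6 - e)
  else if j % 2 = 1 then 4 * k + 2 + (16 * k + e - (3 + d)) / (32 * k + 16 + 2 * e)
  else 4 * k + 2 + (16 * k + e + (3 + d)) / (32 * k + 16 + 2 * e)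

/-- The parameter of an intersection point on the blue curve. -/
def blueParam (n : ℕ) (d : SignType) (i : LinkIdx n) : ℝ :=
  let s := strandParam n d (strand n i) (position n i)
  if strand n i then s else 8 * n + 10 - s

/-- The parameter of an intersection point on copy `d` of the red curve. -/
def redParam (n : ℕ) (d : SignType) (i : LinkIdx n) : ℝ :=
  let e := strandSign (strand n i)
  let j := position n i
  let k : ℝ := ((j + 1) / 2 : ℕ)
  let w : ℝ := 16 * n - 6 + 2 * d
  if j = 2 * n - 1 then (if strand n i then 1 / (3 + d) else 5 - 1 / (3 + d))
  else if j = 0 then 2 + (3 + d - e) / (2 * (3 + d))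
  else if j % 2 = 1 then 3 + (16 * k - 3 + e + d) / w
  else 1 + (16 * n - 3 - 16 * k - e + d) / w

theorem strandSign_mem (b : Bool) : strandSign b = 1 ∨ strandSign b = -1 := by
  cases b <;> simp [strandSign]

theorem strandVertex_end (n : ℕ) (b : Bool) : strandVertex n b (4 * n + 5) = ⟨16 * n - 2, 0⟩ := by
  simp [strandVertex]

theorem blue_strand (n : ℕ) (b : Bool) {m : ℕ} {s x a c a' c' : ℝ}
    (h : strandVertex n b m = ⟨a, c⟩) (h' : strandVertex n b (m + 1) = ⟨a', c'⟩)
    (hm : m < 4 * n + 5) (hs : s = m + x) (h0 : 0 ≤ x) (h1 : x ≤ 1) :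
    blue n (if b then s else 8 * n + 10 - s) = ⟨a + x * (a' - a), c + x * (c' - c)⟩ := by
  cases b
  · have hm' : ((8 * n + 9 - m : ℕ) : ℝ) = 8 * n + 9 - m := by
      rw [Nat.cast_sub (by omega)]
      push_cast
      ring
    rw [blue, polyline_mk _ (k := 8 * n + 9 - m) (x := 1 - x) (a := a') (b := c') (a' := a)
      (b' := c) ?_ ?_ (by omega) (by rw [hm', hs]; simp; ring) (by linarith) (by linarith)]
    · congr 1 <;> ring
    · by_cases hme : m = 4 * n + 4
      · subst hme
        rw [show 8 * n + 9 - (4 * n + 4) = 4 * n + 5 by omega]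
        rw [strandVertex_end] at h'
        simp only [le_refl, if_true]
        rw [strandVertex_end, h']
      · simp only [show ¬ 8 * n + 9 - m ≤ 4 * n + 5 by omega, if_false]
        rw [show 8 * n + 10 - (8 * n + 9 - m) = m + 1 by omega, h']
    · simp only [show ¬ 8 * n + 9 - m + 1 ≤ 4 * n + 5 by omega, if_false]
      rw [show 8 * n + 10 - (8 * n + 9 - m + 1) = m by omega, h]
  · rw [blue, polyline_mk _ (k := m) (x := x) (a := a) (b := c) (a' := a')
      (b' := c') ?_ ?_ (by omega) (by simpa using hs) h0 h1]
    · simp only [show m ≤ 4 * n + 5 by omega, if_true, h]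
    · simp only [show m + 1 ≤ 4 * n + 5 by omega, if_true, h']

theorem red_side (n : ℕ) (d : SignType) {k : ℕ} {t x a b a' b' : ℝ} (h : redVertex n d k = ⟨a, b⟩)
    (h' : redVertex n d (k + 1) = ⟨a', b'⟩) (hk : k < 5) (ht : t = k + x) (h0 : 0 ≤ x)
    (h1 : x ≤ 1) : red n d t = ⟨a + x * (a' - a), b + x * (b' - b)⟩ :=
  polyline_mk _ h h' hk ht h0 h1

theorem blue_blueParam (n : ℕ) (d : SignType) (i : LinkIdx n) :
    blue n (blueParam n d i) = red n d (redParam n d i) := by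
  obtain ⟨hd, hd'⟩ := signType_mem d
  have hh : (0 : ℝ) < 3 + d := by linarith
  have hn0 : (0 : ℝ) ≤ n := Nat.cast_nonneg n
  have hp : position n i = 2 * n - 1 ∨ position n i < 2 * n - 1 := by
    rcases i with (⟨i, hi⟩ | ⟨i, hi⟩) | i <;> simp [position] <;> omega
  simp only [blueParam, redParam]
  generalize position n i = j at *
  generalize strand n i = b
  have he := strandSign_mem b
  have he1 : -1 ≤ strandSign b ∧ strandSign b ≤ 1 := by
    rcases he with h | h <;> rw [h] <;> norm_num
  obtain ⟨he1, he2⟩ := he1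
  rcases hp with rfl | hj
  · -- next to the right puncture
    have e1 : strandVertex n b (4 * n + 3) = ⟨16 * n + 4 + strandSign b, -strandSign b⟩ := by
      simp [strandVertex]
    have e2 : strandVertex n b (4 * n + 3 + 1) = ⟨16 * n - 2, -strandSign b⟩ := by
      simp [strandVertex]
    rw [blue_strand n b e1 e2 (by omega) (x := (3 + strandSign b - d) / (6 + strandSign b))
      (by simp [strandParam]) (div_nonneg (by linarith) (by linarith))
      (by rw [div_le_one (by linarith)]; linarith)]
    have hx : (0 : ℝ) ≤ 1 / (3 + d) := by positivity
    have hx' : 1 / (3 + (d : ℝ)) ≤ 1 := by rw [div_le_one hh]; linarith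
    have h6 : (6 : ℝ) + strandSign b ≠ 0 := by
      intro h
      linarith
    simp only [if_true]
    cases b
    · rw [red_side n d (k := 4) (x := 1 - 1 / (3 + d)) rfl rfl (by norm_num)
        (by simp; ring) (by linarith) (by linarith)]
      apply Complex.ext
      · simp only
        field_simp
        ring
      · simp only [strandSign]
        field_simp
        simp
        ring
    · rw [red_side n d (k := 0) (x := 1 / (3 + d)) rfl rfl (by norm_num)
        (by simp) hx hx']
      apply Complex.ext
      · simp only
        field_simp
        ring
      · simp only [strandSign]
        field_simp
        simp
  simp only [hj.ne, if_false]
  have hn : 1 ≤ n := by omega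
  have hn1 : (1 : ℝ) ≤ n := by exact_mod_cast hn
  rcases Nat.eq_zero_or_pos j with rfl | hj0
  · -- next to the middle puncture
    have e1 : strandVertex n b 1 = ⟨10, -strandSign b⟩ := by
      simp [strandVertex]
    have e2 : strandVertex n b (1 + 1) = ⟨4 + strandSign b, -strandSign b⟩ := by
      simp [strandVertex]
    rw [blue_strand n b e1 e2 (by omega) (x := (3 + d) / (6 - strandSign b))
      (by simp [strandParam, hj.ne]) (div_nonneg (by linarith) (by linarith))
      (by rw [div_le_one (by linarith)]; linarith)]
    simp only [if_true]
    rw [red_side n d (k := 2) (x := (3 + d - strandSign b) / (2 * (3 + d))) rfl rfl (by norm_num)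
      (by simp) (div_nonneg (by linarith) (by linarith))
      (by rw [div_le_one (by linarith)]; linarith)]
    have h6 : (6 : ℝ) - strandSign b ≠ 0 := by
      intro h
      linarith
    apply Complex.ext
    · simp only
      field_simp
      ring
    · simp only
      field_simp
      ring
  obtain ⟨k, hk0, hkn, hk⟩ : ∃ k, 1 ≤ k ∧ k + 1 ≤ n ∧ (j = 2 * k - 1 ∨ j = 2 * k) := by
    refine ⟨(j + 1) / 2, ?_, ?_, ?_⟩ <;> omega
  have hk1 : (1 : ℝ) ≤ k := by exact_mod_cast hk0
  have hkn1 : (k : ℝ) + 1 ≤ n := by exact_mod_cast hkn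
  have hjk : (j + 1) / 2 = k := by omega
  have e1 : strandVertex n b (4 * k + 2) =
      ⟨16 * k + 4 + strandSign b, 16 * k + strandSign b⟩ := by
    have a1 : (4 * k + 2 + 1) / 4 = k := by omega
    have a2 : (4 * k + 2 + 1) % 4 = 3 := by omega
    simp only [strandVertex, a1, a2]
    simp [show k ≠ 0 by omega, show k ≤ n by omega]
    ring
  have e2 : strandVertex n b (4 * k + 2 + 1) =
      ⟨16 * k + 4 + strandSign b, -(16 * k + 16 + strandSign b)⟩ := by
    have a1 : (4 * k + 2 + 1 + 1) / 4 = k + 1 := by omega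
    have a2 : (4 * k + 2 + 1 + 1) % 4 = 0 := by omega
    have a3 : 4 * k + 2 + 1 ≤ 4 * n + 2 := by omega
    simp only [strandVertex, a1, a2, a3]
    simp
    constructor <;> ring
  have hw : (0 : ℝ) < 16 * n - 6 + 2 * d := by linarith
  have hv : (0 : ℝ) < 32 * k + 16 + 2 * strandSign b := by linarith
  rcases hk with hk | hk
  · have hj2 : j % 2 = 1 := by omega
    rw [blue_strand n b e1 e2 (by omega)
      (x := (16 * k + strandSign b - (3 + d)) / (32 * k + 16 + 2 * strandSign b))
      (by simp [strandParam, hj.ne, hj0.ne', hj2, hjk]) (div_nonneg (by linarith) (by linarith))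
      (by rw [div_le_one (by linarith)]; linarith)]
    simp only [hj0.ne', hj2, hjk, if_true, if_false]
    rw [red_side n d (k := 3) (x := (16 * k - 3 + strandSign b + d) / (16 * n - 6 + 2 * d)) rfl rfl
      (by norm_num) (by simp) (div_nonneg (by linarith) (by linarith))
      (by rw [div_le_one (by linarith)]; linarith)]
    have h1 := div_mul_cancel₀ (16 * (k : ℝ) - 3 + strandSign b + d) hw.ne'
    have h2 := div_mul_cancel₀ (16 * (k : ℝ) + strandSign b - (3 + d)) hv.ne'
    apply Complex.ext
    · simp only
      linear_combination - h1
    · simp only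
      linear_combination - h2
  · have hj2 : ¬ j % 2 = 1 := by omega
    rw [blue_strand n b e1 e2 (by omega)
      (x := (16 * k + strandSign b + (3 + d)) / (32 * k + 16 + 2 * strandSign b))
      (by simp [strandParam, hj.ne, hj0.ne', hj2, hjk]) (div_nonneg (by linarith) (by linarith))
      (by rw [div_le_one (by linarith)]; linarith)]
    simp only [hj0.ne', hj2, hjk, if_false]
    rw [red_side n d (k := 1) (x := (16 * n - 3 - 16 * k - strandSign b + d)
      / (16 * n - 6 + 2 * d)) rfl rfl
      (by norm_num) (by simp) (div_nonneg (by linarith) (by linarith))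
      (by rw [div_le_one (by linarith)]; linarith)]
    have h1 := div_mul_cancel₀ (16 * (n : ℝ) - 3 - 16 * k - strandSign b + d) hw.ne'
    have h2 := div_mul_cancel₀ (16 * (k : ℝ) + strandSign b + (3 + d)) hv.ne'
    apply Complex.ext
    · simp only
      linear_combination  h1
    · simp only
      linear_combination - h2

/-- The intersection points `λ_i` of the blue curve and the red curve. -/
def lam (n : ℕ) (i : LinkIdx n) : ℂ := blue n (blueParam n 0 i)

/-- The path from `λ_j` back to `λ_i` along copy `d` of the red curve, missing its hole. -/
def redPath (n : ℕ) (d : SignType) (j i : LinkIdx n) :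
    Path (blue n (blueParam n d j)) (blue n (blueParam n d i)) :=
  (along (red n d) (redParam n d j) (redParam n d i)).cast
    (blue_blueParam n d j) (blue_blueParam n d i)

/-- The loop `γ^L_{i,j}` in `M`. -/
def linkLoop (n : ℕ) (i j : LinkIdx n) : Path (lam n i) (lam n i) :=
  (along (blue n) (blueParam n 0 i) (blueParam n 0 j)).trans (redPath n 0 j i)

open Classical in
/-- The copy of the red curve on which `λ_i` is placed in the loop in `Conf²` belonging to `λ_i`
and `λ_j`: the point that comes first on the red curve, run through clockwise from `λ_ω`, is placed
on the outer copy and the other one on the inner copy. -/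
def linkCopy (n : ℕ) (i j : LinkIdx n) : SignType :=
  if redParam n 0 i < redParam n 0 j then 1 else -1

/-- The loop in `Conf²(M)` belonging to `λ_i` and `λ_j`. -/
def linkLoop₂ (n : ℕ) (i j : LinkIdx n) : C(I, ℂ × ℂ) :=
  twoPointLoop (blue n) (blueParam n (linkCopy n i j) i) (blueParam n (linkCopy n i j) j)
    (blueParam n (linkCopy n j i) j) (redPath n (linkCopy n i j) j i)

/-! ### The correction term of the quadratic form -/

/-- The orientation types of rational tangles. -/
inductive Orientation
  | UP
  | OP
  | RI

/-- Top and right twists. -/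
inductive Twist
  | T
  | R

/-- The contribution to `μ₃` of a list of twists, applied from left to right to a tangle `τ_{u/v}`
with the given orientation: `#{RUP, ROP⁻} - #{TOP⁺, TRI, RRI}`, where `OP⁺` means `OP` with `u > v`
and `OP⁻` means `OP` with `u < v`. -/
def mu₃Aux : Orientation → ℕ → ℕ → List Twist → ℤ
  | _, _, _, [] => 0
  | .UP, u, v, .T :: l => mu₃Aux .UP (u + v) v l
  | .OP, u, v, .T :: l => (if v < u then -1 else 0) + mu₃Aux .RI (u + v) v l
  | .RI, u, v, .T :: l => -1 + mu₃Aux .OP (u + v) v l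
  | .UP, u, v, .R :: l => 1 + mu₃Aux .OP u (u + v) l
  | .OP, u, v, .R :: l => (if u < v then 1 else 0) + mu₃Aux .UP u (u + v) l
  | .RI, u, v, .R :: l => -1 + mu₃Aux .RI u (u + v) l

/-- `μ₃(L_{2n/1})`, computed from the twists that build `τ_{(2n-1)/1} = T^{2n-1} τ_{0/1}`. -/
def mu₃ (n : ℕ) : ℤ := mu₃Aux .UP 0 1 (List.replicate (2 * n - 1) .T)

/-- The matrix `Q^L_{2n/1}` computed from the geometry of the link, in the standard ordering. -/
def linkMatrix (n : ℕ) : Matrix (LinkIdx n) (LinkIdx n) ℤ :=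
  let ω : LinkIdx n := .inr (.inr 0)
  let Ψ (W : Finset Puncture) (i j : LinkIdx n) : ℤ := psi (linkLoc n) W (linkLoop n i j)
  let diag (i : LinkIdx n) : ℤ := Ψ {.Xminus, .Y} i ω - 3 * Ψ {.Xplus} i ω + mu₃ n
  fun i j => if i = j then diag i
    else diag i + (phi (linkLoop₂ n j i) - 2 * Ψ {.Xplus} j i)

/-! ### Well-posedness of the pictures -/

/-- The listed points are exactly the intersections of the arc with the two axes, and the loops
lie in `M` and in `Conf²(M)`. -/
def TangleWellPosed (N : ℕ) (hN : 1 ≤ N) : Prop :=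
  Set.BijOn (fun k : Fin N => arc N (arcParam N 0 (.inl k))) Set.univ
    (Set.range (arc N) ∩ {z | z.re = 0}) ∧
  Set.BijOn (fun k : Fin 1 => arc N (arcParam N 0 (.inr k))) Set.univ
    (Set.range (arc N) ∩ {z | z.re = 4 * N + 2}) ∧
  (∀ i j t, tangleLoop N hN i j t ∈ puncturedPlane (tangleLoc N)) ∧
  ∀ i j, i ≠ j → ∀ t, tangleLoop₂ N hN i j t ∈ confTwo (tangleLoc N)

/-- The listed points are exactly the intersections of the blue curve with the red curve, and the
loops lie in `M` and in `Conf²(M)`. -/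
def LinkWellPosed (n : ℕ) : Prop :=
  Set.BijOn (lam n) Set.univ (Set.range (blue n) ∩ Set.range (red n 0)) ∧
  (∀ i j t, linkLoop n i j t ∈ puncturedPlane (linkLoc n)) ∧
  ∀ i j, i ≠ j → ∀ t, linkLoop₂ n i j t ∈ confTwo (linkLoc n)

end RationalTorusLink

end

/-!
# The matrices of the torus links `2n/1` and of their closing tangles

The curves are polygonal, so all winding numbers are computed by covering the directions of the
plane by four half planes (right, below, left, above, numbered clockwise; `InHalf`). On each of
them there is a branch of the clockwise angle for every integer in the residue class of its number
(`ang`), and two branches whose numbers differ by at most two agree where both half planes apply.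
A point `p` sees each side of a polygonal curve that avoids it in some half plane, and the change
of the angle along the curve is read off from a list of integers, one for each side, in which
neighbours differ by at most two (`turns_polyline`). In the same way the class in `Br₂` of a loop
of the exchange rule depends on four such integers only: the half planes in which the moving point
starts and arrives, as seen from the resting one, and those at the two ends of the return path
(`twoPointLoop_phi`). Whether the two points are exchanged is decided by the half plane of arrival:
it tells which of the two copies of the end point is reached first.

*The tangle.* The arc is a spiral. From each of its points the earlier part is seen on the inner
side, and the later part starts ahead and then winds around the point, one half turn for each
crossing (`turns_back`, `turns_ahead`); the return path stays in a half plane. Hence `Φ` vanishes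
if the moving point comes earlier, and otherwise it is minus the difference of the ranks.
The entry of the matrix at `i, j` is `N - 1 - max (rank i) (rank j)` (`tangleMatrix_eq`), the rank
being the number of a crossing from `0` on, where the inactive point counts like the last active
one.

*The link.* A strand of the blue curve leaves the red rectangle through its left side, crosses its
upper and its lower side on each descending side of the spiral after the first one, and ends after
a crossing of the right side. A point with `κ` of these descending sides on its left sees the strand
swing to and fro up to the last one of them, and wind around the point afterwards (`turnIdx`,
`sees_spiral`). This applies to the intersection points and both strands (`sees_before`,
`sees_after`, `sees_other`) and to the
punctures (`sees_lookIdx`). The cut red curve is a rectangle: from inside it is seen once around,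
from outside in a single half plane (`InsideRed.turns`, `redPath_lifts`). Of two parallel copies the
inner one is seen from the outer one in a half plane, and the outer one is seen from the inner one
from inside. This gives `Φ` of all exchange loops (`linkLoop₂_phi`, with the values `linkPhi`) and
their winding numbers about the punctures (`psi_linkLoop`, as differences of the integers `sheet`).
The correction `μ₃` is zero, and the matrices are compared block by block
(`linkMatrix_eq_closureMatrix`).

All loops avoid the punctures, and their two points avoid each other, because a point that sees a
curve with a continuous angle does not lie on it. That there are no further intersection points is
checked on each side of the strands (`eq_spot_of_mem`).
-/

noncomputable section

namespace RationalTorusLink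

/-! ### Half planes and branches of the clockwise angle -/

/-- `z` lies in the open half plane around the direction reached from the positive real axis by
`a` clockwise quarter turns: right, below, left, above for `a = 0, 1, 2, 3` modulo `4`. -/
def InHalf (a : ℤ) (z : ℂ) : Prop := 0 < (z * Complex.I ^ a).re

/-- The branch of the clockwise angle of `z` that is continuous on the half plane number `a`, with
values there between `(a - 1) π / 2` and `(a + 1) π / 2`. -/
def ang (a : ℤ) (z : ℂ) : ℝ := a * (Real.pi / 2) - Complex.arg (z * Complex.I ^ a)

theorem I_zpow_add_four_mul (a m : ℤ) : Complex.I ^ (a + 4 * m) = Complex.I ^ a := by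
  rw [zpow_add₀ Complex.I_ne_zero, zpow_mul]
  have : Complex.I ^ (4 : ℤ) = 1 := by
    rw [show (4 : ℤ) = ((4 : ℕ) : ℤ) by rfl, zpow_natCast, Complex.I_pow_four]
  rw [this, one_zpow, mul_one]

theorem I_zpow_add_two (a : ℤ) : Complex.I ^ (a + 2) = -Complex.I ^ a := by
  rw [zpow_add₀ Complex.I_ne_zero]
  have : Complex.I ^ (2 : ℤ) = -1 := by
    rw [show (2 : ℤ) = ((2 : ℕ) : ℤ) by rfl, zpow_natCast, Complex.I_sq]
  rw [this, mul_neg_one]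

theorem inHalf_congr {a b : ℤ} (h : a % 4 = b % 4) (z : ℂ) : InHalf a z ↔ InHalf b z := by
  obtain ⟨m, rfl⟩ : ∃ m, a = b + 4 * m := ⟨(a - b) / 4, by omega⟩
  rw [InHalf, InHalf, I_zpow_add_four_mul]

theorem inHalf_right {a : ℤ} (h : a % 4 = 0) {z : ℂ} : InHalf a z ↔ 0 < z.re := by
  rw [inHalf_congr (b := 0) h, InHalf]
  simp

theorem inHalf_below {a : ℤ} (h : a % 4 = 1) {z : ℂ} : InHalf a z ↔ z.im < 0 := by
  rw [inHalf_congr (b := 1) h, InHalf]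
  simp

theorem inHalf_left {a : ℤ} (h : a % 4 = 2) {z : ℂ} : InHalf a z ↔ z.re < 0 := by
  rw [inHalf_congr (b := 0 + 2) (by omega), InHalf, I_zpow_add_two]
  simp

theorem inHalf_above {a : ℤ} (h : a % 4 = 3) {z : ℂ} : InHalf a z ↔ 0 < z.im := by
  rw [inHalf_congr (b := 1 + 2) (by omega), InHalf, I_zpow_add_two]
  simp

theorem inHalf_neg {a : ℤ} {z : ℂ} : InHalf (a + 2) (-z) ↔ InHalf a z := by
  rw [InHalf, InHalf, I_zpow_add_two, neg_mul_neg]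

theorem InHalf.ne_zero {a : ℤ} {z : ℂ} (h : InHalf a z) : z ≠ 0 := by
  rintro rfl
  simp [InHalf] at h

theorem ang_add_four_mul (a m : ℤ) (z : ℂ) : ang (a + 4 * m) z = ang a z + 2 * Real.pi * m := by
  rw [ang, ang, I_zpow_add_four_mul]
  push_cast
  ring

theorem ang_add_two_neg (a : ℤ) (z : ℂ) : ang (a + 2) (-z) = ang a z + Real.pi := by
  rw [ang, ang, I_zpow_add_two, neg_mul_neg]
  push_cast
  ring

theorem ang_succ {a : ℤ} {z : ℂ} (h : InHalf a z) :
    ang (a + 1) z = ang a z := by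
  have e : z * Complex.I ^ (a + 1) = z * Complex.I ^ a * Complex.I := by
    rw [zpow_add_one₀ Complex.I_ne_zero, mul_assoc]
  have h1 : |Complex.arg (z * Complex.I ^ a)| < Real.pi / 2 :=
    Complex.abs_arg_lt_pi_div_two_iff.mpr (Or.inl h)
  rw [abs_lt] at h1
  have hne : z * Complex.I ^ a ≠ 0 := by
    intro h0
    rw [InHalf, h0] at h
    simp at h
  rw [ang, ang, e, Complex.arg_mul hne Complex.I_ne_zero, Complex.arg_I]
  · push_cast
    ring
  · rw [Complex.arg_I]
    exact ⟨by linarith [Real.pi_pos], by linarith⟩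

theorem InHalf.not_add_two {a : ℤ} {z : ℂ} (h : InHalf a z) : ¬ InHalf (a + 2) z := by
  intro h'
  rw [InHalf] at h h'
  rw [I_zpow_add_two] at h'
  simp only [mul_neg, Complex.neg_re] at h'
  linarith

/-- Two branches agree at a point of both half planes if they are less than a full turn apart. -/
theorem ang_eq {a b : ℤ} {z : ℂ} (ha : InHalf a z) (hb : InHalf b z) (hab : |a - b| ≤ 2) :
    ang a z = ang b z := by
  rw [abs_le] at hab
  have : b = a ∨ b = a + 1 ∨ a = b + 1 ∨ b = a + 2 ∨ a = b + 2 := by omega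
  rcases this with rfl | rfl | rfl | rfl | rfl
  · rfl
  · exact (ang_succ ha).symm
  · exact ang_succ hb
  · exact absurd hb ha.not_add_two
  · exact absurd ha hb.not_add_two

/-- `x` is a clockwise angle of `z`. -/
def IsAngle (z : ℂ) (x : ℝ) : Prop := z ≠ 0 ∧ z = ‖z‖ * Complex.exp (-(x : ℂ) * Complex.I)

theorem IsAngle.neg {z : ℂ} {x : ℝ} (h : IsAngle z x) : IsAngle (-z) (x + Real.pi) := by
  refine ⟨neg_ne_zero.mpr h.1, ?_⟩
  have e : (-((x + Real.pi : ℝ) : ℂ)) * Complex.I = -(x : ℂ) * Complex.I - Real.pi * Complex.I := by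
    push_cast
    ring
  rw [e, Complex.exp_sub, Complex.exp_pi_mul_I, norm_neg]
  conv_lhs => rw [h.2]
  ring

theorem IsAngle.add_turns {z : ℂ} {x : ℝ} (h : IsAngle z x) (m : ℤ) :
    IsAngle z (x + 2 * Real.pi * m) := by
  refine ⟨h.1, ?_⟩
  have e : (-((x + 2 * Real.pi * m : ℝ) : ℂ)) * Complex.I =
      -(x : ℂ) * Complex.I - m * (2 * Real.pi * Complex.I) := by
    push_cast
    ring
  rw [e, Complex.exp_sub, Complex.exp_int_mul_two_pi_mul_I, div_one]
  exact h.2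

theorem isAngle_ang (a : ℤ) {z : ℂ} (hz : z ≠ 0) : IsAngle z (ang a z) := by
  refine ⟨hz, ?_⟩
  have hI : ∀ b : ℤ, Complex.exp (-(b * (Real.pi / 2)) * Complex.I) * Complex.I ^ b = 1 := by
    intro b
    have : Complex.I ^ b = Complex.exp (b * (Real.pi / 2 * Complex.I)) := by
      rw [Complex.exp_int_mul, Complex.exp_pi_div_two_mul_I]
    rw [this, ← Complex.exp_add]
    simp [mul_assoc]
  have hn : ‖z * Complex.I ^ a‖ = ‖z‖ := by simp
  have h1 := Complex.norm_mul_exp_arg_mul_I (z * Complex.I ^ a)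
  rw [hn] at h1
  have e : (-((ang a z : ℝ) : ℂ)) * Complex.I = -(a * (Real.pi / 2)) * Complex.I +
      Complex.arg (z * Complex.I ^ a) * Complex.I := by
    rw [ang]
    push_cast
    ring
  rw [e, Complex.exp_add]
  calc z = z * (Complex.exp (-(a * (Real.pi / 2)) * Complex.I) * Complex.I ^ a) := by
        rw [hI, mul_one]
    _ = Complex.exp (-(a * (Real.pi / 2)) * Complex.I) * (z * Complex.I ^ a) := by ring
    _ = Complex.exp (-(a * (Real.pi / 2)) * Complex.I) *
        (‖z‖ * Complex.exp (Complex.arg (z * Complex.I ^ a) * Complex.I)) := by rw [h1]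
    _ = _ := by ring

theorem InHalf.continuousAt_ang {a : ℤ} {z : ℂ} (h : InHalf a z) : ContinuousAt (ang a) z := by
  have h1 : z * Complex.I ^ a ∈ Complex.slitPlane := Or.inl h
  have h2 : ContinuousAt (fun w : ℂ => w * Complex.I ^ a) z := by fun_prop
  have h3 : ContinuousAt (fun w : ℂ => Complex.arg (w * Complex.I ^ a)) z :=
    ContinuousAt.comp (g := Complex.arg) (Complex.continuousAt_arg h1) h2
  exact continuousAt_const.sub h3

theorem InHalf.convexComb {a : ℤ} {z w : ℂ} (hz : InHalf a z) (hw : InHalf a w) {r s : ℝ}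
    (hr : 0 ≤ r) (hs : 0 ≤ s) (hrs : r + s = 1) : InHalf a (r * z + s * w) := by
  rw [InHalf] at *
  have e : ((r * z + s * w) * Complex.I ^ a).re =
      r * (z * Complex.I ^ a).re + s * (w * Complex.I ^ a).re := by
    rw [add_mul, mul_assoc, mul_assoc, Complex.add_re, Complex.re_ofReal_mul,
      Complex.re_ofReal_mul]
  rw [e]
  rcases hr.eq_or_lt with rfl | hr
  · have : s = 1 := by linarith
    rw [this]
    linarith
  · have := mul_nonneg hs hw.le
    have := mul_pos hr hz
    linarith

/-! ### Following the angle along a parametrized curve -/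

/-- The clockwise angle of `f`, followed continuously from time `s` to time `t`, changes from `x`
to `y`; in particular `f` does not vanish between `s` and `t`. -/
def Turns (f : ℝ → ℂ) (s t x y : ℝ) : Prop :=
  ∃ θ : ℝ → ℝ, ContinuousOn θ (Set.uIcc s t) ∧ (∀ u ∈ Set.uIcc s t, IsAngle (f u) (θ u)) ∧
    θ s = x ∧ θ t = y

theorem Turns.symm {f : ℝ → ℂ} {s t x y : ℝ} (h : Turns f s t x y) : Turns f t s y x := by
  obtain ⟨θ, h1, h2, h3, h4⟩ := h
  rw [Set.uIcc_comm] at h1 h2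
  exact ⟨θ, h1, h2, h4, h3⟩

theorem Turns.ne_zero {f : ℝ → ℂ} {s t x y : ℝ} (h : Turns f s t x y) {u : ℝ}
    (hu : u ∈ Set.uIcc s t) : f u ≠ 0 := by
  obtain ⟨θ, -, h2, -⟩ := h
  exact (h2 u hu).1

theorem Turns.trans_of_le {f : ℝ → ℂ} {s u t x y w : ℝ} (h : Turns f s u x y)
    (h' : Turns f u t y w) (hsu : s ≤ u) (hut : u ≤ t) : Turns f s t x w := by
  obtain ⟨θ, h1, h2, h3, h4⟩ := h
  obtain ⟨η, k1, k2, k3, k4⟩ := h'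
  rw [Set.uIcc_of_le hsu] at h1 h2
  rw [Set.uIcc_of_le hut] at k1 k2
  refine ⟨fun r => if r ≤ u then θ r else η r, ?_, ?_, ?_, ?_⟩
  · rw [Set.uIcc_of_le (hsu.trans hut)]
    apply ContinuousOn.if
    · intro a ha
      have hau : a = u := by
        have := ha.2
        rw [show {a : ℝ | a ≤ u} = Set.Iic u from rfl, frontier_Iic] at this
        exact this
      rw [hau, h4, k3]
    · apply h1.mono
      rintro a ⟨ha, ha'⟩
      rw [show {a : ℝ | a ≤ u} = Set.Iic u from rfl, closure_Iic] at ha'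
      exact ⟨ha.1, ha'⟩
    · apply k1.mono
      rintro a ⟨ha, ha'⟩
      rw [show {a : ℝ | ¬ a ≤ u} = Set.Ioi u by ext; simp, closure_Ioi] at ha'
      exact ⟨ha', ha.2⟩
  · intro r hr
    rw [Set.uIcc_of_le (hsu.trans hut)] at hr
    by_cases hru : r ≤ u
    · simpa [hru] using h2 r ⟨hr.1, hru⟩
    · simpa [hru] using k2 r ⟨(not_le.mp hru).le, hr.2⟩
  · simp [hsu, h3]
  · rcases hut.eq_or_lt with rfl | hut
    · simp [h4, ← k3, ← k4]
    · simp [not_le.mpr hut, k4]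

theorem Turns.trans {f : ℝ → ℂ} {s u t x y w : ℝ} (h : Turns f s u x y)
    (h' : Turns f u t y w) (hu : u ∈ Set.uIcc s t) : Turns f s t x w := by
  rcases Set.mem_uIcc.mp hu with ⟨h1, h2⟩ | ⟨h1, h2⟩
  · exact h.trans_of_le h' h1 h2
  · exact (h'.symm.trans_of_le h.symm h1 h2).symm

/-- Following the angle along a curve run through with another affine parameter. -/
theorem Turns.comp_affine {f g : ℝ → ℂ} {s t x y : ℝ} (h : Turns f s t x y) (c r : ℝ)
    (hg : ∀ u ∈ Set.uIcc s t, g (c + r * u) = f u) (hr : r ≠ 0) :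
    Turns g (c + r * s) (c + r * t) x y := by
  obtain ⟨θ, h1, h2, h3, h4⟩ := h
  have hm : Set.MapsTo (fun v : ℝ => (v - c) / r) (Set.uIcc (c + r * s) (c + r * t))
      (Set.uIcc s t) := by
    intro v hv
    have hc : Set.uIcc (c + r * s) (c + r * t) = (fun v => c + r * v) '' Set.uIcc s t := by
      rw [← Set.image_image (fun v => c + v) (fun v => r * v), Set.image_const_mul_uIcc,
        Set.image_const_add_uIcc]
    rw [hc] at hv
    obtain ⟨w, hw, rfl⟩ := hv
    simpa [hr] using hw
  refine ⟨fun v => θ ((v - c) / r), ?_, ?_, ?_, ?_⟩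
  · exact h1.comp (by fun_prop) hm
  · intro v hv
    have := h2 _ (hm hv)
    rw [← hg _ (hm hv)] at this
    rwa [show c + r * ((v - c) / r) = v by field_simp; ring] at this
  · simpa [hr] using h3
  · simpa [hr] using h4

theorem turns_of_inHalf {f : ℝ → ℂ} (hf : Continuous f) {s t : ℝ} {a : ℤ}
    (h : ∀ u ∈ Set.uIcc s t, InHalf a (f u)) : Turns f s t (ang a (f s)) (ang a (f t)) := by
  refine ⟨fun u => ang a (f u), ?_, ?_, rfl, rfl⟩
  · intro u hu
    exact (ContinuousAt.comp (g := ang a) (h u hu).continuousAt_ang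
      hf.continuousAt).continuousWithinAt
  · intro u hu
    exact isAngle_ang a (h u hu).ne_zero

/-- A polygonal curve is seen from `p` under an angle that can be read off from half planes
containing its sides: it suffices that every vertex passed lies in the half planes `q m`, `q (m+1)`
chosen for the two sides that meet there. -/
theorem turns_polyline (v : ℕ → ℂ) {M : ℕ} (p : ℂ) (q : ℕ → ℤ) {i j : ℕ} (hij : i ≤ j)
    (hj : j < M) {s t : ℝ} (hs0 : i ≤ s) (hs1 : s ≤ i + 1) (ht0 : j ≤ t) (ht1 : t ≤ j + 1)
    (hst : s ≤ t)
    (hs : InHalf (q i) (polyline v M s - p)) (ht : InHalf (q j) (polyline v M t - p))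
    (hv : ∀ m, i ≤ m → m < j → InHalf (q m) (v (m + 1) - p) ∧
      InHalf (q (m + 1)) (v (m + 1) - p) ∧ |q m - q (m + 1)| ≤ 2) :
    Turns (fun u => polyline v M u - p) s t (ang (q i) (polyline v M s - p))
      (ang (q j) (polyline v M t - p)) := by
  have side : ∀ k < M, ∀ a b : ℝ, k ≤ a → a ≤ b → b ≤ k + 1 →
      InHalf (q k) (polyline v M a - p) → InHalf (q k) (polyline v M b - p) →
      Turns (fun u => polyline v M u - p) a b (ang (q k) (polyline v M a - p))
      (ang (q k) (polyline v M b - p)) := by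
    intro k hk a b hka hab hbk ha hb
    apply turns_of_inHalf (f := fun u => polyline v M u - p) (by fun_prop)
    intro u hu
    rw [Set.uIcc_of_le hab] at hu
    obtain ⟨hau, hub⟩ := hu
    rcases hab.eq_or_lt with rfl | hab'
    · rw [show u = a by linarith]
      exact ha
    have key : polyline v M u - p = (((b - u) / (b - a) : ℝ) : ℂ) * (polyline v M a - p) +
        (((u - a) / (b - a) : ℝ) : ℂ) * (polyline v M b - p) := by
      rw [polyline_apply v hk (t := u) (x := u - k) (by ring) (by linarith) (by linarith),
        polyline_apply v hk (t := a) (x := a - k) (by ring) (by linarith) (by linarith),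
        polyline_apply v hk (t := b) (x := b - k) (by ring) (by linarith) (by linarith)]
      have : (b : ℂ) - a ≠ 0 := by
        rw [sub_ne_zero]
        exact_mod_cast hab'.ne'
      push_cast
      field_simp
      ring
    change InHalf (q k) (polyline v M u - p)
    rw [key]
    refine ha.convexComb hb (div_nonneg (by linarith) (by linarith))
      (div_nonneg (by linarith) (by linarith)) ?_
    rw [← add_div, div_eq_one_iff_eq (by linarith)]
    ring
  induction j, hij using Nat.le_induction generalizing t with
  | base => exact side i hj s t hs0 hst ht1 hs ht
  | succ j hij ih =>
    have hvert : polyline v M ((j + 1 : ℕ) : ℝ) = v (j + 1) := by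
      rw [polyline_apply v hj (x := 0) (by simp) le_rfl zero_le_one]
      simp
    obtain ⟨h1, h2, h3⟩ := hv j hij (by omega)
    have hij' : (i : ℝ) ≤ j := by exact_mod_cast hij
    rw [← hvert] at h1 h2
    have T1 := ih (t := ((j + 1 : ℕ) : ℝ)) (by omega) (by push_cast; linarith)
      (by push_cast; linarith) (by push_cast; linarith) h1 (fun m hm hm' => hv m hm (by omega))
    rw [ang_eq h1 h2 h3] at T1
    have T2 := side (j + 1) hj _ t le_rfl ht0 ht1 h2 ht
    exact T1.trans_of_le T2 (by push_cast; linarith) ht0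

/-! ### Following the angle along a path -/

/-- The clockwise angle of `g`, followed continuously along the path `γ`, changes from `x` to
`y`. -/
def Lifts {X : Type*} [TopologicalSpace X] (g : X → ℂ) {a b : X} (γ : Path a b) (x y : ℝ) :
    Prop :=
  ∃ θ : Path x y, ∀ t, IsAngle (g (γ t)) (θ t)

section Lifts

variable {X : Type*} [TopologicalSpace X] {g : X → ℂ} {a b c : X}

theorem Lifts.trans {γ : Path a b} {δ : Path b c} {x y w : ℝ} (h : Lifts g γ x y)
    (h' : Lifts g δ y w) : Lifts g (γ.trans δ) x w := by
  obtain ⟨θ, h1⟩ := h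
  obtain ⟨η, h2⟩ := h'
  refine ⟨θ.trans η, fun t => ?_⟩
  rw [Path.trans_apply, Path.trans_apply]
  split_ifs
  · exact h1 _
  · exact h2 _

theorem Lifts.ne_zero {γ : Path a b} {x y : ℝ} (h : Lifts g γ x y) (t : I) : g (γ t) ≠ 0 := by
  obtain ⟨θ, h1⟩ := h
  exact (h1 t).1

theorem Lifts.add_turns {γ : Path a b} {x y : ℝ} (h : Lifts g γ x y) (m : ℤ) :
    Lifts g γ (x + 2 * Real.pi * m) (y + 2 * Real.pi * m) := by
  obtain ⟨θ, h1⟩ := h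
  exact ⟨θ.map (f := fun x => x + 2 * Real.pi * m) (by fun_prop), fun t => (h1 t).add_turns m⟩

theorem Lifts.neg {γ : Path a b} {x y : ℝ} (h : Lifts g γ x y) :
    Lifts (fun z => -g z) γ (x + Real.pi) (y + Real.pi) := by
  obtain ⟨θ, h1⟩ := h
  exact ⟨θ.map (f := fun x => x + Real.pi) (by fun_prop), fun t => (h1 t).neg⟩

theorem lifts_of_inHalf {γ : Path a b} (hg : Continuous g) {k : ℤ} (h : ∀ t, InHalf k (g (γ t))) :
    Lifts g γ (ang k (g a)) (ang k (g b)) := by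
  refine ⟨⟨⟨fun t => ang k (g (γ t)), ?_⟩, by simp, by simp⟩, fun t => isAngle_ang k (h t).ne_zero⟩
  rw [continuous_iff_continuousAt]
  intro t
  exact ContinuousAt.comp (g := ang k) (h t).continuousAt_ang
    (ContinuousAt.comp (g := g) hg.continuousAt γ.continuous.continuousAt)

theorem Lifts.halfTurns {γ : Path a b} (hg : Continuous g) {x y : ℝ} {k : ℤ}
    (h : Lifts g γ x y) (hk : y - x = k * Real.pi) :
    IsHalfTurns ⟨fun t => g (γ t), by fun_prop⟩ k := by
  obtain ⟨θ, h1⟩ := h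
  refine ⟨fun t => (h1 t).1, ⟨θ, θ.continuous⟩, fun t => (h1 t).2, ?_⟩
  simpa using hk

end Lifts

theorem IsHalfTurns.halfTurns_eq {f : C(I, ℂ)} {k : ℤ} (h : IsHalfTurns f k) :
    halfTurns f = k := by
  have h' : ∃ k, IsHalfTurns f k := ⟨k, h⟩
  rw [halfTurns, dif_pos h']
  exact h'.choose_spec.unique h

/-- The affine parameter of `along` stays between its endpoints. -/
theorem affine_mem_uIcc (s t : ℝ) (r : I) : s + r * (t - s) ∈ Set.uIcc s t := by
  obtain ⟨r, h0, h1⟩ := r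
  rw [Set.mem_uIcc]
  rcases le_total s t with h | h
  · left
    constructor <;> nlinarith
  · right
    constructor <;> nlinarith

theorem Turns.lifts {c : C(ℝ, ℂ)} {p : ℂ} {s t x y : ℝ} (h : Turns (fun u => c u - p) s t x y) :
    Lifts (fun z => z - p) (along c s t) x y := by
  obtain ⟨θ, h1, h2, h3, h4⟩ := h
  refine ⟨⟨⟨fun r : I => θ (s + r * (t - s)), ?_⟩, by simp [h3], by simp [h4]⟩, fun r => ?_⟩
  · exact h1.comp_continuous (by fun_prop) (affine_mem_uIcc s t)
  · exact h2 _ (affine_mem_uIcc s t r)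

/-- The difference of two points of the plane, as a function on pairs. -/
def diff (z : ℂ × ℂ) : ℂ := z.1 - z.2

theorem continuous_diff : Continuous diff := continuous_fst.sub continuous_snd

theorem Lifts.prod_refl {a b p : ℂ} {γ : Path a b} {x y : ℝ} (h : Lifts (fun z => z - p) γ x y) :
    Lifts diff (γ.prod (Path.refl p)) x y := h

theorem Lifts.refl_prod {a b p : ℂ} {γ : Path a b} {x y : ℝ} (h : Lifts (fun z => z - p) γ x y) :
    Lifts diff ((Path.refl p).prod γ) (x + Real.pi) (y + Real.pi) := by
  obtain ⟨θ, h1⟩ := h.neg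
  refine ⟨θ, fun t => ?_⟩
  have : diff (((Path.refl p).prod γ) t) = -(γ t - p) := by
    simp [diff]
  rw [this]
  exact h1 t

/-! ### Loops and the exchange rule -/

/-- The half planes, numbered without reduction modulo `4`, at the two ends of a lift determine the
winding number. -/
theorem psiOne_eq {x V : ℂ} {γ : Path x x} {k : ℤ} {a : ℤ}
    (h : Lifts (fun z => z - V) γ (ang a (x - V)) (ang (a + 4 * k) (x - V))) :
    psiOne V γ = 2 * k := by
  apply IsHalfTurns.halfTurns_eq
  apply Lifts.halfTurns (g := fun z => z - V) (by fun_prop) h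
  rw [ang_add_four_mul]
  push_cast
  ring

/-- If no exchange takes place: the first point goes round the resting second point. -/
theorem twoPointLoop_rest {c : C(ℝ, ℂ)} {s₀ s₁ s₂ : ℝ} {ret : Path (c s₁) (c s₀)}
    (hs : ¬ ((s₀ < s₂ ∧ s₂ < s₁) ∨ (s₁ < s₂ ∧ s₂ < s₀))) {a b k : ℤ}
    (h₁ : Lifts (fun z => z - c s₂) (along c s₀ s₁) (ang a (c s₀ - c s₂)) (ang b (c s₁ - c s₂)))
    (h₂ : Lifts (fun z => z - c s₂) ret (ang b (c s₁ - c s₂)) (ang (a + 2 * k) (c s₀ - c s₂)))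
    (hk : k % 2 = 0) :
    (∀ t, (twoPointLoop c s₀ s₁ s₂ ret t).1 ≠ (twoPointLoop c s₀ s₁ s₂ ret t).2) ∧
      phi (twoPointLoop c s₀ s₁ s₂ ret) = k := by
  have h : Lifts diff (((along c s₀ s₁).prod (Path.refl (c s₂))).trans
      (ret.prod (Path.refl (c s₂)))) (ang a (c s₀ - c s₂)) (ang (a + 2 * k) (c s₀ - c s₂)) :=
    h₁.prod_refl.trans h₂.prod_refl
  obtain ⟨m, rfl⟩ : ∃ m, k = 2 * m := ⟨k / 2, by omega⟩
  have h' := h.halfTurns (k := 2 * m) continuous_diff (by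
    rw [show a + 2 * (2 * m) = a + 4 * m by ring, ang_add_four_mul]
    push_cast
    ring)
  rw [twoPointLoop, if_neg hs]
  exact ⟨fun t => sub_ne_zero.mp (h'.1 t), h'.halfTurns_eq⟩

/-- If an exchange takes place: the second point first gets out of the way, then the first one
moves up to its place, and the second one returns to the starting point of the first one. -/
theorem twoPointLoop_exchange {c : C(ℝ, ℂ)} {s₀ s₁ s₂ : ℝ} {ret : Path (c s₁) (c s₀)}
    (hs : (s₀ < s₂ ∧ s₂ < s₁) ∨ (s₁ < s₂ ∧ s₂ < s₀)) {a b k : ℤ}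
    (h₀ : Lifts (fun z => z - c s₀) (along c s₂ s₁) (ang (a + 2) (c s₂ - c s₀))
      (ang (a + 2) (c s₁ - c s₀)))
    (h₁ : Lifts (fun z => z - c s₁) (along c s₀ s₂) (ang a (c s₀ - c s₁)) (ang b (c s₂ - c s₁)))
    (h₂ : Lifts (fun z => z - c s₂) ret (ang (b + 2) (c s₁ - c s₂))
      (ang (a + 2 * k + 2) (c s₀ - c s₂)))
    (hk : k % 2 = 1) :
    (∀ t, (twoPointLoop c s₀ s₁ s₂ ret t).1 ≠ (twoPointLoop c s₀ s₁ s₂ ret t).2) ∧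
      phi (twoPointLoop c s₀ s₁ s₂ ret) = k := by
  have n₀ := h₀.refl_prod.add_turns (-1)
  have n₁ := h₁.prod_refl
  have n₂ := h₂.refl_prod.add_turns (-1)
  have e : ∀ (b : ℤ) (z w : ℂ), ang (b + 2) (z - w) + Real.pi + 2 * Real.pi * (-1 : ℤ) =
      ang b (w - z) := by
    intro b z w
    rw [← neg_sub w z, ang_add_two_neg]
    push_cast
    ring
  rw [e, e] at n₀ n₂
  have h := n₀.trans (n₁.trans n₂)
  obtain ⟨m, rfl⟩ : ∃ m, k = 2 * m + 1 := ⟨k / 2, by omega⟩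
  have h' := h.halfTurns (k := 2 * m + 1) continuous_diff (by
    rw [show a + 2 * (2 * m + 1) = a + 2 + 4 * m by ring, ang_add_four_mul, ← neg_sub (c s₀) (c s₂),
      ang_add_two_neg]
    push_cast
    ring)
  rw [twoPointLoop, if_pos hs]
  exact ⟨fun t => sub_ne_zero.mp (h'.1 t), h'.halfTurns_eq⟩

/-- The exchange rule in terms of half planes. The moving point starts in the half plane number `b`
as seen from the resting point and arrives next to it in the half plane number `e`; the return path
leads from the half plane number `r` to the half plane number `r'`. -/
theorem twoPointLoop_phi {c : C(ℝ, ℂ)} {s₀ s₁ s₂ : ℝ} {ret : Path (c s₁) (c s₀)} {b e r r' S : ℤ}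
    (hside : (s₀ < s₁ ∧ s₀ < s₂) ∨ (s₁ < s₀ ∧ s₂ < s₀))
    (he : InHalf e (c s₁ - c s₂) ∨ InHalf e (c s₂ - c s₁))
    (h₁ : InHalf e (c s₁ - c s₂) → Turns (fun u => c u - c s₂) s₀ s₁ (ang b (c s₀ - c s₂))
      (ang e (c s₁ - c s₂)))
    (h₂ : InHalf e (c s₂ - c s₁) → Turns (fun u => c u - c s₁) s₀ s₂ (ang b (c s₀ - c s₁))
      (ang e (c s₂ - c s₁)))
    (h₀ : Turns (fun u => c u - c s₀) s₂ s₁ (ang (b + 2) (c s₂ - c s₀))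
      (ang (b + 2) (c s₁ - c s₀)))
    (hret : Lifts (fun z => z - c s₂) ret (ang r (c s₁ - c s₂)) (ang r' (c s₀ - c s₂)))
    (hr : InHalf r (c s₁ - c s₂)) (hr' : InHalf r' (c s₀ - c s₂)) (hb : InHalf b (c s₀ - c s₂))
    (her : e % 2 = r % 2) (hS : S % 4 = r' % 4) (hSb : |b - S| ≤ 2) :
    (∀ t, (twoPointLoop c s₀ s₁ s₂ ret t).1 ≠ (twoPointLoop c s₀ s₁ s₂ ret t).2) ∧
      phi (twoPointLoop c s₀ s₁ s₂ ret) = (e + r' - r - S) / 2 := by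
  have hSz : ang b (c s₀ - c s₂) = ang S (c s₀ - c s₂) :=
    ang_eq hb ((inHalf_congr hS _).mpr hr') hSb
  obtain ⟨l, rfl⟩ : ∃ l, S = r' + 4 * l := ⟨(S - r') / 4, by omega⟩
  rw [ang_add_four_mul] at hSz
  have hflip : InHalf (r + 2) (c s₂ - c s₁) := by
    rw [← neg_sub, inHalf_neg]
    exact hr
  rcases (show e % 4 = r % 4 ∨ e % 4 = (r + 2) % 4 by omega) with h4 | h4
  · have he' := (inHalf_congr h4 _).mpr hr
    have T := h₁ he'
    obtain ⟨m, rfl⟩ : ∃ m, e = r + 4 * m := ⟨(e - r) / 4, by omega⟩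
    refine twoPointLoop_rest (a := b) (b := r + 4 * m) ?_ ?_ ?_ ?_
    · -- the resting point is not passed, since the difference does not vanish
      have : s₂ ∉ Set.uIcc s₀ s₁ := fun hmem => T.ne_zero hmem (sub_self _)
      rw [Set.mem_uIcc] at this
      rintro (h | h)
      · exact this (Or.inl ⟨h.1.le, h.2.le⟩)
      · exact this (Or.inr ⟨h.1.le, h.2.le⟩)
    · exact T.lifts
    · have := hret.add_turns m
      rw [← ang_add_four_mul] at this
      convert this using 1
      rw [show b + 2 * ((r + 4 * m + r' - r - (r' + 4 * l)) / 2) = b + 4 * (m - l) by omega,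
        ang_add_four_mul, hSz]
      push_cast
      ring
    · omega
  · have he' := (inHalf_congr h4 _).mpr hflip
    have T := h₂ he'
    obtain ⟨m, rfl⟩ : ∃ m, e = r + 2 + 4 * m := ⟨(e - r - 2) / 4, by omega⟩
    refine twoPointLoop_exchange (a := b) (b := r + 2 + 4 * m) ?_ ?_ ?_ ?_ ?_
    · have : s₁ ∉ Set.uIcc s₀ s₂ := fun hmem => T.ne_zero hmem (sub_self _)
      rw [Set.mem_uIcc] at this
      push Not at this
      rcases hside with h | h
      · exact Or.inl ⟨h.2, this.1 h.1.le⟩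
      · refine Or.inr ⟨?_, h.2⟩
        by_contra h'
        exact absurd (this.2 (not_lt.mp h')) (not_lt.mpr h.1.le)
    · exact h₀.lifts
    · exact T.lifts
    · have := hret.add_turns (m + 1)
      rw [← ang_add_four_mul] at this
      convert this using 1
      · congr 1
        ring
      · rw [show b + 2 * ((r + 2 + 4 * m + r' - r - (r' + 4 * l)) / 2) + 2 =
          b + 4 * (m - l + 1) by omega, ang_add_four_mul, hSz]
        push_cast
        ring
    · omega

/-- The straight piece between two points of one side stays in every half plane containing both. -/
theorem turns_side (v : ℕ → ℂ) {M : ℕ} (p : ℂ) (a : ℤ) {k : ℕ} (hk : k < M) {s t : ℝ}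
    (hs0 : k ≤ s) (hs1 : s ≤ k + 1) (ht0 : k ≤ t) (ht1 : t ≤ k + 1)
    (hs : InHalf a (polyline v M s - p)) (ht : InHalf a (polyline v M t - p)) :
    Turns (fun u => polyline v M u - p) s t (ang a (polyline v M s - p))
      (ang a (polyline v M t - p)) := by
  rcases le_total s t with h | h
  · exact turns_polyline v p (fun _ => a) le_rfl hk hs0 hs1 ht0 ht1 h hs ht (by omega)
  · exact (turns_polyline v p (fun _ => a) le_rfl hk ht0 ht1 hs0 hs1 h ht hs (by omega)).symm

theorem forall_trans {X : Type*} [TopologicalSpace X] {a b c : X} {γ : Path a b} {δ : Path b c}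
    {P : X → Prop} (h : ∀ t, P (γ t)) (h' : ∀ t, P (δ t)) (t : I) : P ((γ.trans δ) t) := by
  rw [Path.trans_apply]
  split_ifs
  · exact h _
  · exact h' _

/-- The loop of the exchange rule stays where the curve and the return path are. -/
theorem twoPointLoop_mem {c : C(ℝ, ℂ)} {s₀ s₁ s₂ : ℝ} {ret : Path (c s₁) (c s₀)} {A : Set ℝ}
    {P : Set ℂ} (hA : A.OrdConnected) (h₀ : s₀ ∈ A) (h₁ : s₁ ∈ A) (h₂ : s₂ ∈ A)
    (hc : ∀ s ∈ A, c s ∈ P) (hret : ∀ t, ret t ∈ P) (t : I) :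
    (twoPointLoop c s₀ s₁ s₂ ret t).1 ∈ P ∧ (twoPointLoop c s₀ s₁ s₂ ret t).2 ∈ P := by
  have hal : ∀ {s s'}, s ∈ A → s' ∈ A → ∀ r, along c s s' r ∈ P := fun h h' r =>
    hc _ (hA.uIcc_subset h h' (affine_mem_uIcc _ _ r))
  rw [twoPointLoop]
  split_ifs
  · refine forall_trans (P := fun z : ℂ × ℂ => z.1 ∈ P ∧ z.2 ∈ P) ?_
      (forall_trans (P := fun z : ℂ × ℂ => z.1 ∈ P ∧ z.2 ∈ P) ?_ ?_) t
    · exact fun r => ⟨hc _ h₀, hal h₂ h₁ r⟩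
    · exact fun r => ⟨hal h₀ h₂ r, hc _ h₁⟩
    · exact fun r => ⟨hc _ h₂, hret r⟩
  · refine forall_trans (P := fun z : ℂ × ℂ => z.1 ∈ P ∧ z.2 ∈ P) ?_ ?_ t
    · exact fun r => ⟨hal h₀ h₁ r, hc _ h₂⟩
    · exact fun r => ⟨hret r, hc _ h₂⟩

/-! ### The arc of the tangle -/

theorem neg_one_pow_cases (k : ℕ) :
    (k % 2 = 0 ∧ (-1 : ℝ) ^ k = 1) ∨ (k % 2 = 1 ∧ (-1 : ℝ) ^ k = -1) := by
  rcases Nat.even_or_odd k with h | h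
  · exact Or.inl ⟨Nat.even_iff.mp h, h.neg_one_pow⟩
  · exact Or.inr ⟨Nat.odd_iff.mp h, h.neg_one_pow⟩

theorem neg_one_pow_odd_add {N : ℕ} (hN : N % 2 = 1) (k : ℕ) :
    (-1 : ℝ) ^ (N + k) = -(-1) ^ k := by
  rw [pow_add, (Nat.odd_iff.mpr hN).neg_one_pow]
  ring

theorem arcVertex_even {N : ℕ} (hN : N % 2 = 1) (k : ℕ) :
    arcVertex N (2 * k) = ⟨-(-1) ^ k * (4 * (k + 1)), -(-1) ^ k * (4 * k)⟩ := by
  have a1 : 2 * k / 2 = k := by omega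
  simp [arcVertex, a1, show ¬ 2 * k = 2 * N + 1 by omega, neg_one_pow_odd_add hN]

theorem arcVertex_odd {N : ℕ} (hN : N % 2 = 1) {k : ℕ} (hk : k < N) :
    arcVertex N (2 * k + 1) = ⟨-(-1) ^ k * (4 * (k + 1)), (-1) ^ k * (4 * (k + 1))⟩ := by
  have a1 : (2 * k + 1) / 2 = k := by omega
  simp [arcVertex, a1, hk.ne, neg_one_pow_odd_add hN]

theorem arcVertex_last (N : ℕ) : arcVertex N (2 * N + 1) = ⟨4 * (N + 1), 0⟩ := by
  simp [arcVertex]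

/-- The spiral bends clockwise: its side number `m` lies on the line bounding the half plane number
`m + 2`, at distance `4 (m / 2 + 1)` from the origin. -/
theorem arcVertex_inHalf {N : ℕ} (hN : N % 2 = 1) {m : ℕ} (hm : m ≤ 2 * N) {p : ℂ}
    (h0 : m % 2 = 0 → |p.re| < 4 * ((m / 2 : ℕ) + 1))
    (h1 : m % 2 = 1 → |p.im| < 4 * ((m / 2 : ℕ) + 1)) :
    InHalf (m + 2) (arcVertex N m - p) ∧ InHalf (m + 2) (arcVertex N (m + 1) - p) := by
  obtain ⟨k, rfl | rfl⟩ : ∃ k, m = 2 * k ∨ m = 2 * k + 1 := ⟨m / 2, by omega⟩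
  · have h0 := abs_lt.mp (h0 (by omega))
    rw [show 2 * k / 2 = k by omega] at h0
    rcases eq_or_ne k N with hkN | hkN
    · have a : ((2 * k : ℕ) + 2 : ℤ) % 4 = 0 := by omega
      rw [inHalf_right a, inHalf_right a, arcVertex_even hN, hkN, arcVertex_last]
      rcases neg_one_pow_cases N with ⟨h, h'⟩ | ⟨h, h'⟩
      · omega
      · simp only [h', Complex.sub_re]
        rw [hkN] at h0
        constructor <;> linarith [h0.2]
    · rw [arcVertex_even hN, arcVertex_odd hN (by omega)]
      rcases neg_one_pow_cases k with ⟨h, h'⟩ | ⟨h, h'⟩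
      · have a : ((2 * k : ℕ) + 2 : ℤ) % 4 = 2 := by omega
        rw [inHalf_left a, inHalf_left a, h']
        simp only [Complex.sub_re]
        constructor <;> linarith [h0.1]
      · have a : ((2 * k : ℕ) + 2 : ℤ) % 4 = 0 := by omega
        rw [inHalf_right a, inHalf_right a, h']
        simp only [Complex.sub_re]
        constructor <;> linarith [h0.2]
  · have h1 := abs_lt.mp (h1 (by omega))
    rw [show (2 * k + 1) / 2 = k by omega] at h1
    rw [show 2 * k + 1 + 1 = 2 * (k + 1) by ring, arcVertex_even hN, arcVertex_odd hN (by omega)]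
    rcases neg_one_pow_cases k with ⟨h, h'⟩ | ⟨h, h'⟩
    · have a : ((2 * k + 1 : ℕ) + 2 : ℤ) % 4 = 3 := by omega
      rw [inHalf_above a, inHalf_above a, pow_succ, h']
      simp only [Complex.sub_im]
      push_cast
      constructor <;> linarith [h1.2]
    · have a : ((2 * k + 1 : ℕ) + 2 : ℤ) % 4 = 1 := by omega
      rw [inHalf_below a, inHalf_below a, pow_succ, h']
      simp only [Complex.sub_im]
      push_cast
      constructor <;> linarith [h1.1]

/-- The intersection point `ξ_i`, on copy `c` of its axis. -/
def xi (N : ℕ) (c : SignType) (i : TangleIdx N) : ℂ := arc N (arcParam N c i)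

/-- The number of the crossing of the active axis that lies on the same side of the arc as `ξ_i`;
the inactive point lies on the side of the last active one. -/
def rank {N : ℕ} : TangleIdx N → ℕ
  | .inl k => k
  | .inr _ => N - 1

theorem rank_lt {N : ℕ} (hN : 1 ≤ N) (i : TangleIdx N) : rank i < N := by
  rcases i with ⟨k, hk⟩ | i
  · exact hk
  · simp only [rank]
    omega

theorem xi_active {N : ℕ} (hN : N % 2 = 1) (c : SignType) (k : Fin N) :
    xi N c (.inl k) = ⟨c, (-1) ^ (k : ℕ) * (4 * ((k : ℕ) + 1))⟩ := by
  rw [xi, arc_arcParam N (by omega), vertical_apply]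
  simp [axisX, height, neg_one_pow_odd_add hN]

theorem xi_inactive {N : ℕ} (hN : N % 2 = 1) (c : SignType) (k : Fin 1) :
    xi N c (.inr k) = ⟨4 * N + 2 + c, 4 * N⟩ := by
  rw [xi, arc_arcParam N (by omega), vertical_apply]
  simp [axisX, height]

theorem xi_im {N : ℕ} (hN : N % 2 = 1) (c : SignType) (i : TangleIdx N) :
    (xi N c i).im = (-1) ^ (rank i) * (4 * (rank i + 1)) := by
  rcases i with k | k
  · rw [xi_active hN]
    rfl
  · rw [xi_inactive hN]
    have : ((N - 1 : ℕ) : ℝ) = N - 1 := by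
      rw [Nat.cast_sub (by omega)]
      simp
    rcases neg_one_pow_cases (N - 1) with ⟨h, h'⟩ | ⟨h, h'⟩
    · simp only [rank, h', this]
      ring
    · omega

theorem arcParam_active {N : ℕ} (c : SignType) (k : Fin N) :
    2 * (k : ℕ) + 1 + 1 / 5 ≤ arcParam N c (.inl k) ∧
      arcParam N c (.inl k) ≤ 2 * (k : ℕ) + 1 + 1 / 2 := by
  obtain ⟨hc, hc'⟩ := signType_mem c
  have hk : (0 : ℝ) ≤ (k : ℕ) := Nat.cast_nonneg _
  have hd : (0 : ℝ) < 8 * (k : ℕ) + 12 := by positivity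
  simp only [arcParam]
  constructor
  · rw [add_le_add_iff_left, div_le_div_iff₀ (by norm_num) hd]
    rcases neg_one_pow_eq_or ℝ (N + (k : ℕ)) with h | h <;> rw [h] <;> linarith
  · rw [add_le_add_iff_left, div_le_div_iff₀ hd (by norm_num)]
    rcases neg_one_pow_eq_or ℝ (N + (k : ℕ)) with h | h <;> rw [h] <;> linarith

theorem arcParam_inactive {N : ℕ} (hN : 1 ≤ N) (c : SignType) (k : Fin 1) :
    2 * N - 1 + 1 / 2 < arcParam N c (.inr k) ∧ arcParam N c (.inr k) < 2 * N := by
  obtain ⟨hc, hc'⟩ := signType_mem c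
  have hk : (1 : ℝ) ≤ N := by exact_mod_cast hN
  have hd : (0 : ℝ) < 8 * N + 4 := by positivity
  simp only [arcParam]
  constructor
  · rw [add_lt_add_iff_left, div_lt_div_iff₀ (by norm_num) hd]
    linarith
  · have : (8 * (N : ℝ) + 2 + c) / (8 * N + 4) < 1 := by
      rw [div_lt_one hd]
      linarith
    linarith

theorem arcParam_mem {N : ℕ} (hN : 1 ≤ N) (c : SignType) (i : TangleIdx N) :
    2 * (rank i : ℝ) + 1 ≤ arcParam N c i ∧ arcParam N c i ≤ 2 * rank i + 2 := by
  rcases i with k | k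
  · have := arcParam_active c k
    simp only [rank]
    constructor <;> linarith
  · have := arcParam_inactive hN c k
    have e : ((N - 1 : ℕ) : ℝ) = N - 1 := by
      rw [Nat.cast_sub (by omega)]
      simp
    simp only [rank, e]
    constructor <;> linarith

/-- The order of the intersection points along the arc. -/
def precedes {N : ℕ} : TangleIdx N → TangleIdx N → Prop
  | .inl i, .inl j => i < j
  | .inl _, .inr _ => True
  | .inr _, _ => False

theorem precedes_total {N : ℕ} {i j : TangleIdx N} (h : i ≠ j) : precedes i j ∨ precedes j i := by
  rcases i with i | i <;> rcases j with j | j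
  · have : i ≠ j := by simpa using h
    exact lt_or_gt_of_ne this
  · exact Or.inl trivial
  · exact Or.inr trivial
  · exact absurd (congrArg Sum.inr (Subsingleton.elim i j)) h

theorem precedes.rank_le {N : ℕ} {i j : TangleIdx N} (h : precedes i j) : rank i ≤ rank j := by
  rcases i with i | i <;> rcases j with j | j
  · exact le_of_lt h
  · have := i.2
    simp only [rank]
    omega
  · exact absurd h (by simp [precedes])
  · exact absurd h (by simp [precedes])

theorem precedes.arcParam_lt {N : ℕ} (hN : 1 ≤ N) {i j : TangleIdx N} (h : precedes i j)
    (c d : SignType) : arcParam N c i < arcParam N d j := by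
  rcases i with i | i <;> rcases j with j | j
  · have h1 := (arcParam_active c i).2
    have h2 := (arcParam_active d j).1
    have h3 : ((i : ℕ) : ℝ) + 1 ≤ (j : ℕ) := by exact_mod_cast (show i < j from h)
    linarith
  · have h1 := (arcParam_active c i).2
    have h2 := (arcParam_inactive hN d j).1
    have h3 : ((i : ℕ) : ℝ) + 1 ≤ N := by exact_mod_cast i.2
    linarith
  · exact absurd h (by simp [precedes])
  · exact absurd h (by simp [precedes])

theorem xi_re_copy {N : ℕ} (hN : N % 2 = 1) (c d : SignType) (i : TangleIdx N) :
    (xi N c i).re - (xi N d i).re = c - d := by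
  rcases i with i | i
  · simp [xi_active hN]
  · simp [xi_inactive hN]

theorem signType_abs_lt (c : SignType) : |(c : ℝ)| < 4 := by
  obtain ⟨h, h'⟩ := signType_mem c
  rw [abs_lt]
  constructor <;> linarith

theorem abs_neg_one_pow_mul (k : ℕ) {x : ℝ} (hx : 0 ≤ x) : |(-1 : ℝ) ^ k * x| = x := by
  rw [abs_mul, abs_pow, abs_neg, abs_one, one_pow, one_mul, abs_of_nonneg hx]

/-- The number of the half plane in which an earlier point `ξ_i` of the arc is seen from `ξ_j`. -/
def lookBack {N : ℕ} (i j : TangleIdx N) : ℤ :=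
  if rank i < rank j then 2 * rank j + 1 else 2 * rank j + 2

/-- The number of the half plane in which a later point `ξ_i` of the arc is seen from `ξ_j`. -/
def lookAhead {N : ℕ} (i j : TangleIdx N) : ℤ :=
  if rank j < rank i then 2 * rank i + 3 else 2 * rank j + 4

theorem inHalf_lookBack {N : ℕ} (hN : N % 2 = 1) {i j : TangleIdx N} (h : precedes i j)
    (d d' : SignType) : InHalf (lookBack i j) (xi N d i - xi N d' j) := by
  rw [lookBack]
  split_ifs with hr
  · have hr' : (rank i : ℝ) + 1 ≤ rank j := by exact_mod_cast hr
    have h0 : (0 : ℝ) ≤ rank i := Nat.cast_nonneg _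
    rcases neg_one_pow_cases (rank j) with ⟨a, a'⟩ | ⟨a, a'⟩
    · rw [inHalf_below (by omega), Complex.sub_im, xi_im hN, xi_im hN, a']
      rcases neg_one_pow_cases (rank i) with ⟨b, b'⟩ | ⟨b, b'⟩ <;> rw [b'] <;> linarith
    · rw [inHalf_above (by omega), Complex.sub_im, xi_im hN, xi_im hN, a']
      rcases neg_one_pow_cases (rank i) with ⟨b, b'⟩ | ⟨b, b'⟩ <;> rw [b'] <;> linarith
  · obtain ⟨hd, hd'⟩ := signType_mem d
    obtain ⟨he, he'⟩ := signType_mem d'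
    rcases i with i | i <;> rcases j with j | j
    · exact absurd h hr
    · have h1 : (1 : ℝ) ≤ N := by exact_mod_cast (show 1 ≤ N by omega)
      rw [inHalf_left (by simp only [rank]; omega), xi_active hN, xi_inactive hN]
      simp only [Complex.sub_re]
      linarith
    · exact absurd h (by simp [precedes])
    · exact absurd h (by simp [precedes])

theorem inHalf_lookAhead {N : ℕ} (hN : N % 2 = 1) {i j : TangleIdx N} (h : precedes j i)
    (d d' : SignType) : InHalf (lookAhead i j) (xi N d i - xi N d' j) := by
  rw [lookAhead]
  split_ifs with hr
  · have hr' : (rank j : ℝ) + 1 ≤ rank i := by exact_mod_cast hr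
    have h0 : (0 : ℝ) ≤ rank j := Nat.cast_nonneg _
    rcases neg_one_pow_cases (rank i) with ⟨a, a'⟩ | ⟨a, a'⟩
    · rw [inHalf_above (by omega), Complex.sub_im, xi_im hN, xi_im hN, a']
      rcases neg_one_pow_cases (rank j) with ⟨b, b'⟩ | ⟨b, b'⟩ <;> rw [b'] <;> linarith
    · rw [inHalf_below (by omega), Complex.sub_im, xi_im hN, xi_im hN, a']
      rcases neg_one_pow_cases (rank j) with ⟨b, b'⟩ | ⟨b, b'⟩ <;> rw [b'] <;> linarith
  · obtain ⟨hd, hd'⟩ := signType_mem d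
    obtain ⟨he, he'⟩ := signType_mem d'
    rcases j with j | j <;> rcases i with i | i
    · exact absurd h hr
    · have h1 : (1 : ℝ) ≤ N := by exact_mod_cast (show 1 ≤ N by omega)
      have := j.2
      simp only [rank] at hr
      rw [inHalf_right (by simp only [rank]; omega), xi_active hN, xi_inactive hN]
      simp only [Complex.sub_re]
      linarith
    · exact absurd h (by simp [precedes])
    · exact absurd h (by simp [precedes])

/-- Seen from `ξ_j`, the earlier part of the arc lies on the inner side, and the piece just before
`ξ_j` lies behind. -/
theorem turns_back {N : ℕ} (hN : N % 2 = 1) {i j : TangleIdx N} (h : precedes i j)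
    (d : SignType) {d₁ d₂ : SignType}
    (hd : InHalf (2 * rank j + 2) (xi N d₂ j - xi N d₁ j)) :
    Turns (fun u => arc N u - xi N d₁ j) (arcParam N d i) (arcParam N d₂ j)
      (ang (lookBack i j) (xi N d i - xi N d₁ j))
      (ang (2 * rank j + 2) (xi N d₂ j - xi N d₁ j)) := by
  have hN1 : 1 ≤ N := by omega
  have hi := arcParam_mem hN1 d i
  have hj := arcParam_mem hN1 d₂ j
  have hri := h.rank_le
  have hrj := rank_lt hN1 j
  have hj0 : (0 : ℝ) ≤ rank j := Nat.cast_nonneg _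
  have him := xi_im hN d₁ j
  have hq := inHalf_lookBack hN h d d₁
  let q : ℕ → ℤ := fun m => if m < 2 * rank j then 2 * rank j + 1 else 2 * rank j + 2
  have qi : q (2 * rank i + 1) = lookBack i j := by
    simp only [q, lookBack]
    split_ifs <;> omega
  have qj : q (2 * rank j + 1) = 2 * rank j + 2 := by
    simp only [q]
    split_ifs <;> omega
  -- the last but one side before `ξ_j` lies behind it
  have hback : InHalf (2 * rank j + 2) (arcVertex N (2 * rank j) - xi N d₁ j) ∧
      InHalf (2 * rank j + 2) (arcVertex N (2 * rank j + 1) - xi N d₁ j) := by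
    rcases j with j | j
    · have := arcVertex_inHalf hN (m := 2 * j) (p := xi N d₁ (.inl j))
        (by simp only [rank] at *; omega)
        (fun _ => by
          rw [xi_active hN]
          refine (signType_abs_lt d₁).trans_le ?_
          have : (0 : ℝ) ≤ (2 * (j : ℕ) / 2 : ℕ) := Nat.cast_nonneg _
          linarith) (by omega)
      exact_mod_cast this
    · have e : rank (Sum.inr j : TangleIdx N) = N - 1 := rfl
      obtain ⟨hc, hc'⟩ := signType_mem d₁
      have h1 : (1 : ℝ) ≤ N := by exact_mod_cast hN1
      rw [inHalf_left (by rw [e]; omega), inHalf_left (by rw [e]; omega), e, arcVertex_even hN,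
        arcVertex_odd hN (by omega), xi_inactive hN]
      rcases neg_one_pow_cases (N - 1) with ⟨b, b'⟩ | ⟨b, b'⟩
      · rw [b', Nat.cast_sub hN1]
        simp only [Complex.sub_re]
        push_cast
        constructor <;> linarith
      · omega
  -- the sides before it lie on the inner side
  have hinner : ∀ m, m ≤ 2 * rank j → InHalf (2 * rank j + 1) (arcVertex N m - xi N d₁ j) := by
    intro m hm
    have hb : -(4 * (rank j : ℝ)) ≤ (arcVertex N m).im ∧ (arcVertex N m).im ≤ 4 * rank j := by
      obtain ⟨k, rfl | rfl⟩ : ∃ k, m = 2 * k ∨ m = 2 * k + 1 := ⟨m / 2, by omega⟩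
      · have : (k : ℝ) ≤ rank j := by exact_mod_cast (show k ≤ rank j by omega)
        have : (0 : ℝ) ≤ k := Nat.cast_nonneg k
        rw [arcVertex_even hN]
        rcases neg_one_pow_cases k with ⟨b, b'⟩ | ⟨b, b'⟩ <;> rw [b'] <;>
          constructor <;> simp only <;> linarith
      · have : (k : ℝ) + 1 ≤ rank j := by exact_mod_cast (show k + 1 ≤ rank j by omega)
        have : (0 : ℝ) ≤ k := Nat.cast_nonneg k
        rw [arcVertex_odd hN (by omega)]
        rcases neg_one_pow_cases k with ⟨b, b'⟩ | ⟨b, b'⟩ <;> rw [b'] <;>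
          constructor <;> simp only <;> linarith
    rcases neg_one_pow_cases (rank j) with ⟨a, a'⟩ | ⟨a, a'⟩
    · rw [inHalf_below (by omega), Complex.sub_im, him, a']
      linarith [hb.2]
    · rw [inHalf_above (by omega), Complex.sub_im, him, a']
      linarith [hb.1]
  have := turns_polyline (arcVertex N) (M := 2 * N + 1) (xi N d₁ j) q
    (i := 2 * rank i + 1) (j := 2 * rank j + 1) (s := arcParam N d i) (t := arcParam N d₂ j)
    (by omega) (by omega) (by push_cast; linarith) (by push_cast; linarith) (by push_cast; linarith)
    (by push_cast; linarith) (h.arcParam_lt hN1 d d₂).le (by rw [qi]; exact hq)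
    (by rw [qj]; exact hd) (by
      intro m hm hm'
      simp only [q]
      rcases lt_trichotomy (m + 1) (2 * rank j) with h1 | h1 | h1
      · rw [if_pos (by omega), if_pos h1]
        exact ⟨hinner _ h1.le, hinner _ h1.le, by simp⟩
      · rw [if_pos (by omega), if_neg (by omega), h1]
        refine ⟨hinner _ le_rfl, hback.1, by simp⟩
      · obtain rfl : m = 2 * rank j := by omega
        rw [if_neg (by omega), if_neg (by omega)]
        exact ⟨hback.2, hback.2, by simp⟩)
  rw [qi, qj] at this
  exact this

/-- Seen from `ξ_j`, the piece of the arc just after `ξ_j` lies ahead, and the later part spirals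
around `ξ_j`. -/
theorem turns_ahead {N : ℕ} (hN : N % 2 = 1) {i j : TangleIdx N} (h : precedes j i)
    (d : SignType) {d₁ d₂ : SignType}
    (hd : InHalf (2 * rank j + 4) (xi N d₂ j - xi N d₁ j)) :
    Turns (fun u => arc N u - xi N d₁ j) (arcParam N d i) (arcParam N d₂ j)
      (ang (lookAhead i j) (xi N d i - xi N d₁ j))
      (ang (2 * rank j + 4) (xi N d₂ j - xi N d₁ j)) := by
  have hN1 : 1 ≤ N := by omega
  have hi := arcParam_mem hN1 d i
  have hj := arcParam_mem hN1 d₂ j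
  have hri := h.rank_le
  have hrj := rank_lt hN1 i
  have hj0 : (0 : ℝ) ≤ rank j := Nat.cast_nonneg _
  have him := xi_im hN d₁ j
  have hq := inHalf_lookAhead hN h d d₁
  let q : ℕ → ℤ := fun m => if m = 2 * rank j + 1 then 2 * rank j + 4 else m + 2
  have qi : q (2 * rank i + 1) = lookAhead i j := by
    simp only [q, lookAhead]
    split_ifs <;> push_cast <;> omega
  have qj : q (2 * rank j + 1) = 2 * rank j + 4 := by
    simp only [q]
    split_ifs <;> omega
  have hre : |(xi N d₁ j).re| < 4 := by
    rcases j with j | j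
    · rw [xi_active hN]
      exact signType_abs_lt d₁
    · exact absurd h (by cases i <;> simp [precedes])
  have houter : ∀ m, 2 * rank j + 2 ≤ m → m ≤ 2 * N →
      InHalf (m + 2) (arcVertex N m - xi N d₁ j) ∧
        InHalf (m + 2) (arcVertex N (m + 1) - xi N d₁ j) := by
    intro m hm hm'
    refine arcVertex_inHalf hN hm' (fun _ => hre.trans_le ?_) (fun hm2 => ?_)
    · have : (0 : ℝ) ≤ (m / 2 : ℕ) := Nat.cast_nonneg _
      linarith
    · rw [him, abs_neg_one_pow_mul _ (by positivity)]
      have : (rank j : ℝ) < (m / 2 : ℕ) := by exact_mod_cast (show rank j < m / 2 by omega)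
      linarith
  have := turns_polyline (arcVertex N) (M := 2 * N + 1) (xi N d₁ j) q
    (i := 2 * rank j + 1) (j := 2 * rank i + 1) (s := arcParam N d₂ j) (t := arcParam N d i)
    (by omega) (by omega) (by push_cast; linarith) (by push_cast; linarith) (by push_cast; linarith)
    (by push_cast; linarith) (h.arcParam_lt hN1 d₂ d).le (by rw [qj]; exact hd)
    (by rw [qi]; exact hq) (by
      intro m hm hm'
      simp only [q]
      rw [if_neg (show ¬ m + 1 = 2 * rank j + 1 by omega)]
      have h2 := (houter (m + 1) (by omega) (by omega)).1
      split_ifs with h1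
      · subst h1
        have e : ((2 * rank j + 1 + 1 : ℕ) : ℤ) + 2 = 2 * rank j + 4 := by push_cast; ring
        rw [e] at h2 ⊢
        exact ⟨h2, h2, by simp⟩
      · refine ⟨(houter m (by omega) (by omega)).2, h2, ?_⟩
        push_cast
        rw [abs_le]
        constructor <;> linarith)
  rw [qi, qj] at this
  exact this.symm

/-! ### Return paths of the tangle, and the exchange of two of its points -/

theorem height_eq {N : ℕ} (hN : N % 2 = 1) (i : TangleIdx N) :
    height N i = (-1) ^ (rank i) * (4 * (rank i + 1)) := by
  have h := xi_im hN 0 i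
  rw [xi, arc_arcParam N (by omega), vertical_apply] at h
  exact h

/-- Of two points of the arc, the earlier one is placed on the copy where the arc arrives at the
later one, and the later one on the other copy. -/
theorem precedes.tangleCopy_eq {N : ℕ} (hN : N % 2 = 1) {i j : TangleIdx N} (h : precedes i j) :
    (rank j % 2 = 0 ∧ tangleCopy N i j = -1 ∧ tangleCopy N j i = 1) ∨
      (rank j % 2 = 1 ∧ tangleCopy N i j = 1 ∧ tangleCopy N j i = -1) := by
  rcases i with i | i <;> rcases j with j | j
  · have hi := height_eq hN (.inl i : TangleIdx N)
    have hj := height_eq hN (.inl j : TangleIdx N)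
    have hij : (rank (.inl i : TangleIdx N) : ℝ) + 1 ≤ rank (.inl j : TangleIdx N) := by
      exact_mod_cast (show i < j from h)
    have h0 : (0 : ℝ) ≤ rank (.inl i : TangleIdx N) := Nat.cast_nonneg _
    simp only [tangleCopy]
    rcases neg_one_pow_cases (rank (.inl j : TangleIdx N)) with ⟨a, a'⟩ | ⟨a, a'⟩
    · have : height N (.inl i) < height N (.inl j) := by
        rw [hi, hj, a']
        rcases neg_one_pow_cases (rank (.inl i : TangleIdx N)) with ⟨b, b'⟩ | ⟨b, b'⟩ <;>
          rw [b'] <;> linarith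
      left
      exact ⟨a, if_pos this, if_neg (not_lt.mpr this.le)⟩
    · have : height N (.inl j) < height N (.inl i) := by
        rw [hi, hj, a']
        rcases neg_one_pow_cases (rank (.inl i : TangleIdx N)) with ⟨b, b'⟩ | ⟨b, b'⟩ <;>
          rw [b'] <;> linarith
      right
      exact ⟨a, if_neg (not_lt.mpr this.le), if_pos this⟩
  · left
    exact ⟨by simp only [rank]; omega, rfl, rfl⟩
  · exact absurd h (by simp [precedes])
  · exact absurd h (by simp [precedes])

/-- The piece of the arc between the two axes is horizontal. -/
theorem arc_top {N : ℕ} (hN : N % 2 = 1) {x : ℝ} (h0 : 0 ≤ x) (h1 : x ≤ 1) :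
    arc N (2 * N - 1 + x) = ⟨-(4 * N) + x * (8 * N + 4), 4 * N⟩ := by
  obtain ⟨K, rfl⟩ : ∃ K, N = K + 1 := ⟨N - 1, by omega⟩
  have e1 := arcVertex_odd hN (k := K) (by omega)
  have e2 := arcVertex_even hN (K + 1)
  rw [show 2 * (K + 1) = 2 * K + 1 + 1 by ring, pow_succ] at e2
  rw [arc, polyline_mk (arcVertex (K + 1)) e1 e2 (by omega) (x := x) (by push_cast; ring) h0 h1]
  rcases neg_one_pow_cases K with ⟨a, a'⟩ | ⟨a, a'⟩
  · rw [a']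
    push_cast
    congr 1 <;> ring
  · omega

theorem axisPath_re {N : ℕ} (hN : 1 ≤ N) (c : SignType) (i j : TangleIdx N)
    (h : axisX N c i = axisX N c j) (t : I) : (axisPath N hN c i j h t).re = axisX N c i := by
  simp [axisPath, along, vertical_apply]

/-- A path along copy `c` of the active axis, of the piece of the arc between the axes, and of the
inactive axis. -/
theorem along_top {N : ℕ} (hN : N % 2 = 1) (hN1 : 1 ≤ N) (c : SignType) {s t : ℝ}
    (hs : s = arcParam N c (topActive N hN1) ∨ s = arcParam N c (.inr 0))
    (ht : t = arcParam N c (topActive N hN1) ∨ t = arcParam N c (.inr 0)) (r : I) :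
    (along (arc N) s t r).im = 4 * N ∧ (c : ℝ) ≤ (along (arc N) s t r).re ∧
      (along (arc N) s t r).re ≤ 4 * N + 2 + c := by
  have hN' : (1 : ℝ) ≤ N := by exact_mod_cast hN1
  have hd : (0 : ℝ) < 8 * N + 4 := by positivity
  obtain ⟨hc, hc'⟩ := signType_mem c
  have e1 : arcParam N c (topActive N hN1) = 2 * N - 1 + (4 * N + c) / (8 * N + 4) := by
    simp only [arcParam, topActive, neg_one_pow_odd_add hN]
    rw [Nat.cast_sub hN1]
    rcases neg_one_pow_cases (N - 1) with ⟨a, a'⟩ | ⟨a, a'⟩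
    · rw [a']
      push_cast
      congr 1
      · ring
      · congr 1 <;> ring
    · omega
  have e2 : arcParam N c (.inr 0) = 2 * N - 1 + (8 * N + 2 + c) / (8 * N + 4) := rfl
  have hlt : (4 * (N : ℝ) + c) / (8 * N + 4) ≤ (8 * N + 2 + c) / (8 * N + 4) := by
    gcongr
    linarith
  have hmem : s + r * (t - s) ∈
      Set.Icc (arcParam N c (topActive N hN1)) (arcParam N c (.inr 0)) := by
    refine Set.ordConnected_Icc.uIcc_subset ?_ ?_ (affine_mem_uIcc s t r)
    · rcases hs with rfl | rfl
      · exact ⟨le_rfl, by rw [e1, e2]; linarith⟩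
      · exact ⟨by rw [e1, e2]; linarith, le_rfl⟩
    · rcases ht with rfl | rfl
      · exact ⟨le_rfl, by rw [e1, e2]; linarith⟩
      · exact ⟨by rw [e1, e2]; linarith, le_rfl⟩
  change (arc N (s + r * (t - s))).im = _ ∧ _ ≤ (arc N (s + r * (t - s))).re ∧
    (arc N (s + r * (t - s))).re ≤ _
  obtain ⟨x, hx⟩ : ∃ x, s + r * (t - s) = 2 * N - 1 + x := ⟨s + r * (t - s) - (2 * N - 1), by ring⟩
  rw [hx, e1, e2] at hmem
  obtain ⟨h1, h2⟩ := hmem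
  have h1 : (4 * (N : ℝ) + c) / (8 * N + 4) ≤ x := by linarith
  have h2 : x ≤ (8 * (N : ℝ) + 2 + c) / (8 * N + 4) := by linarith
  have h0 : 0 ≤ x := le_trans (div_nonneg (by linarith) hd.le) h1
  have h3 : x ≤ 1 := h2.trans (by rw [div_le_one hd]; linarith)
  rw [div_le_iff₀ hd] at h1
  rw [le_div_iff₀ hd] at h2
  rw [hx, arc_top hN h0 h3]
  refine ⟨rfl, ?_, ?_⟩ <;> simp only <;> linarith

theorem returnPath_active {N : ℕ} (hN : 1 ≤ N) (c : SignType) (j i : Fin N) (t : I) :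
    (returnPath N hN c (.inl j) (.inl i) t).re = c := axisPath_re hN c (.inl j) (.inl i) rfl t

theorem returnPath_mem {N : ℕ} (hN : N % 2 = 1) (hN1 : 1 ≤ N) (c : SignType) (j i : TangleIdx N)
    (t : I) : ((returnPath N hN1 c j i t).re = c ∨ 4 ≤ (returnPath N hN1 c j i t).im ∨
        4 < (returnPath N hN1 c j i t).re) ∧
      (c : ℝ) ≤ (returnPath N hN1 c j i t).re ∧
      (returnPath N hN1 c j i t).re ≤ 4 * N + 2 + c := by
  let P : ℂ → Prop := fun z => (z.re = c ∨ 4 ≤ z.im ∨ 4 < z.re) ∧ c ≤ z.re ∧ z.re ≤ 4 * N + 2 + c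
  have hN' : (1 : ℝ) ≤ N := by exact_mod_cast hN1
  obtain ⟨hc, hc'⟩ := signType_mem c
  have hA : ∀ (i j : Fin N) t, P (axisPath N hN1 c (.inl i) (.inl j) rfl t) := by
    intro i j t
    have := axisPath_re hN1 c (.inl i) (.inl j) rfl t
    simp only [axisX] at this
    exact ⟨Or.inl this, this.ge, by rw [this]; linarith⟩
  have hI : ∀ (i j : Fin 1) t, P (axisPath N hN1 c (.inr i) (.inr j) rfl t) := by
    intro i j t
    have := axisPath_re hN1 c (.inr i) (.inr j) rfl t
    simp only [axisX] at this
    exact ⟨Or.inr (Or.inr (by rw [this]; linarith)), by rw [this]; linarith, this.le⟩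
  have hT : ∀ {s t : ℝ} (_ : s = arcParam N c (topActive N hN1) ∨ s = arcParam N c (.inr 0))
      (_ : t = arcParam N c (topActive N hN1) ∨ t = arcParam N c (.inr 0)) (r : I),
      P (along (arc N) s t r) := by
    intro s t hs ht r
    obtain ⟨h1, h2, h3⟩ := along_top hN hN1 c hs ht r
    exact ⟨Or.inr (Or.inl (by rw [h1]; linarith)), h2, h3⟩
  change P _
  rcases i with i | i <;> rcases j with j | j
  · exact hA _ _ t
  · exact forall_trans (forall_trans (hI _ _) (hT (Or.inr rfl) (Or.inl rfl))) (hA _ _) t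
  · exact forall_trans (forall_trans (hA _ _) (hT (Or.inl rfl) (Or.inr rfl))) (hI _ _) t
  · exact hI _ _ t

/-- Of the two points on different copies, the one on the left copy never gets to the right of
the other one on its way back. -/
theorem returnPath_inHalf {N : ℕ} (hN : N % 2 = 1) (hN1 : 1 ≤ N) {i j : TangleIdx N} (hij : i ≠ j)
    (t : I) : (tangleCopy N i j = -1 → tangleCopy N j i = 1 →
      InHalf 2 (returnPath N hN1 (tangleCopy N i j) j i t - xi N (tangleCopy N j i) j)) ∧
    (tangleCopy N i j = 1 → tangleCopy N j i = -1 →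
      InHalf 0 (returnPath N hN1 (tangleCopy N i j) j i t - xi N (tangleCopy N j i) j)) := by
  rw [inHalf_left (by norm_num), inHalf_right (by norm_num), Complex.sub_re]
  have hN' : (1 : ℝ) ≤ N := by exact_mod_cast hN1
  rcases i with i | i <;> rcases j with j | j
  · have := returnPath_active hN1 (tangleCopy N (.inl i) (.inl j)) j i t
    rw [this, xi_active hN]
    constructor <;> intro h h' <;> rw [h, h'] <;> simp
  · have := (returnPath_mem hN hN1 (tangleCopy N (.inl i) (.inr j)) (.inr j) (.inl i) t).2.2
    rw [xi_inactive hN]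
    constructor <;> intro h h'
    · rw [h] at this ⊢
      rw [h']
      simp at this ⊢
      linarith
    · simp [tangleCopy] at h
  · have := (returnPath_mem hN hN1 (tangleCopy N (.inr i) (.inl j)) (.inl j) (.inr i) t).2.1
    rw [xi_active hN]
    constructor <;> intro h h'
    · simp [tangleCopy] at h
    · rw [h] at this ⊢
      rw [h']
      simp at this ⊢
      linarith
  · exact absurd (congrArg Sum.inr (Subsingleton.elim i j)) hij

theorem xi_copy_inHalf {N : ℕ} (hN : N % 2 = 1) (i : TangleIdx N) {e : ℤ} (he : e % 2 = 0) :
    InHalf e (xi N 1 i - xi N (-1) i) ∨ InHalf e (xi N (-1) i - xi N 1 i) := by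
  have h1 := xi_re_copy hN 1 (-1) i
  have h2 := xi_re_copy hN (-1) 1 i
  simp at h1 h2
  rcases (show e % 4 = 0 ∨ e % 4 = 2 by omega) with h | h
  · left
    rw [inHalf_right h, Complex.sub_re]
    linarith
  · right
    rw [inHalf_left h, Complex.sub_re]
    linarith

/-- The loop in `Conf²` of two points of the arc. It only depends on the numbers of the half planes
in which the moving point is seen at the beginning, `b` (or `S`), and on its arrival, `e`. -/
theorem tangleLoop₂_aux {N : ℕ} (hN : N % 2 = 1) (hN1 : 1 ≤ N) {i j : TangleIdx N} (hij : i ≠ j)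
    {b e S : ℤ}
    (hside : (∀ c d, arcParam N c i < arcParam N d j) ∨ (∀ c d, arcParam N d j < arcParam N c i))
    (hb : ∀ d d', InHalf b (xi N d i - xi N d' j)) (he : e % 2 = 0)
    (hT : ∀ d d₁ d₂, InHalf e (xi N d₂ j - xi N d₁ j) →
      Turns (fun u => arc N u - xi N d₁ j) (arcParam N d i) (arcParam N d₂ j)
      (ang b (xi N d i - xi N d₁ j)) (ang e (xi N d₂ j - xi N d₁ j)))
    (hS : (tangleCopy N i j = -1 ∧ tangleCopy N j i = 1 ∧ S % 4 = 2) ∨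
      (tangleCopy N i j = 1 ∧ tangleCopy N j i = -1 ∧ S % 4 = 0)) (hSb : |b - S| ≤ 2) :
    (∀ t, (tangleLoop₂ N hN1 i j t).1 ≠ (tangleLoop₂ N hN1 i j t).2) ∧
      phi (tangleLoop₂ N hN1 i j) = (e - S) / 2 := by
  have hret := returnPath_inHalf hN hN1 hij
  have h0 : ∀ d d₁ d₂ : SignType, Turns (fun u => arc N u - xi N d i) (arcParam N d₁ j)
      (arcParam N d₂ j) (ang (b + 2) (xi N d₁ j - xi N d i))
      (ang (b + 2) (xi N d₂ j - xi N d i)) := by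
    intro d d₁ d₂
    have h := rank_lt hN1 j
    have h1 := arcParam_mem hN1 d₁ j
    have h2 := arcParam_mem hN1 d₂ j
    refine turns_side _ _ (b + 2) (k := 2 * rank j + 1) (by omega) ?_ ?_ ?_ ?_ ?_ ?_
    · push_cast; linarith
    · push_cast; linarith
    · push_cast; linarith
    · push_cast; linarith
    · have := inHalf_neg.mpr (hb d d₁)
      rwa [neg_sub] at this
    · have := inHalf_neg.mpr (hb d d₂)
      rwa [neg_sub] at this
  have main : ∀ r : ℤ, r % 2 = 0 → S % 4 = r % 4 → (∀ t, InHalf r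
      (returnPath N hN1 (tangleCopy N i j) j i t - xi N (tangleCopy N j i) j)) →
      (InHalf e (xi N (tangleCopy N i j) j - xi N (tangleCopy N j i) j) ∨
        InHalf e (xi N (tangleCopy N j i) j - xi N (tangleCopy N i j) j)) →
      (∀ t, (tangleLoop₂ N hN1 i j t).1 ≠ (tangleLoop₂ N hN1 i j t).2) ∧
      phi (tangleLoop₂ N hN1 i j) = (e - S) / 2 := by
    intro r hr hSr hret he'
    have hr0 := hret 0
    have hr1 := hret 1
    rw [Path.source] at hr0
    rw [Path.target] at hr1
    have := twoPointLoop_phi (c := arc N) (s₀ := arcParam N (tangleCopy N i j) i)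
      (s₁ := arcParam N (tangleCopy N i j) j) (s₂ := arcParam N (tangleCopy N j i) j)
      (ret := returnPath N hN1 (tangleCopy N i j) j i) (b := b) (e := e) (r := r) (r' := r) (S := S)
      (hside.imp (fun h => ⟨h _ _, h _ _⟩) (fun h => ⟨h _ _, h _ _⟩)) he' (hT _ _ _) (hT _ _ _)
      (h0 _ _ _) (lifts_of_inHalf (g := fun z => z - xi N (tangleCopy N j i) j) (by fun_prop) hret)
      hr0 hr1 (hb _ _) (by omega) hSr hSb
    rw [show e + r - r - S = e - S by ring] at this
    exact this
  rcases hS with ⟨h1, h2, h3⟩ | ⟨h1, h2, h3⟩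
  · refine main 2 rfl h3 (fun t => (hret t).1 h1 h2) ?_
    rw [h1, h2]
    exact (xi_copy_inHalf hN j he).symm
  · refine main 0 rfl h3 (fun t => (hret t).2 h1 h2) ?_
    rw [h1, h2]
    exact xi_copy_inHalf hN j he

theorem tangle_phi_back {N : ℕ} (hN : N % 2 = 1) (hN1 : 1 ≤ N) {i j : TangleIdx N}
    (h : precedes i j) (hij : i ≠ j) :
    (∀ t, (tangleLoop₂ N hN1 i j t).1 ≠ (tangleLoop₂ N hN1 i j t).2) ∧
      phi (tangleLoop₂ N hN1 i j) = 0 := by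
  have := tangleLoop₂_aux hN hN1 hij (b := lookBack i j) (e := 2 * rank j + 2)
    (S := 2 * rank j + 2) (Or.inl fun c d => h.arcParam_lt hN1 c d)
    (fun d d' => inHalf_lookBack hN h d d') (by omega) (fun d d₁ d₂ he => turns_back hN h d he)
    (by
      rcases h.tangleCopy_eq hN with ⟨h1, h2, h3⟩ | ⟨h1, h2, h3⟩
      · exact Or.inl ⟨h2, h3, by omega⟩
      · exact Or.inr ⟨h2, h3, by omega⟩)
    (by rw [lookBack, abs_le]; split_ifs <;> omega)
  simpa using this

theorem tangle_phi_ahead {N : ℕ} (hN : N % 2 = 1) (hN1 : 1 ≤ N) {i j : TangleIdx N}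
    (h : precedes j i) (hij : i ≠ j) :
    (∀ t, (tangleLoop₂ N hN1 i j t).1 ≠ (tangleLoop₂ N hN1 i j t).2) ∧
      phi (tangleLoop₂ N hN1 i j) = rank j - rank i := by
  have hr := h.rank_le
  have := tangleLoop₂_aux hN hN1 hij (b := lookAhead i j) (e := 2 * rank j + 4)
    (S := 2 * rank i + 4) (Or.inr fun c d => h.arcParam_lt hN1 d c)
    (fun d d' => inHalf_lookAhead hN h d d') (by omega) (fun d d₁ d₂ he => turns_ahead hN h d he)
    (by
      rcases h.tangleCopy_eq hN with ⟨h1, h2, h3⟩ | ⟨h1, h2, h3⟩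
      · exact Or.inr ⟨h3, h2, by omega⟩
      · exact Or.inl ⟨h3, h2, by omega⟩)
    (by rw [lookAhead, abs_le]; split_ifs <;> omega)
  refine ⟨this.1, this.2.trans ?_⟩
  omega

/-! ### Winding numbers about the punctures of the tangle -/

theorem tangleLoc_Xminus {N : ℕ} (hN : N % 2 = 1) : tangleLoc N .Xminus = ⟨-4, 0⟩ := by
  apply Complex.ext <;> simp [tangleLoc, (Nat.odd_iff.mpr hN).neg_one_pow]

theorem tangleLoc_Y {N : ℕ} (hN : N % 2 = 1) : tangleLoc N .Y = ⟨4, 0⟩ := by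
  apply Complex.ext <;> simp [tangleLoc, (Nat.odd_iff.mpr hN).neg_one_pow]

theorem tangleLoc_Xplus (N : ℕ) : tangleLoc N .Xplus = ⟨4 * (N + 1), 0⟩ := by
  apply Complex.ext <;> simp [tangleLoc]

theorem xi_inHalf_im {N : ℕ} (hN : N % 2 = 1) (c : SignType) (i : TangleIdx N) {p : ℂ}
    (hp : p.im = 0) : InHalf (2 * rank i + 3) (xi N c i - p) := by
  have h0 : (0 : ℝ) ≤ rank i := Nat.cast_nonneg _
  rcases neg_one_pow_cases (rank i) with ⟨a, a'⟩ | ⟨a, a'⟩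
  · rw [inHalf_above (by omega), Complex.sub_im, xi_im hN, a', hp]
    linarith
  · rw [inHalf_below (by omega), Complex.sub_im, xi_im hN, a', hp]
    linarith

/-- The arc spirals around both inner punctures. -/
theorem turns_inner {N : ℕ} (hN : N % 2 = 1) {p : ℂ} (hre : |p.re| ≤ 4) (him : p.im = 0)
    {i j : ℕ} (hi : 1 ≤ i) (hij : i ≤ j) (hj : j < 2 * N) {s t : ℝ} (hs0 : i ≤ s) (hs1 : s ≤ i + 1)
    (ht0 : j ≤ t) (ht1 : t ≤ j + 1) (hst : s ≤ t) (hs : InHalf (i + 2) (arc N s - p))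
    (ht : InHalf (j + 2) (arc N t - p)) :
    Turns (fun u => arc N u - p) s t (ang (i + 2) (arc N s - p)) (ang (j + 2) (arc N t - p)) := by
  have key : ∀ m, 1 ≤ m → m ≤ 2 * N → InHalf (m + 2) (arcVertex N m - p) ∧
      InHalf (m + 2) (arcVertex N (m + 1) - p) := by
    intro m hm hm'
    refine arcVertex_inHalf hN hm' (fun h => hre.trans_lt ?_) (fun h => ?_)
    · have : (1 : ℝ) ≤ (m / 2 : ℕ) := by exact_mod_cast (show 1 ≤ m / 2 by omega)
      linarith
    · rw [him, abs_zero]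
      positivity
  refine turns_polyline (arcVertex N) (M := 2 * N + 1) p (fun m => (m : ℤ) + 2) hij (by omega) hs0
    hs1 ht0 ht1 hst hs ht (fun m hm hm' => ⟨(key m (by omega) (by omega)).2,
      (key (m + 1) (by omega) (by omega)).1, ?_⟩)
  push_cast
  rw [abs_le]
  constructor <;> linarith

/-- The arc up to the inactive axis lies to the left of the right puncture. -/
theorem turns_outer {N : ℕ} (hN : N % 2 = 1) {i j : ℕ} (hij : i ≤ j) (hj : j < 2 * N) {s t : ℝ}
    (hs0 : i ≤ s) (hs1 : s ≤ i + 1) (ht0 : j ≤ t) (ht1 : t ≤ j + 1) (hst : s ≤ t)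
    (hs : (arc N s).re < 4 * (N + 1)) (ht : (arc N t).re < 4 * (N + 1)) :
    Turns (fun u => arc N u - tangleLoc N .Xplus) s t (ang 2 (arc N s - tangleLoc N .Xplus))
      (ang 2 (arc N t - tangleLoc N .Xplus)) := by
  have h2 : ∀ z : ℂ, InHalf 2 (z - tangleLoc N .Xplus) ↔ z.re < 4 * (N + 1) := by
    intro z
    rw [inHalf_left (by norm_num), tangleLoc_Xplus, Complex.sub_re]
    simp only
    constructor <;> intro h <;> linarith
  have key : ∀ m < 2 * N, InHalf 2 (arcVertex N m - tangleLoc N .Xplus) := by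
    intro m hm
    rw [h2]
    obtain ⟨k, hk⟩ : ∃ k, m = 2 * k ∨ m = 2 * k + 1 := ⟨m / 2, by omega⟩
    have hkN : (k : ℝ) + 1 ≤ N := by exact_mod_cast (show k + 1 ≤ N by omega)
    have hk0 : (0 : ℝ) ≤ k := Nat.cast_nonneg k
    have e : (arcVertex N m).re = -(-1) ^ k * (4 * (k + 1)) := by
      rcases hk with rfl | rfl
      · rw [arcVertex_even hN]
      · rw [arcVertex_odd hN (by omega)]
    rw [e]
    rcases neg_one_pow_cases k with ⟨a, a'⟩ | ⟨a, a'⟩ <;> rw [a'] <;> linarith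
  exact turns_polyline (arcVertex N) (M := 2 * N + 1) _ (fun _ => 2) hij (by omega) hs0
    hs1 ht0 ht1 hst ((h2 _).mpr hs) ((h2 _).mpr ht) (fun m hm hm' => ⟨key _ (by omega),
      key _ (by omega), by simp⟩)

theorem xi_re_lt {N : ℕ} (hN : N % 2 = 1) (c : SignType) (i : TangleIdx N) :
    (xi N c i).re < 4 * (N + 1) := by
  have h0 : (0 : ℝ) ≤ N := Nat.cast_nonneg _
  obtain ⟨hc, hc'⟩ := signType_mem c
  rcases i with i | i
  · rw [xi_active hN]
    simp only
    linarith
  · rw [xi_inactive hN]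
    simp only
    linarith

theorem returnPath_left {N : ℕ} (hN : N % 2 = 1) (hN1 : 1 ≤ N) (c : SignType) (j i : TangleIdx N)
    (t : I) : InHalf 2 (returnPath N hN1 c j i t - tangleLoc N .Xplus) := by
  obtain ⟨hc, hc'⟩ := signType_mem c
  have := (returnPath_mem hN hN1 c j i t).2.2
  rw [inHalf_left (by norm_num), tangleLoc_Xplus, Complex.sub_re]
  simp only
  linarith

theorem tangle_psiOne_Xplus {N : ℕ} (hN : N % 2 = 1) (hN1 : 1 ≤ N) (i j : TangleIdx N) :
    psiOne (tangleLoc N .Xplus) (tangleLoop N hN1 i j) = 0 := by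
  have hT : ∀ i j : TangleIdx N, arcParam N 0 i ≤ arcParam N 0 j → rank i ≤ rank j →
      Turns (fun u => arc N u - tangleLoc N .Xplus) (arcParam N 0 i) (arcParam N 0 j)
      (ang 2 (xi N 0 i - tangleLoc N .Xplus)) (ang 2 (xi N 0 j - tangleLoc N .Xplus)) := by
    intro i j h hr
    have hi := arcParam_mem hN1 0 i
    have hj := arcParam_mem hN1 0 j
    have := rank_lt hN1 j
    exact turns_outer hN (i := 2 * rank i + 1) (j := 2 * rank j + 1) (by omega) (by omega)
      (by push_cast; linarith) (by push_cast; linarith) (by push_cast; linarith)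
      (by push_cast; linarith) h (xi_re_lt hN 0 i) (xi_re_lt hN 0 j)
  have h1 : Turns (fun u => arc N u - tangleLoc N .Xplus) (arcParam N 0 i) (arcParam N 0 j)
      (ang 2 (xi N 0 i - tangleLoc N .Xplus)) (ang 2 (xi N 0 j - tangleLoc N .Xplus)) := by
    rcases eq_or_ne i j with rfl | hij
    · exact hT _ _ le_rfl le_rfl
    · rcases precedes_total hij with h | h
      · exact hT _ _ (h.arcParam_lt hN1 0 0).le h.rank_le
      · exact (hT _ _ (h.arcParam_lt hN1 0 0).le h.rank_le).symm
  have h2 : Lifts (fun z => z - tangleLoc N .Xplus) (returnPath N hN1 0 j i)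
      (ang 2 (xi N 0 j - tangleLoc N .Xplus)) (ang 2 (xi N 0 i - tangleLoc N .Xplus)) :=
    lifts_of_inHalf (by fun_prop) (returnPath_left hN hN1 0 j i)
  have := psiOne_eq (k := 0) (a := 2) (V := tangleLoc N .Xplus) (γ := tangleLoop N hN1 i j)
    (h1.lifts.trans h2)
  simpa using this

/-- The loop from `ξ_i` to `ξ_ω` and back winds clockwise around the inner punctures. -/
theorem tangle_psiOne_inner {N : ℕ} (hN : N % 2 = 1) (hN1 : 1 ≤ N) (i : Fin N) {p : ℂ}
    (hre : |p.re| ≤ 4) (him : p.im = 0) {r k : ℤ}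
    (hret : Lifts (fun z => z - p) (returnPath N hN1 0 (.inr 0) (.inl i))
      (ang (2 * N + 1) (xi N 0 (.inr 0) - p)) (ang r (xi N 0 (.inl i) - p)))
    (hr : InHalf (r - 4 * k) (xi N 0 (.inl i) - p))
    (hrk : |2 * (i : ℕ) + 3 - (r - 4 * k)| ≤ 2) :
    psiOne p (tangleLoop N hN1 (.inl i) (.inr 0)) = 2 * k := by
  have hi := arcParam_mem hN1 0 (.inl i : TangleIdx N)
  have hj := arcParam_mem hN1 0 (.inr 0 : TangleIdx N)
  have e : ((rank (.inr 0 : TangleIdx N) : ℕ) : ℤ) = N - 1 := by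
    simp only [rank]
    omega
  have hlt := rank_lt hN1 (.inr 0 : TangleIdx N)
  have hp : precedes (.inl i : TangleIdx N) (.inr 0) := trivial
  have h1 := xi_inHalf_im hN 0 (.inl i) him
  have h2 := xi_inHalf_im hN 0 (.inr 0) him
  have T := turns_inner hN hre him (i := 2 * rank (.inl i : TangleIdx N) + 1)
    (j := 2 * rank (.inr 0 : TangleIdx N) + 1) (by omega) (by have := hp.rank_le; omega) (by omega)
    (by push_cast; linarith) (by push_cast; linarith) (by push_cast; linarith)
    (by push_cast; linarith) (hp.arcParam_lt hN1 0 0).le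
    (by push_cast; rw [add_assoc]; exact h1) (by push_cast; rw [add_assoc]; exact h2)
  have e1 : ((2 * rank (.inl i : TangleIdx N) + 1 : ℕ) : ℤ) + 2 = 2 * (i : ℕ) + 3 := by
    simp only [rank]
    push_cast
    ring
  have e2 : ((2 * rank (.inr 0 : TangleIdx N) + 1 : ℕ) : ℤ) + 2 = 2 * N + 1 := by
    push_cast
    rw [e]
    ring
  rw [e1, e2] at T
  have h1' : InHalf (2 * (i : ℕ) + 3) (xi N 0 (.inl i) - p) := h1
  apply psiOne_eq (a := r - 4 * k)
  have E : ang (2 * (i : ℕ) + 3) (arc N (arcParam N 0 (.inl i)) - p) =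
      ang (r - 4 * k) (arc N (arcParam N 0 (.inl i)) - p) := ang_eq h1' hr hrk
  rw [sub_add_cancel, ← E]
  exact T.lifts.trans hret

theorem tangle_psiOne_Xminus {N : ℕ} (hN : N % 2 = 1) (hN1 : 1 ≤ N) (i : Fin N) :
    psiOne (tangleLoc N .Xminus) (tangleLoop N hN1 (.inl i) (.inr 0)) =
      2 * ((N - i) / 2 : ℤ) := by
  have hre : |(tangleLoc N .Xminus).re| ≤ 4 := by
    rw [tangleLoc_Xminus hN]
    simp
  have him : (tangleLoc N .Xminus).im = 0 := by
    rw [tangleLoc_Xminus hN]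
  have hret : ∀ t, InHalf (2 * N + 2)
      (returnPath N hN1 0 (.inr 0) (.inl i) t - tangleLoc N .Xminus) := by
    intro t
    have := (returnPath_mem hN hN1 0 (.inr 0) (.inl i) t).2.1
    rw [inHalf_right (by omega), tangleLoc_Xminus hN, Complex.sub_re]
    simp at this ⊢
    linarith
  have hs := hret 0
  have ht := hret 1
  rw [Path.source] at hs
  rw [Path.target] at ht
  have h2 := xi_inHalf_im hN 0 (.inr 0) him
  have e : ((rank (.inr 0 : TangleIdx N) : ℕ) : ℤ) = N - 1 := by
    simp only [rank]
    omega
  rw [e, show 2 * ((N : ℤ) - 1) + 3 = 2 * N + 1 by ring] at h2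
  have hL := lifts_of_inHalf (g := fun z => z - tangleLoc N .Xminus) (by fun_prop) hret
  have E : ang (2 * N + 1) (arc N (arcParam N 0 (.inr 0)) - tangleLoc N .Xminus) =
      ang (2 * N + 2) (arc N (arcParam N 0 (.inr 0)) - tangleLoc N .Xminus) :=
    ang_eq h2 hs (by rw [abs_le]; constructor <;> linarith)
  rw [← E] at hL
  refine tangle_psiOne_inner hN hN1 i hre him hL ((inHalf_congr (by omega) _).mp ht) ?_
  have := i.2
  rw [abs_le]
  omega

theorem tangle_psiOne_Y {N : ℕ} (hN : N % 2 = 1) (hN1 : 1 ≤ N) (i : Fin N) :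
    psiOne (tangleLoc N .Y) (tangleLoop N hN1 (.inl i) (.inr 0)) =
      2 * ((N - 1 - i) / 2 : ℤ) := by
  have hre : |(tangleLoc N .Y).re| ≤ 4 := by
    rw [tangleLoc_Y hN]
    simp
  have him : (tangleLoc N .Y).im = 0 := by
    rw [tangleLoc_Y hN]
  have hN' : (1 : ℝ) ≤ N := by exact_mod_cast hN1
  -- the return path passes above `Y` to the active axis, which lies to the left of `Y`
  have hab : ∀ t, InHalf (2 * N + 1) (((axisPath N hN1 0 (.inr 0) (.inr 0) rfl).trans
      (along (arc N) (arcParam N 0 (.inr 0)) (arcParam N 0 (topActive N hN1)))) t -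
        tangleLoc N .Y) := by
    refine forall_trans (P := fun z => InHalf (2 * N + 1) (z - tangleLoc N .Y)) (fun t => ?_)
      (fun t => ?_)
    · rw [inHalf_above (by omega), tangleLoc_Y hN, Complex.sub_im]
      change 0 < (vertical _ (height N (.inr 0) +
        t * (height N (.inr 0) - height N (.inr 0)))).im - 0
      rw [vertical_apply]
      simp only [height]
      linarith
    · rw [inHalf_above (by omega), tangleLoc_Y hN, Complex.sub_im,
        (along_top hN hN1 0 (Or.inr rfl) (Or.inl rfl) t).1]
      simp only
      linarith
  have hle : ∀ t, InHalf (2 * N) (axisPath N hN1 0 (topActive N hN1) (.inl i) rfl t -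
        tangleLoc N .Y) := by
    intro t
    rw [inHalf_left (by omega), tangleLoc_Y hN, Complex.sub_re]
    have e := axisPath_re hN1 0 (topActive N hN1) (.inl i) rfl t
    exact sub_neg.mpr (e.trans_lt (by simp [axisX, topActive]))
  have h1 := hab 1
  have h2 := hle 0
  have h3 := hle 1
  rw [Path.target] at h1 h3
  rw [Path.source] at h2
  have L1 := lifts_of_inHalf (g := fun z => z - tangleLoc N .Y) (by fun_prop) hab
  have L2 := lifts_of_inHalf (g := fun z => z - tangleLoc N .Y) (by fun_prop) hle
  rw [ang_eq h1 h2 (by rw [abs_le]; constructor <;> linarith)] at L1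
  refine tangle_psiOne_inner hN hN1 i hre him (L1.trans L2) ((inHalf_congr (by omega) _).mp h3) ?_
  have := i.2
  rw [abs_le]
  omega

/-- The loop of `ξ_ω` with itself is constant. -/
theorem tangle_psiOne_omega {N : ℕ} (hN : N % 2 = 1) (hN1 : 1 ≤ N) {p : ℂ}
    (hre : |p.re| ≤ 4) : psiOne p (tangleLoop N hN1 (.inr 0) (.inr 0)) = 0 := by
  have hp := abs_le.mp hre
  have hN' : (1 : ℝ) ≤ N := by exact_mod_cast hN1
  have h : ∀ t, InHalf 0 (tangleLoop N hN1 (.inr 0) (.inr 0) t - p) := by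
    refine forall_trans (P := fun z => InHalf 0 (z - p)) (fun t => ?_) (fun t => ?_)
    · rw [inHalf_right (by norm_num), Complex.sub_re]
      have : along (arc N) (arcParam N 0 (.inr 0)) (arcParam N 0 (.inr 0)) t = xi N 0 (.inr 0) := by
        simp [along, xi]
      rw [this, xi_inactive hN]
      simp
      linarith
    · rw [inHalf_right (by norm_num), Complex.sub_re, returnPath, axisPath_re]
      simp [axisX]
      linarith
  have L := lifts_of_inHalf (g := fun z => z - p) (by fun_prop) h
  have := psiOne_eq (k := 0) (a := 0) L
  simpa using this

/-- The matrix of the tangle; the loops do not wind around `X⁺`, and around the two inner punctures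
together once for each remaining crossing. -/
theorem tangleMatrix_eq {N : ℕ} (hN : N % 2 = 1) (hN1 : 1 ≤ N) (i j : TangleIdx N) :
    tangleMatrix N hN1 i j = N - 1 - max (rank i) (rank j) := by
  have hZ : ¬ middle N = .Xplus := by
    simp only [middle]
    split_ifs <;> simp
  have hP : ∀ i j, psi (tangleLoc N) {.Xplus} (tangleLoop N hN1 i j) = 0 := by
    intro i j
    simp [psi, tangle_psiOne_Xplus hN]
  have hre1 : |(tangleLoc N .Xminus).re| ≤ 4 := by
    rw [tangleLoc_Xminus hN]
    simp
  have hre2 : |(tangleLoc N .Y).re| ≤ 4 := by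
    rw [tangleLoc_Y hN]
    simp
  have hD : ∀ i : TangleIdx N, psi (tangleLoc N) {.Xminus, .Y} (tangleLoop N hN1 i (.inr 0)) =
      N - 1 - rank i := by
    intro i
    rw [psi, Finset.sum_pair (by decide)]
    rcases i with i | i
    · rw [tangle_psiOne_Xminus hN, tangle_psiOne_Y hN]
      simp only [rank]
      have := i.2
      omega
    · rw [Subsingleton.elim i 0, tangle_psiOne_omega hN hN1 hre1,
        tangle_psiOne_omega hN hN1 hre2]
      simp only [rank]
      omega
  simp only [tangleMatrix, hZ, hP, hD, if_false]
  rcases eq_or_ne i j with rfl | hij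
  · simp
  · rw [if_neg hij]
    rcases precedes_total hij with h | h
    · rw [(tangle_phi_ahead hN hN1 h hij.symm).2]
      have := h.rank_le
      omega
    · rw [(tangle_phi_back hN hN1 h hij.symm).2]
      have := h.rank_le
      omega

/-! ### Well-posedness of the picture of the tangle -/

theorem polyline_vertex (v : ℕ → ℂ) {M k : ℕ} (hk : k < M) : polyline v M k = v k := by
  rw [polyline_apply v hk (x := 0) (by simp) le_rfl zero_le_one]
  simp

/-- Every point of a polygonal curve lies on one of its sides. -/
theorem polyline_mem_side (v : ℕ → ℂ) {M : ℕ} (hM : 0 < M) (t : ℝ) :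
    ∃ k < M, ∃ x : ℝ, 0 ≤ x ∧ x ≤ 1 ∧ polyline v M t = v k + x * (v (k + 1) - v k) := by
  rcases lt_or_ge t 0 with ht | ht
  · refine ⟨0, hM, 0, le_rfl, zero_le_one, ?_⟩
    change v 0 + ∑ j ∈ Finset.range M, _ = _
    rw [Finset.sum_eq_zero]
    · simp
    · intro j _
      have : (0 : ℝ) ≤ j := Nat.cast_nonneg j
      rw [max_eq_left ((min_le_right _ _).trans (by linarith))]
      simp
  rcases lt_or_ge t M with htM | htM
  · have h1 := Nat.floor_le ht
    have h2 := Nat.lt_floor_add_one t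
    have hk : ⌊t⌋₊ < M := by
      have : ((⌊t⌋₊ : ℕ) : ℝ) < M := by linarith
      exact_mod_cast this
    refine ⟨⌊t⌋₊, hk, t - ⌊t⌋₊, by linarith, by linarith, ?_⟩
    exact polyline_apply v hk (by ring) (by linarith) (by linarith)
  · refine ⟨M - 1, by omega, 1, zero_le_one, le_rfl, ?_⟩
    change v 0 + ∑ j ∈ Finset.range M, _ = _
    rw [Finset.sum_congr rfl (g := fun j => v (j + 1) - v j)]
    · rw [Finset.sum_range_sub, Nat.sub_add_cancel (by omega)]
      simp
    · intro j hj
      have : (j : ℝ) + 1 ≤ M := by exact_mod_cast Finset.mem_range.mp hj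
      rw [min_eq_left (by linarith), max_eq_right zero_le_one]
      simp

/-- The sides of the arc: vertical ones, and horizontal ones at the heights of the points `ξ_k`. -/
theorem arc_cases {N : ℕ} (hN : N % 2 = 1) (t : ℝ) :
    (∃ k : ℕ, (arc N t).re = -(-1) ^ k * (4 * (k + 1))) ∨
    ∃ k < N, ∃ x : ℝ, 0 ≤ x ∧ x ≤ 1 ∧ arc N t =
      ⟨(-1) ^ k * (x * (8 * k + 12) - 4 * (k + 1)), (-1) ^ k * (4 * (k + 1))⟩ := by
  obtain ⟨m, hm, x, h0, h1, h⟩ := polyline_mem_side (arcVertex N) (M := 2 * N + 1) (by omega) t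
  change arc N t = _ at h
  rw [h]
  obtain ⟨k, rfl | rfl⟩ : ∃ k, m = 2 * k ∨ m = 2 * k + 1 := ⟨m / 2, by omega⟩
  · left
    refine ⟨k, ?_⟩
    rcases eq_or_ne k N with hk | hk
    · rw [arcVertex_even hN, hk, arcVertex_last]
      rcases neg_one_pow_cases N with ⟨a, a'⟩ | ⟨a, a'⟩
      · omega
      · simp [a']
    · rw [arcVertex_even hN, arcVertex_odd hN (by omega)]
      simp
  · right
    refine ⟨k, by omega, x, h0, h1, ?_⟩
    rw [show 2 * k + 1 + 1 = 2 * (k + 1) by ring, arcVertex_even hN, arcVertex_odd hN (by omega),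
      pow_succ]
    apply Complex.ext
    · simp
      ring
    · simp

theorem tangle_active_bijOn {N : ℕ} (hN : N % 2 = 1) :
    Set.BijOn (fun k : Fin N => arc N (arcParam N 0 (.inl k))) Set.univ
      (Set.range (arc N) ∩ {z | z.re = 0}) := by
  change Set.BijOn (fun k : Fin N => xi N 0 (.inl k)) _ _
  refine ⟨fun k _ => ⟨⟨_, rfl⟩, ?_⟩, fun k _ l _ hkl => ?_, ?_⟩
  · change (xi N 0 (.inl k)).re = 0
    rw [xi_active hN]
    simp
  · have h := congrArg (fun z : ℂ => |z.im|) hkl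
    simp only [xi_active hN] at h
    rw [abs_neg_one_pow_mul _ (by positivity), abs_neg_one_pow_mul _ (by positivity)] at h
    have : ((k : ℕ) : ℝ) = (l : ℕ) := by linarith
    exact Fin.ext (by exact_mod_cast this)
  · rintro _ ⟨⟨t, rfl⟩, ht⟩
    change (arc N t).re = 0 at ht
    rcases arc_cases hN t with ⟨k, hk⟩ | ⟨k, hk, x, h0, h1, h⟩
    · have hk0 : (0 : ℝ) ≤ k := Nat.cast_nonneg k
      rw [hk] at ht
      rcases neg_one_pow_cases k with ⟨a, a'⟩ | ⟨a, a'⟩ <;> rw [a'] at ht <;> linarith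
    · refine ⟨⟨k, hk⟩, trivial, ?_⟩
      simp only [xi_active hN]
      rw [h] at ht ⊢
      apply Complex.ext
      · simpa using ht.symm
      · rfl

theorem tangle_inactive_bijOn {N : ℕ} (hN : N % 2 = 1) :
    Set.BijOn (fun k : Fin 1 => arc N (arcParam N 0 (.inr k))) Set.univ
      (Set.range (arc N) ∩ {z | z.re = 4 * N + 2}) := by
  change Set.BijOn (fun k : Fin 1 => xi N 0 (.inr k)) _ _
  refine ⟨fun k _ => ⟨⟨_, rfl⟩, ?_⟩, fun k _ l _ _ => Subsingleton.elim k l, ?_⟩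
  · change (xi N 0 (.inr k)).re = 4 * N + 2
    rw [xi_inactive hN]
    simp
  · rintro _ ⟨⟨t, rfl⟩, ht⟩
    change (arc N t).re = 4 * N + 2 at ht
    refine ⟨0, trivial, ?_⟩
    rcases arc_cases hN t with ⟨k, hk⟩ | ⟨k, hk, x, h0, h1, h⟩
    · exfalso
      rw [hk] at ht
      -- the abscissas of the vertical sides are divisible by `4`
      rcases neg_one_pow_cases k with ⟨a, a'⟩ | ⟨a, a'⟩
      · have : -(1 : ℤ) * (4 * (k + 1)) = 4 * N + 2 := by
          rw [a'] at ht
          exact_mod_cast ht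
        omega
      · have : (1 : ℤ) * (4 * (k + 1)) = 4 * N + 2 := by
          rw [a', neg_neg] at ht
          exact_mod_cast ht
        omega
    · have hkN : (k : ℝ) + 1 ≤ N := by exact_mod_cast hk
      have hk0 : (0 : ℝ) ≤ k := Nat.cast_nonneg k
      have hx : x * (8 * k + 12) ≤ 8 * k + 12 := mul_le_of_le_one_left (by linarith) h1
      have hx0 : 0 ≤ x * (8 * (k : ℝ) + 12) := by positivity
      simp only [xi_inactive hN]
      rw [h] at ht ⊢
      rcases neg_one_pow_cases k with ⟨a, a'⟩ | ⟨a, a'⟩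
      · rw [a'] at ht ⊢
        simp only [one_mul] at ht ⊢
        have : N = k + 1 := by
          have h3 : (N : ℝ) < k + 2 := by linarith
          have h4 : N < k + 2 := by exact_mod_cast h3
          omega
        subst this
        rw [ht]
        push_cast
        simp
      · rw [a'] at ht
        simp only at ht
        linarith

/-- The parameters of all intersection points lie in a range in which the arc avoids the
punctures. -/
theorem arcParam_mem_Icc {N : ℕ} (hN1 : 1 ≤ N) (c : SignType) (i : TangleIdx N) :
    arcParam N c i ∈ Set.Icc 1 (arcParam N 1 (.inr 0)) := by
  have h := arcParam_mem hN1 c i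
  have h0 : (0 : ℝ) ≤ rank i := Nat.cast_nonneg _
  refine ⟨by linarith, ?_⟩
  rcases i with i | i
  · exact (precedes.arcParam_lt hN1 (show precedes (.inl i : TangleIdx N) (.inr 0) from trivial)
      c 1).le
  · obtain ⟨hc, hc'⟩ := signType_mem c
    simp only [arcParam]
    gcongr
    simpa using hc'

theorem arc_mem_puncturedPlane {N : ℕ} (hN : N % 2 = 1) {u : ℝ}
    (hu : u ∈ Set.Icc 1 (arcParam N 1 (.inr 0))) : arc N u ∈ puncturedPlane (tangleLoc N) := by
  have hN1 : 1 ≤ N := by omega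
  have hm := arcParam_mem hN1 1 (.inr 0 : TangleIdx N)
  have e : ((rank (.inr 0 : TangleIdx N) : ℕ) : ℝ) = N - 1 := by
    simp only [rank]
    rw [Nat.cast_sub hN1]
    simp
  rw [e] at hm
  have e' : ((2 * N - 1 : ℕ) : ℝ) = 2 * N - 1 := by
    rw [Nat.cast_sub (by omega)]
    push_cast
    ring
  have hle := hu.1.trans hu.2
  have hmem : u ∈ Set.uIcc 1 (arcParam N 1 (.inr 0)) := by rwa [Set.uIcc_of_le hle]
  have hinner : ∀ p : ℂ, |p.re| ≤ 4 → p.im = 0 → arc N u ≠ p := by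
    intro p hre him
    have h1 : InHalf ((1 : ℕ) + 2) (arc N 1 - p) := by
      have : arc N 1 = arcVertex N 1 := by
        have := polyline_vertex (arcVertex N) (M := 2 * N + 1) (k := 1) (by omega)
        rwa [Nat.cast_one] at this
      rw [this]
      refine (arcVertex_inHalf hN (by omega) (by omega) (fun _ => ?_)).1
      rw [him]
      simp
    have h2 := xi_inHalf_im hN 1 (.inr 0) him
    have e2 : 2 * ((rank (.inr 0 : TangleIdx N) : ℕ) : ℤ) + 3 = (2 * N - 1 : ℕ) + 2 := by
      simp only [rank]
      omega
    rw [e2] at h2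
    have T := turns_inner hN hre him (i := 1) (j := 2 * N - 1) (by omega) (by omega) (by omega)
      (by norm_num) (by norm_num) (by linarith) (by linarith) hle h1 h2
    exact sub_ne_zero.mp (T.ne_zero hmem)
  rintro (_ | _ | _)
  · exact hinner _ (by rw [tangleLoc_Xminus hN]; simp) (by rw [tangleLoc_Xminus hN])
  · have h1 : (arc N 1).re < 4 * (N + 1) := by
      have := polyline_vertex (arcVertex N) (M := 2 * N + 1) (k := 1) (by omega)
      rw [Nat.cast_one] at this
      have h0 : (0 : ℝ) ≤ N := Nat.cast_nonneg _
      rw [arc, this, show 1 = 2 * 0 + 1 by rfl, arcVertex_odd hN (by omega)]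
      simp
      linarith
    have T := turns_outer hN (i := 1) (j := 2 * N - 1) (by omega) (by omega)
      (by norm_num) (by norm_num) (by linarith) (by linarith) hle h1 (xi_re_lt hN 1 (.inr 0))
    exact sub_ne_zero.mp (T.ne_zero hmem)
  · exact hinner _ (by rw [tangleLoc_Y hN]; simp) (by rw [tangleLoc_Y hN])

theorem returnPath_mem_puncturedPlane {N : ℕ} (hN : N % 2 = 1) (hN1 : 1 ≤ N) (c : SignType)
    (j i : TangleIdx N) (t : I) :
    returnPath N hN1 c j i t ∈ puncturedPlane (tangleLoc N) := by
  obtain ⟨hc, hc'⟩ := signType_mem c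
  obtain ⟨h1, h2, h3⟩ := returnPath_mem hN hN1 c j i t
  rintro (_ | _ | _) h
  · rw [h, tangleLoc_Xminus hN] at h2
    simp only at h2
    linarith
  · rw [h, tangleLoc_Xplus] at h3
    simp only at h3
    linarith
  · rw [h, tangleLoc_Y hN] at h1
    simp only at h1
    rcases h1 with h1 | h1 | h1 <;> linarith

theorem tangleWellPosed {N : ℕ} (hN : N % 2 = 1) (hN1 : 1 ≤ N) : TangleWellPosed N hN1 := by
  refine ⟨tangle_active_bijOn hN, tangle_inactive_bijOn hN, fun i j => ?_, fun i j hij t => ?_⟩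
  · refine forall_trans (P := fun z => z ∈ puncturedPlane (tangleLoc N)) (fun r => ?_)
      (returnPath_mem_puncturedPlane hN hN1 0 j i)
    exact arc_mem_puncturedPlane hN (Set.ordConnected_Icc.uIcc_subset (arcParam_mem_Icc hN1 0 i)
      (arcParam_mem_Icc hN1 0 j) (affine_mem_uIcc _ _ r))
  · have hM := twoPointLoop_mem (c := arc N) (P := puncturedPlane (tangleLoc N))
      Set.ordConnected_Icc (arcParam_mem_Icc hN1 (tangleCopy N i j) i)
      (arcParam_mem_Icc hN1 (tangleCopy N i j) j) (arcParam_mem_Icc hN1 (tangleCopy N j i) j)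
      (fun _ hs => arc_mem_puncturedPlane hN hs)
      (returnPath_mem_puncturedPlane hN hN1 (tangleCopy N i j) j i) t
    refine ⟨hM.1, hM.2, ?_⟩
    rcases precedes_total hij with h | h
    · exact (tangle_phi_back hN hN1 h hij).1 t
    · exact (tangle_phi_ahead hN hN1 h hij).1 t

/-! ### The strands of the blue curve -/

/-- A strand of the blue curve, from the end of the band at `X⁻` to the end at `X⁺`. -/
def strandCurve (n : ℕ) (b : Bool) : C(ℝ, ℂ) := polyline (strandVertex n b) (4 * n + 5)

/-- The parameter on the blue curve of the point with parameter `s` of a strand. -/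
def blueTime (n : ℕ) (b : Bool) (s : ℝ) : ℝ := if b then s else 8 * n + 10 - s

theorem blue_blueTime (n : ℕ) (b : Bool) {s : ℝ} (h0 : 0 ≤ s) (h1 : s ≤ 4 * n + 5) :
    blue n (blueTime n b s) = strandCurve n b s := by
  obtain ⟨m, hm, hms, hsm⟩ : ∃ m : ℕ, m < 4 * n + 5 ∧ (m : ℝ) ≤ s ∧ s ≤ m + 1 := by
    rcases h1.eq_or_lt with rfl | h1
    · exact ⟨4 * n + 4, by omega, by push_cast; linarith, by push_cast; linarith⟩
    · refine ⟨⌊s⌋₊, ?_, Nat.floor_le h0, (Nat.lt_floor_add_one s).le⟩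
      rw [Nat.floor_lt h0]
      exact_mod_cast h1
  have e := fun k => (Complex.eta (strandVertex n b k)).symm
  rw [blueTime, blue_strand n b (e m) (e (m + 1)) hm (x := s - m) (by ring) (by linarith)
    (by linarith), strandCurve, polyline_mk _ (e m) (e (m + 1)) hm (x := s - m) (by ring)
    (by linarith) (by linarith)]

theorem strandVertex_below {n : ℕ} (b : Bool) {k : ℕ} (hk : k < n) : strandVertex n b (4 * k + 3) =
    ⟨16 * k + 4 + strandSign b, -(16 * k + 16 + strandSign b)⟩ := by
  have a1 : (4 * k + 3 + 1) / 4 = k + 1 := by omega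
  have a2 : (4 * k + 3 + 1) % 4 = 0 := by omega
  have a3 : 4 * k + 3 ≤ 4 * n + 2 := by omega
  simp only [strandVertex, a1, a2, a3]
  simp
  constructor <;> ring

theorem strandVertex_below_left {n : ℕ} (b : Bool) {k : ℕ} (hk : k < n) :
    strandVertex n b (4 * k + 4) =
      ⟨-(16 * k + 16 + strandSign b), -(16 * k + 16 + strandSign b)⟩ := by
  have a1 : (4 * k + 4 + 1) / 4 = k + 1 := by omega
  have a2 : (4 * k + 4 + 1) % 4 = 1 := by omega
  have a3 : 4 * k + 4 ≤ 4 * n + 2 := by omega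
  simp only [strandVertex, a1, a2, a3]
  simp
  ring

theorem strandVertex_above_left {n : ℕ} (b : Bool) {k : ℕ} (hk : k < n) :
    strandVertex n b (4 * k + 5) = ⟨-(16 * k + 16 + strandSign b), 16 * k + 16 + strandSign b⟩ := by
  have a1 : (4 * k + 5 + 1) / 4 = k + 1 := by omega
  have a2 : (4 * k + 5 + 1) % 4 = 2 := by omega
  have a3 : 4 * k + 5 ≤ 4 * n + 2 := by omega
  simp only [strandVertex, a1, a2, a3]
  simp
  constructor <;> ring

theorem strandVertex_above {n : ℕ} (b : Bool) {k : ℕ} (hk : k < n) : strandVertex n b (4 * k + 6) =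
    ⟨16 * k + 20 + strandSign b, 16 * k + 16 + strandSign b⟩ := by
  have a1 : (4 * k + 6 + 1) / 4 = k + 1 := by omega
  have a2 : (4 * k + 6 + 1) % 4 = 3 := by omega
  have a3 : 4 * k + 6 ≤ 4 * n + 2 := by omega
  simp only [strandVertex, a1, a2, a3]
  simp
  constructor <;> ring

theorem strandVertex_zero (n : ℕ) (b : Bool) : strandVertex n b 0 = ⟨10, 0⟩ := by
  simp [strandVertex]

theorem strandVertex_one (n : ℕ) (b : Bool) : strandVertex n b 1 = ⟨10, -strandSign b⟩ := by
  simp [strandVertex]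

theorem strandVertex_two (n : ℕ) (b : Bool) :
    strandVertex n b 2 = ⟨4 + strandSign b, -strandSign b⟩ := by
  simp [strandVertex]

theorem strandVertex_end₃ (n : ℕ) (b : Bool) :
    strandVertex n b (4 * n + 3) = ⟨16 * n + 4 + strandSign b, -strandSign b⟩ := by
  simp [strandVertex]

theorem strandVertex_end₄ (n : ℕ) (b : Bool) :
    strandVertex n b (4 * n + 4) = ⟨16 * n - 2, -strandSign b⟩ := by
  simp [strandVertex]

theorem strandSign_le (b : Bool) : -1 ≤ strandSign b ∧ strandSign b ≤ 1 := by
  rcases strandSign_mem b with h | h <;> rw [h] <;> norm_num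

/-! ### How the strands are seen from a point -/

/-- The vertices of a strand between its sides number `lo` and `hi` lie in the half planes around
`p` chosen for the adjacent sides. -/
def Sees (n : ℕ) (b : Bool) (p : ℂ) (lo hi : ℕ) (q : ℕ → ℤ) : Prop :=
  ∀ m, lo ≤ m → m < hi → InHalf (q m) (strandVertex n b (m + 1) - p) ∧
    InHalf (q (m + 1)) (strandVertex n b (m + 1) - p) ∧ |q m - q (m + 1)| ≤ 2

theorem Sees.append {n : ℕ} {b : Bool} {p : ℂ} {lo mid hi : ℕ} {q : ℕ → ℤ}
    (h : Sees n b p lo mid q) (h' : Sees n b p mid hi q) : Sees n b p lo hi q := by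
  intro m hm hm'
  rcases lt_or_ge m mid with h1 | h1
  · exact h m hm h1
  · exact h' m h1 hm'

theorem Sees.mono {n : ℕ} {b : Bool} {p : ℂ} {lo hi lo' hi' : ℕ} {q : ℕ → ℤ}
    (h : Sees n b p lo hi q) (h1 : lo ≤ lo') (h2 : hi' ≤ hi) : Sees n b p lo' hi' q :=
  fun m hm hm' => h m (h1.trans hm) (hm'.trans_le h2)

theorem Sees.congr {n : ℕ} {b : Bool} {p : ℂ} {lo hi : ℕ} {q q' : ℕ → ℤ}
    (h : Sees n b p lo hi q) (hq : ∀ m, lo ≤ m → m ≤ hi → q' m = q m) : Sees n b p lo hi q' := by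
  intro m hm hm'
  rw [hq m hm hm'.le, hq (m + 1) (by omega) hm']
  exact h m hm hm'

theorem sees_single {n : ℕ} {b : Bool} {p : ℂ} {k : ℕ} {q : ℕ → ℤ}
    (h : InHalf (q k) (strandVertex n b (k + 1) - p))
    (h' : InHalf (q (k + 1)) (strandVertex n b (k + 1) - p)) (hq : |q k - q (k + 1)| ≤ 2) :
    Sees n b p k (k + 1) q := by
  intro m hm hm'
  obtain rfl : m = k := by omega
  exact ⟨h, h', hq⟩

/-- A choice of half planes for the sides determines how far the strand turns around the point. -/
theorem Sees.turns {n : ℕ} {b : Bool} {p : ℂ} {lo hi : ℕ} {q : ℕ → ℤ} (h : Sees n b p lo hi q)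
    (hlo : lo ≤ hi) (hhi : hi ≤ 4 * n + 4) {s t : ℝ} (hs0 : lo ≤ s) (hs1 : s ≤ lo + 1)
    (ht0 : hi ≤ t) (ht1 : t ≤ hi + 1) (hst : s ≤ t) {z w : ℂ} (hz : strandCurve n b s = z)
    (hw : strandCurve n b t = w) (hs : InHalf (q lo) (z - p)) (ht : InHalf (q hi) (w - p)) :
    Turns (fun u => strandCurve n b u - p) s t (ang (q lo) (z - p)) (ang (q hi) (w - p)) := by
  subst hz hw
  exact turns_polyline (strandVertex n b) p q hlo (by omega) hs0 hs1 ht0 ht1 hst hs ht h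

/-- The numbers of the half planes in which the sides of a spiral are seen from a point that has
`κ` of its descending sides (after the first one) on its left. Up to the side number `4 κ + 2` the
spiral does not surround the point and swings to and fro; after that it winds around the point. -/
def turnIdx (κ m : ℕ) : ℤ :=
  if 4 * κ + 3 ≤ m then m - 2 - 4 * κ
  else if m % 4 = 3 then 1 else if m % 4 = 1 then 3 else 2

/-- The spiral part of a strand, seen from a point at small height. It is enough to know for each
descending side whether it lies on the left or on the right of the point, since the other three
sides of a turn lie below the point, on its left and above it. -/
theorem sees_spiral {n : ℕ} (b : Bool) {p : ℂ} {κ lo hi : ℕ} (hlo : 2 ≤ lo) (hhi : hi ≤ 4 * n + 2)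
    (him : |p.im| ≤ 4) (hre : 0 ≤ p.re)
    (hL : ∀ k, lo ≤ 4 * k + 2 → 4 * k + 2 ≤ hi → k ≤ κ → 16 * k + 4 + strandSign b < p.re)
    (hR : ∀ k, lo ≤ 4 * k + 2 → 4 * k + 2 ≤ hi → κ < k → p.re < 16 * k + 4 + strandSign b) :
    Sees n b p lo hi (turnIdx κ) := by
  have hb := strandSign_le b
  rw [abs_le] at him
  have hline : ∀ k, lo ≤ 4 * k + 2 → 4 * k + 2 ≤ hi → ∀ y : ℝ,
      InHalf (turnIdx κ (4 * k + 2)) (⟨16 * k + 4 + strandSign b, y⟩ - p) := by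
    intro k h1 h2 y
    rcases le_or_gt k κ with h | h
    · have := hL k h1 h2 h
      have e : turnIdx κ (4 * k + 2) % 4 = 2 := by
        simp only [turnIdx]
        split_ifs <;> omega
      rw [inHalf_left e, Complex.sub_re]
      simp only
      linarith
    · have := hR k h1 h2 h
      have e : turnIdx κ (4 * k + 2) % 4 = 0 := by
        simp only [turnIdx]
        split_ifs <;> push_cast <;> omega
      rw [inHalf_right e, Complex.sub_re]
      simp only
      linarith
  intro m hm hm'
  refine ⟨?_, ?_, ?_⟩
  · obtain ⟨k, hk⟩ : ∃ k, m = 4 * k + 2 ∨ m = 4 * k + 3 ∨ m = 4 * k + 4 ∨ m = 4 * k + 5 :=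
      ⟨(m - 2) / 4, by omega⟩
    have hk0 : (0 : ℝ) ≤ k := Nat.cast_nonneg k
    rcases hk with rfl | rfl | rfl | rfl
    · rw [show 4 * k + 2 + 1 = 4 * k + 3 by ring, strandVertex_below b (by omega)]
      exact hline k hm hm'.le _
    · rw [show 4 * k + 3 + 1 = 4 * k + 4 by ring, strandVertex_below_left b (by omega)]
      rw [inHalf_below (by simp only [turnIdx]; split_ifs <;> push_cast <;> omega), Complex.sub_im]
      simp only
      linarith
    · rw [show 4 * k + 4 + 1 = 4 * k + 5 by ring, strandVertex_above_left b (by omega)]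
      rw [inHalf_left (by simp only [turnIdx]; split_ifs <;> push_cast <;> omega), Complex.sub_re]
      simp only
      linarith
    · rw [show 4 * k + 5 + 1 = 4 * k + 6 by ring, strandVertex_above b (by omega)]
      rw [inHalf_above (by simp only [turnIdx]; split_ifs <;> push_cast <;> omega), Complex.sub_im]
      simp only
      linarith
  · obtain ⟨k, hk⟩ : ∃ k, m = 4 * k + 2 ∨ m = 4 * k + 3 ∨ m = 4 * k + 4 ∨ m = 4 * k + 5 :=
      ⟨(m - 2) / 4, by omega⟩
    have hk0 : (0 : ℝ) ≤ k := Nat.cast_nonneg k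
    rcases hk with rfl | rfl | rfl | rfl
    · rw [show 4 * k + 2 + 1 = 4 * k + 3 by ring, strandVertex_below b (by omega)]
      rw [inHalf_below (by simp only [turnIdx]; split_ifs <;> push_cast <;> omega), Complex.sub_im]
      simp only
      linarith
    · rw [show 4 * k + 3 + 1 = 4 * k + 4 by ring, strandVertex_below_left b (by omega)]
      rw [inHalf_left (by simp only [turnIdx]; split_ifs <;> push_cast <;> omega), Complex.sub_re]
      simp only
      linarith
    · rw [show 4 * k + 4 + 1 = 4 * k + 5 by ring, strandVertex_above_left b (by omega)]
      rw [inHalf_above (by simp only [turnIdx]; split_ifs <;> push_cast <;> omega), Complex.sub_im]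
      simp only
      linarith
    · rw [show 4 * k + 5 + 1 = 4 * k + 6 by ring, strandVertex_above b (by omega)]
      have := hline (k + 1) (by omega) (by omega) (16 * k + 16 + strandSign b)
      rw [show 4 * (k + 1) + 2 = 4 * k + 6 by ring] at this
      convert this using 3
      push_cast
      ring
  · simp only [turnIdx]
    rw [abs_le]
    constructor <;> split_ifs <;> omega

/-- A point far enough to the right sees the beginning of a strand on its left. -/
theorem sees_start {n : ℕ} (b : Bool) {p : ℂ} (hp : 10 < p.re) {q : ℕ → ℤ} (h0 : q 0 = 2)
    (h1 : q 1 = 2) (h2 : q 2 = 2) : Sees n b p 0 2 q := by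
  have hb := strandSign_le b
  refine (sees_single (k := 0) ?_ ?_ ?_).append (sees_single (k := 1) ?_ ?_ ?_)
  · rw [h0, inHalf_left rfl, strandVertex_one, Complex.sub_re]
    simp only
    linarith
  · rw [h1, inHalf_left rfl, strandVertex_one, Complex.sub_re]
    simp only
    linarith
  · simp [h0, h1]
  · rw [h1, inHalf_left rfl, strandVertex_two, Complex.sub_re]
    simp only
    linarith
  · rw [h2, inHalf_left rfl, strandVertex_two, Complex.sub_re]
    simp only
    linarith
  · simp [h1, h2]

/-- A point far enough to the left sees the end of a strand on its right. -/
theorem sees_end {n : ℕ} (b : Bool) {p : ℂ} (hp : p.re < 16 * n - 2) {q : ℕ → ℤ} {e : ℤ}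
    (he : e % 4 = 0) (h2 : q (4 * n + 2) = e) (h3 : q (4 * n + 3) = e) (h4 : q (4 * n + 4) = e) :
    Sees n b p (4 * n + 2) (4 * n + 4) q := by
  have hb := strandSign_le b
  refine (sees_single (k := 4 * n + 2) ?_ ?_ ?_).append (sees_single (k := 4 * n + 3) ?_ ?_ ?_)
  · rw [h2, inHalf_right he, strandVertex_end₃, Complex.sub_re]
    simp only
    linarith
  · rw [h3, inHalf_right he, strandVertex_end₃, Complex.sub_re]
    simp only
    linarith
  · simp [h2, h3]
  · rw [h3, inHalf_right he, strandVertex_end₄, Complex.sub_re]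
    simp only
    linarith
  · rw [h4, inHalf_right he, strandVertex_end₄, Complex.sub_re]
    simp only
    linarith
  · simp [h3, h4]

/-! ### The intersection points -/

/-- The number of the side of the strand on which its intersection point number `j` lies. -/
def side (n j : ℕ) : ℕ :=
  if j = 2 * n - 1 then 4 * n + 3 else if j = 0 then 1 else 4 * ((j + 1) / 2) + 2

/-- The intersection point number `j` of the strand `b` with copy `d` of the red curve. -/
def spot (n : ℕ) (d : SignType) (b : Bool) (j : ℕ) : ℂ :=
  if j = 2 * n - 1 then ⟨16 * n + 1 + d, -strandSign b⟩
  else if j = 0 then ⟨7 - d, -strandSign b⟩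
  else ⟨16 * ((j + 1) / 2 : ℕ) + 4 + strandSign b, if j % 2 = 1 then 3 + d else -(3 + d)⟩

/-- An intersection point is the first, the last, or one of the two on a descending side. -/
theorem position_cases {n j : ℕ} (hj : j < 2 * n) :
    j = 2 * n - 1 ∨ (j = 0 ∧ j ≠ 2 * n - 1) ∨
      ∃ k, 1 ≤ k ∧ k + 1 ≤ n ∧ (j = 2 * k - 1 ∨ j = 2 * k) := by
  by_cases h : j = 2 * n - 1
  · exact Or.inl h
  · by_cases h0 : j = 0
    · exact Or.inr (Or.inl ⟨h0, h⟩)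
    · exact Or.inr (Or.inr ⟨(j + 1) / 2, by omega, by omega, by omega⟩)

theorem side_last (n : ℕ) : side n (2 * n - 1) = 4 * n + 3 := by simp [side]

theorem side_first {n : ℕ} (h : 0 ≠ 2 * n - 1) : side n 0 = 1 := by simp [side, h]

theorem side_mid {n j k : ℕ} (hk : 1 ≤ k) (hkn : k + 1 ≤ n) (hj : j = 2 * k - 1 ∨ j = 2 * k) :
    side n j = 4 * k + 2 := by
  have h1 : j ≠ 2 * n - 1 := by omega
  have h2 : j ≠ 0 := by omega
  simp only [side, h1, h2, if_false]
  omega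

theorem spot_last (n : ℕ) (d : SignType) (b : Bool) :
    spot n d b (2 * n - 1) = ⟨16 * n + 1 + d, -strandSign b⟩ := by simp [spot]

theorem spot_first {n : ℕ} (h : 0 ≠ 2 * n - 1) (d : SignType) (b : Bool) :
    spot n d b 0 = ⟨7 - d, -strandSign b⟩ := by simp [spot, h]

theorem spot_above {n k : ℕ} (hk : 1 ≤ k) (hkn : k + 1 ≤ n) (d : SignType) (b : Bool) :
    spot n d b (2 * k - 1) = ⟨16 * k + 4 + strandSign b, 3 + d⟩ := by
  have h1 : 2 * k - 1 ≠ 2 * n - 1 := by omega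
  have h2 : 2 * k - 1 ≠ 0 := by omega
  have h3 : (2 * k - 1 + 1) / 2 = k := by omega
  have h4 : (2 * k - 1) % 2 = 1 := by omega
  simp only [spot, h1, h2, h3, h4, if_true, if_false]

theorem spot_below {n k : ℕ} (hk : 1 ≤ k) (d : SignType) (b : Bool) :
    spot n d b (2 * k) = ⟨16 * k + 4 + strandSign b, -(3 + d)⟩ := by
  have h1 : 2 * k ≠ 2 * n - 1 := by omega
  have h2 : 2 * k ≠ 0 := by omega
  have h3 : (2 * k + 1) / 2 = k := by omega
  have h4 : ¬ (2 * k) % 2 = 1 := by omega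
  simp only [spot, h1, h2, h3, h4, if_false]

theorem spot_mid {n j k : ℕ} (hk : 1 ≤ k) (hkn : k + 1 ≤ n) (hj : j = 2 * k - 1 ∨ j = 2 * k)
    (d : SignType) (b : Bool) :
    ∃ y : ℝ, |y| ≤ 4 ∧ spot n d b j = ⟨16 * k + 4 + strandSign b, y⟩ := by
  obtain ⟨hd, hd'⟩ := signType_mem d
  rcases hj with rfl | rfl
  · exact ⟨3 + d, abs_le.mpr ⟨by linarith, by linarith⟩, spot_above hk hkn d b⟩
  · exact ⟨-(3 + d), abs_le.mpr ⟨by linarith, by linarith⟩, spot_below hk d b⟩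

/-- The intersection points lie on the sides and at the places given by `side` and `spot`. -/
theorem strandParam_spec {n j : ℕ} (hj : j < 2 * n) (d : SignType) (b : Bool) :
    side n j ≤ strandParam n d b j ∧ strandParam n d b j ≤ side n j + 1 ∧
      strandCurve n b (strandParam n d b j) = spot n d b j := by
  obtain ⟨hd, hd'⟩ := signType_mem d
  obtain ⟨he, he'⟩ := strandSign_le b
  rcases position_cases hj with rfl | ⟨rfl, h0⟩ | ⟨k, hk, hkn, h⟩
  · have hp : strandParam n d b (2 * n - 1) =
        4 * n + 3 + (3 + strandSign b - d) / (6 + strandSign b) := by simp [strandParam]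
    have x0 : 0 ≤ (3 + strandSign b - d) / (6 + strandSign b) :=
      div_nonneg (by linarith) (by linarith)
    have x1 : (3 + strandSign b - d) / (6 + strandSign b) ≤ 1 := by
      rw [div_le_one (by linarith)]
      linarith
    rw [hp, side_last, spot_last]
    refine ⟨by push_cast; linarith, by push_cast; linarith, ?_⟩
    rw [strandCurve, polyline_mk _ (strandVertex_end₃ n b) (strandVertex_end₄ n b) (by omega)
      (x := (3 + strandSign b - d) / (6 + strandSign b)) (by push_cast; ring) x0 x1]
    have h6 : (6 : ℝ) + strandSign b ≠ 0 := by
      intro h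
      linarith
    congr 1
    · field_simp
      ring
    · ring
  · have hp : strandParam n d b 0 = 1 + (3 + d) / (6 - strandSign b) := by
      simp [strandParam, h0]
    have x0 : 0 ≤ (3 + (d : ℝ)) / (6 - strandSign b) := div_nonneg (by linarith) (by linarith)
    have x1 : (3 + (d : ℝ)) / (6 - strandSign b) ≤ 1 := by
      rw [div_le_one (by linarith)]
      linarith
    rw [hp, side_first h0, spot_first h0]
    refine ⟨by push_cast; linarith, by push_cast; linarith, ?_⟩
    rw [strandCurve, polyline_mk _ (strandVertex_one n b) (strandVertex_two n b) (by omega)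
      (x := (3 + d) / (6 - strandSign b)) (by push_cast; ring) x0 x1]
    have h6 : (6 : ℝ) - strandSign b ≠ 0 := by
      intro h
      linarith
    congr 1
    · field_simp
      ring
    · ring
  · have hk1 : (1 : ℝ) ≤ k := by exact_mod_cast hk
    have hjl : j ≠ 2 * n - 1 := by omega
    have hj0 : j ≠ 0 := by omega
    have hjk : (j + 1) / 2 = k := by omega
    have hv : (0 : ℝ) < 32 * k + 16 + 2 * strandSign b := by linarith
    have e1 := strandVertex_above b (n := n) (k := k - 1) (by omega)
    rw [show 4 * (k - 1) + 6 = 4 * k + 2 by omega, Nat.cast_sub hk] at e1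
    have e2 := strandVertex_below b (n := n) (k := k) (by omega)
    rw [side_mid hk hkn h]
    have key : ∀ w : ℝ, 0 ≤ 16 * k + strandSign b - w →
        16 * k + strandSign b - w ≤ 32 * k + 16 + 2 * strandSign b →
        ((4 * k + 2 : ℕ) : ℝ) ≤ 4 * k + 2 +
            (16 * k + strandSign b - w) / (32 * k + 16 + 2 * strandSign b) ∧
          4 * k + 2 + (16 * k + strandSign b - w) / (32 * k + 16 + 2 * strandSign b) ≤
            (4 * k + 2 : ℕ) + 1 ∧
          strandCurve n b (4 * k + 2 +
            (16 * k + strandSign b - w) / (32 * k + 16 + 2 * strandSign b)) =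
            ⟨16 * k + 4 + strandSign b, w⟩ := by
      intro w h0 h1
      have x0 := div_nonneg h0 hv.le
      have x1 := (div_le_one hv).mpr h1
      refine ⟨by push_cast; linarith, by push_cast; linarith, ?_⟩
      rw [strandCurve, polyline_mk _ e1 e2 (by omega) (by push_cast; ring) x0 x1]
      have h2 := div_mul_cancel₀ (16 * (k : ℝ) + strandSign b - w) hv.ne'
      congr 1
      · push_cast
        ring
      · push_cast
        linear_combination -h2
    rcases h with rfl | rfl
    · have hp : strandParam n d b (2 * k - 1) = 4 * k + 2 +
          (16 * k + strandSign b - (3 + d)) / (32 * k + 16 + 2 * strandSign b) := by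
        simp only [strandParam, hjl, hj0, hjk, if_false, show (2 * k - 1) % 2 = 1 by omega, if_true]
      rw [hp, spot_above hk hkn]
      exact key _ (by linarith) (by linarith)
    · have hp : strandParam n d b (2 * k) = 4 * k + 2 +
          (16 * k + strandSign b - (-(3 + d))) / (32 * k + 16 + 2 * strandSign b) := by
        simp only [strandParam, hjl, hj0, hjk, if_false, show ¬ (2 * k) % 2 = 1 by omega]
        rw [sub_neg_eq_add]
      rw [hp, spot_below hk]
      exact key _ (by linarith) (by linarith)

theorem side_le {n j : ℕ} (hj : j < 2 * n) : 1 ≤ side n j ∧ side n j ≤ 4 * n + 3 := by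
  rcases position_cases hj with rfl | ⟨rfl, h0⟩ | ⟨k, hk, hkn, h⟩
  · rw [side_last]
    omega
  · rw [side_first h0]
    omega
  · rw [side_mid hk hkn h]
    omega

/-- The intersection points are numbered in their order along the strand, for all copies of the red
curve. -/
theorem strandParam_lt {n i j : ℕ} (hij : i < j) (hj : j < 2 * n) (d d' : SignType) (b : Bool) :
    strandParam n d b i < strandParam n d' b j := by
  obtain ⟨hd, hd'⟩ := signType_mem d
  obtain ⟨hc, hc'⟩ := signType_mem d'
  obtain ⟨he, he'⟩ := strandSign_le b
  have h1 := (strandParam_spec (hij.trans hj) d b).2.1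
  have h2 := (strandParam_spec hj d' b).1
  by_cases hs : side n i + 2 ≤ side n j
  · have : (side n i : ℝ) + 2 ≤ side n j := by exact_mod_cast hs
    linarith
  -- otherwise the points are the two on one descending side
  have hjl : j ≠ 2 * n - 1 := by
    rintro rfl
    rw [side_last] at hs
    rcases position_cases (hij.trans hj) with h | ⟨rfl, h0⟩ | ⟨k, hk, hkn, h⟩
    · omega
    · rw [side_first h0] at hs
      omega
    · rw [side_mid hk hkn h] at hs
      omega
  obtain ⟨k, hk, hkn, h⟩ : ∃ k, 1 ≤ k ∧ k + 1 ≤ n ∧ (j = 2 * k - 1 ∨ j = 2 * k) := by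
    rcases position_cases hj with h | ⟨rfl, h0⟩ | h
    · exact absurd h hjl
    · omega
    · exact h
  rw [side_mid hk hkn h] at hs
  have hi0 : i ≠ 0 := by
    rintro rfl
    rw [side_first (by omega)] at hs
    omega
  obtain ⟨l, hl, hln, h'⟩ : ∃ l, 1 ≤ l ∧ l + 1 ≤ n ∧ (i = 2 * l - 1 ∨ i = 2 * l) := by
    rcases position_cases (hij.trans hj) with h | ⟨rfl, h0⟩ | h
    · omega
    · omega
    · exact h
  rw [side_mid hl hln h'] at hs
  obtain rfl : l = k := by omega
  obtain rfl : i = 2 * l - 1 := by omega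
  obtain rfl : j = 2 * l := by omega
  have hk1 : (1 : ℝ) ≤ l := by exact_mod_cast hk
  have hv : (0 : ℝ) < 32 * l + 16 + 2 * strandSign b := by linarith
  simp only [strandParam, show 2 * l - 1 ≠ 2 * n - 1 by omega, show 2 * l ≠ 2 * n - 1 by omega,
    show 2 * l - 1 ≠ 0 by omega, show 2 * l ≠ 0 by omega, show (2 * l - 1 + 1) / 2 = l by omega,
    show (2 * l + 1) / 2 = l by omega, show (2 * l - 1) % 2 = 1 by omega,
    show ¬ (2 * l) % 2 = 1 by omega, if_true, if_false]
  gcongr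
  linarith

theorem position_lt {n : ℕ} (hn : 1 ≤ n) (i : LinkIdx n) : position n i < 2 * n := by
  rcases i with (⟨i, hi⟩ | ⟨i, hi⟩) | i <;> simp [position] <;> omega

theorem blueParam_eq (n : ℕ) (d : SignType) (i : LinkIdx n) : blueParam n d i =
    blueTime n (strand n i) (strandParam n d (strand n i) (position n i)) := rfl

theorem strandParam_mem {n j : ℕ} (hj : j < 2 * n) (d : SignType) (b : Bool) :
    1 ≤ strandParam n d b j ∧ strandParam n d b j ≤ 4 * n + 4 := by
  have h := strandParam_spec hj d b
  have h' := side_le hj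
  have h1 : (1 : ℝ) ≤ side n j := by exact_mod_cast h'.1
  have h2 : (side n j : ℝ) ≤ 4 * n + 3 := by exact_mod_cast h'.2
  constructor <;> linarith

theorem blue_spot {n : ℕ} (hn : 1 ≤ n) (d : SignType) (i : LinkIdx n) :
    blue n (blueParam n d i) = spot n d (strand n i) (position n i) := by
  have h := strandParam_mem (position_lt hn i) d (strand n i)
  rw [blueParam_eq, blue_blueTime n _ (by linarith) (by linarith),
    (strandParam_spec (position_lt hn i) d _).2.2]

/-! ### How the strands are seen from an intersection point -/

/-- The number of descending sides of the strand of the intersection point number `j`, after the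
first one, that do not lie to the right of that point. -/
def descents (n j : ℕ) : ℕ := if j = 2 * n - 1 then n - 1 else (j + 1) / 2

/-- The half planes in which the earlier part of the same strand is seen from the intersection point
number `j`. -/
def beforeIdx (n j m : ℕ) : ℤ :=
  if m = 1 then 2 else if m = side n j then (if j = 2 * n - 1 then 4 else 3)
  else turnIdx (descents n j) m

/-- The half planes in which the later part of the same strand is seen from the intersection point
number `j`. -/
def afterIdx (n j m : ℕ) : ℤ :=
  if j = 2 * n - 1 then 2
  else if m = side n j then (if j = 0 then 2 else 1)
  else if 4 * n + 3 ≤ m then 4 * n - 4 * descents n j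
  else turnIdx (descents n j) m

/-- The number of descending sides of the other strand, after the first one, that lie to the left
of the intersection point number `j` of the strand `b`. -/
def otherDescents (n : ℕ) (b : Bool) (j : ℕ) : ℕ :=
  if b ∨ j = 2 * n - 1 then descents n j else descents n j - 1

/-- The half planes in which the other strand is seen from the intersection point number `j` of the
strand `b`. -/
def otherIdx (n : ℕ) (b : Bool) (j m : ℕ) : ℤ :=
  if j = 2 * n - 1 then
    (if m = 1 then 2 else if m = 4 * n + 3 then (if b then 3 else 5)
    else if m = 4 * n + 4 then (if b then 2 else 6)
    else turnIdx (n - 1) m)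
  else if m = 1 then (if j = 0 then (if b then 3 else 1) else 2)
  else if 4 * n + 3 ≤ m then 4 * n - 4 * otherDescents n b j
  else turnIdx (otherDescents n b j) m

theorem turnIdx_two (κ : ℕ) : turnIdx κ 2 = 2 := by
  simp [turnIdx]

theorem spot_im {n j : ℕ} (hj : j < 2 * n) (d : SignType) (b : Bool) : |(spot n d b j).im| ≤ 4 := by
  obtain ⟨hb, hb'⟩ := strandSign_le b
  rcases position_cases hj with rfl | ⟨rfl, h0⟩ | ⟨k, hk, hkn, h⟩
  · rw [spot_last, abs_le]
    constructor <;> simp only <;> linarith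
  · rw [spot_first h0, abs_le]
    constructor <;> simp only <;> linarith
  · obtain ⟨y, hy, e⟩ := spot_mid hk hkn h d b
    rw [e]
    exact hy

theorem strandSign_not (b : Bool) : strandSign (!b) = -strandSign b := by
  cases b <;> simp [strandSign]

/-- An intersection point sees the earlier descending sides of its own strand on the left, so that
the strand reaches it without winding around it. -/
theorem sees_before {n j : ℕ} (hj : j < 2 * n) (hj0 : j ≠ 0) (d : SignType) (b : Bool) :
    Sees n b (spot n d b j) 1 (side n j) (beforeIdx n j) := by
  obtain ⟨hd, hd'⟩ := signType_mem d
  obtain ⟨hb, hb'⟩ := strandSign_le b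
  have him := spot_im hj d b
  have hs : side n j = 4 * n + 3 ∨ ∃ k, 1 ≤ k ∧ k + 1 ≤ n ∧ side n j = 4 * k + 2 := by
    rcases position_cases hj with rfl | ⟨rfl, h0⟩ | ⟨k, hk, hkn, h⟩
    · exact Or.inl (side_last n)
    · exact absurd rfl hj0
    · exact Or.inr ⟨k, hk, hkn, side_mid hk hkn h⟩
  have q1 : beforeIdx n j 1 = 2 := by simp [beforeIdx]
  have q2 : beforeIdx n j 2 = 2 := by
    have : 2 ≠ side n j := by omega
    simp [beforeIdx, turnIdx_two, this]
  have hre : 10 < (spot n d b j).re := by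
    rcases position_cases hj with rfl | ⟨rfl, h0⟩ | ⟨k, hk, hkn, h⟩
    · have : (1 : ℝ) ≤ n := by exact_mod_cast (show 1 ≤ n by omega)
      rw [spot_last]
      simp only
      linarith
    · exact absurd rfl hj0
    · have : (1 : ℝ) ≤ k := by exact_mod_cast hk
      obtain ⟨y, hy, e⟩ := spot_mid hk hkn h d b
      rw [e]
      simp only
      linarith
  have hstart : Sees n b (spot n d b j) 1 2 (beforeIdx n j) :=
    ((sees_start (q := fun _ => 2) b hre rfl rfl rfl).mono zero_le_one le_rfl).congr
      (fun m h1 h2 => by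
        rcases (show m = 1 ∨ m = 2 by omega) with rfl | rfl
        · exact q1
        · exact q2)
  refine hstart.append ?_
  rcases position_cases hj with rfl | ⟨rfl, h0⟩ | ⟨k, hk, hkn, h⟩
  · rw [side_last]
    have hn1 : (1 : ℝ) ≤ n := by exact_mod_cast (show 1 ≤ n by omega)
    have hsp := sees_spiral b (p := spot n d b (2 * n - 1)) (κ := n - 1) (lo := 2) (hi := 4 * n + 2)
      le_rfl le_rfl him (by linarith)
      (fun k _ h2 h3 => by
        have : (k : ℝ) + 1 ≤ n := by exact_mod_cast (show k + 1 ≤ n by omega)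
        rw [spot_last]
        simp only
        linarith)
      (fun k _ h2 h3 => by
        obtain rfl : k = n := by omega
        rw [spot_last]
        simp only
        linarith)
    refine (hsp.congr fun m h1 h2 => ?_).append (sees_single (k := 4 * n + 2) ?_ ?_ ?_)
    · simp [beforeIdx, descents, side_last, show m ≠ 1 by omega, show m ≠ 4 * n + 3 by omega]
    · have e : beforeIdx n (2 * n - 1) (4 * n + 2) % 4 = 0 := by
        simp only [beforeIdx, descents, side_last, turnIdx]
        split_ifs <;> push_cast <;> omega
      rw [inHalf_right e, strandVertex_end₃, spot_last, Complex.sub_re]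
      simp only
      linarith
    · have e : beforeIdx n (2 * n - 1) (4 * n + 2 + 1) % 4 = 0 := by
        simp [beforeIdx, side_last]
      rw [inHalf_right e, strandVertex_end₃, spot_last, Complex.sub_re]
      simp only
      linarith
    · simp only [beforeIdx, descents, side_last, turnIdx]
      rw [abs_le]
      constructor <;> split_ifs <;> omega
  · exact absurd rfl hj0
  · rw [side_mid hk hkn h]
    obtain ⟨y, hy, e⟩ := spot_mid hk hkn h d b
    have hD : descents n j = k := by
      simp only [descents, show j ≠ 2 * n - 1 by omega, if_false]
      omega
    have hsp := sees_spiral (n := n) b (p := spot n d b j) (κ := k) (lo := 2) (hi := 4 * k + 1)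
      le_rfl (by omega) him (by linarith)
      (fun l _ h2 h3 => by
        have : (l : ℝ) + 1 ≤ k := by exact_mod_cast (show l + 1 ≤ k by omega)
        rw [e]
        simp only
        linarith)
      (fun l _ h2 h3 => by omega)
    have hv := strandVertex_above b (n := n) (k := k - 1) (by omega)
    rw [show 4 * (k - 1) + 6 = 4 * k + 1 + 1 by omega, Nat.cast_sub hk] at hv
    have hk1 : (1 : ℝ) ≤ k := by exact_mod_cast hk
    rw [e, abs_le] at him
    have hab : 0 < (strandVertex n b (4 * k + 1 + 1) - spot n d b j).im := by
      rw [hv, e, Complex.sub_im]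
      push_cast
      linarith [him.2]
    have hjl : j ≠ 2 * n - 1 := by omega
    refine (hsp.congr fun m h1 h2 => ?_).append (sees_single (k := 4 * k + 1) ?_ ?_ ?_)
    · simp [beforeIdx, hD, side_mid hk hkn h, show m ≠ 1 by omega, show m ≠ 4 * k + 2 by omega]
    · rw [inHalf_above _]
      · exact hab
      · simp only [beforeIdx, hD, side_mid hk hkn h, turnIdx, hjl, if_false]
        split_ifs <;> omega
    · rw [inHalf_above _]
      · exact hab
      · simp only [beforeIdx, hD, side_mid hk hkn h, hjl, if_false]
        split_ifs <;> omega
    · simp only [beforeIdx, hD, side_mid hk hkn h, turnIdx, hjl, if_false]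
      rw [abs_le]
      constructor <;> split_ifs <;> omega

/-- After leaving an intersection point, a strand winds around it, with one turn from each later
descending side to the next. -/
theorem sees_after {n j : ℕ} (hj : j < 2 * n) (d : SignType) (b : Bool) :
    Sees n b (spot n d b j) (side n j) (4 * n + 4) (afterIdx n j) := by
  obtain ⟨hd, hd'⟩ := signType_mem d
  obtain ⟨hb, hb'⟩ := strandSign_le b
  have him := spot_im hj d b
  have hn1 : (1 : ℝ) ≤ n := by exact_mod_cast (show 1 ≤ n by omega)
  rcases position_cases hj with rfl | ⟨rfl, h0⟩ | ⟨k, hk, hkn, h⟩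
  · rw [side_last]
    refine sees_single (k := 4 * n + 3) ?_ ?_ ?_
    · rw [inHalf_left (by simp [afterIdx]), strandVertex_end₄, spot_last, Complex.sub_re]
      simp only
      linarith
    · rw [inHalf_left (by simp [afterIdx]), strandVertex_end₄, spot_last, Complex.sub_re]
      simp only
      linarith
    · simp [afterIdx]
  · have hn2 : n ≠ 0 := by omega
    have hD : descents n 0 = 0 := by simp [descents, h0]
    have hsp := sees_spiral b (p := spot n d b 0) (κ := 0) (lo := 2) (hi := 4 * n + 2)
      le_rfl le_rfl him (by rw [spot_first h0]; simp only; linarith)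
      (fun k _ h2 h3 => by
        obtain rfl : k = 0 := by omega
        rw [spot_first h0]
        push_cast
        linarith)
      (fun k _ h2 h3 => by
        have : (1 : ℝ) ≤ k := by exact_mod_cast h3
        rw [spot_first h0]
        simp only
        linarith)
    rw [side_first h0]
    refine ((sees_single (k := 1) ?_ ?_ ?_).append (hsp.congr fun m h1 h2 => ?_)).append
      (sees_end b (e := 4 * n) ?_ ?_ ?_ ?_ ?_)
    · rw [inHalf_left (by simp [afterIdx, side_first h0, h0]), strandVertex_two, spot_first h0,
        Complex.sub_re]
      simp only
      linarith
    · rw [inHalf_left (by simp [afterIdx, side_first h0, h0, turnIdx]), strandVertex_two,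
        spot_first h0, Complex.sub_re]
      simp only
      linarith
    · simp [afterIdx, side_first h0, h0, turnIdx]
    · simp [afterIdx, side_first h0, h0, hD, show m ≠ 1 by omega, show ¬ 4 * n + 3 ≤ m by omega]
    · rw [spot_first h0]
      simp only
      linarith
    · omega
    · simp only [afterIdx, side_first h0, hD, turnIdx, h0, if_false]
      split_ifs <;> push_cast <;> omega
    · simp only [afterIdx, side_first h0, hD, turnIdx, h0, if_false]
      split_ifs <;> push_cast <;> omega
    · simp only [afterIdx, side_first h0, hD, turnIdx, h0, if_false]
      split_ifs <;> push_cast <;> omega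
  · have hs := side_mid hk hkn h
    rw [hs]
    obtain ⟨y, hy, e⟩ := spot_mid hk hkn h d b
    have hD : descents n j = k := by
      simp only [descents, show j ≠ 2 * n - 1 by omega, if_false]
      omega
    have hjl : j ≠ 2 * n - 1 := by omega
    have hj0 : j ≠ 0 := by omega
    have hkn' : (k : ℝ) + 1 ≤ n := by exact_mod_cast hkn
    have hk0 : (1 : ℝ) ≤ k := by exact_mod_cast hk
    have hsp := sees_spiral b (p := spot n d b j) (κ := k) (lo := 4 * k + 3) (hi := 4 * n + 2)
      (by omega) le_rfl him (by rw [e]; simp only; linarith)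
      (fun l _ h2 h3 => by omega)
      (fun l _ h2 h3 => by
        have : (k : ℝ) + 1 ≤ l := by exact_mod_cast h3
        rw [e]
        simp only
        linarith)
    have hv := strandVertex_below b (n := n) (k := k) (by omega)
    rw [e, abs_le] at him
    have hbe : (strandVertex n b (4 * k + 2 + 1) - spot n d b j).im < 0 := by
      rw [show 4 * k + 2 + 1 = 4 * k + 3 by ring, hv, e, Complex.sub_im]
      simp only
      linarith [him.1]
    refine ((sees_single (k := 4 * k + 2) ?_ ?_ ?_).append (hsp.congr fun m h1 h2 => ?_)).append
      (sees_end b (e := 4 * n - 4 * k) ?_ ?_ ?_ ?_ ?_)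
    · rw [inHalf_below]
      · exact hbe
      · simp [afterIdx, hs, hjl, hj0]
    · rw [inHalf_below]
      · exact hbe
      · simp only [afterIdx, hs, hD, hjl, hj0, turnIdx]
        split_ifs <;> push_cast <;> omega
    · simp only [afterIdx, hs, hD, hjl, hj0, turnIdx]
      rw [abs_le]
      constructor <;> split_ifs <;> push_cast <;> omega
    · simp [afterIdx, hs, hjl, hD, show m ≠ 4 * k + 2 by omega, show ¬ 4 * n + 3 ≤ m by omega]
    · rw [e]
      simp only
      linarith
    · omega
    · simp only [afterIdx, hs, hjl, hj0, hD, turnIdx, if_false]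
      split_ifs <;> push_cast <;> omega
    · simp only [afterIdx, hs, hjl, hj0, hD, turnIdx, if_false]
      split_ifs <;> push_cast <;> omega
    · simp only [afterIdx, hs, hjl, hj0, hD, turnIdx, if_false]
      split_ifs <;> push_cast <;> omega

/-- From a point far enough to the left, a strand is seen as a spiral up to its end. -/
theorem sees_outward {n : ℕ} (b : Bool) {p : ℂ} {κ : ℕ} (hκ : κ < n)
    (him : |p.im| ≤ 4) (hre : 0 ≤ p.re) (hL : 16 * κ + 4 + strandSign b < p.re)
    (hR : p.re < 16 * (κ + 1) + 4 + strandSign b) {q : ℕ → ℤ}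
    (hq : ∀ m, 2 ≤ m → m ≤ 4 * n + 2 → q m = turnIdx κ m)
    (h3 : q (4 * n + 3) = 4 * n - 4 * κ) (h4 : q (4 * n + 4) = 4 * n - 4 * κ)
    (hp : p.re < 16 * n - 2) : Sees n b p 2 (4 * n + 4) q := by
  have hsp := sees_spiral b (p := p) (κ := κ) (lo := 2) (hi := 4 * n + 2) le_rfl le_rfl him hre
    (fun k _ h2 h3 => by
      have : (k : ℝ) ≤ κ := by exact_mod_cast h3
      linarith)
    (fun k _ h2 h3 => by
      have : (κ : ℝ) + 1 ≤ k := by exact_mod_cast h3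
      linarith)
  refine (hsp.congr hq).append (sees_end b (e := 4 * n - 4 * κ) hp (by omega) ?_ h3 h4)
  rw [hq _ (by omega) le_rfl]
  simp only [turnIdx]
  split_ifs <;> push_cast <;> omega

/-- From a point near the right puncture, a strand is seen on the left for all but the last of its
turns. -/
theorem sees_inward {n : ℕ} (hn : 1 ≤ n) (b : Bool) {p : ℂ}
    (him : |p.im| ≤ 4) (hL : 16 * n - 2 < p.re) (hR : p.re < 16 * n + 3) {q : ℕ → ℤ}
    (h1 : q 1 = 2) (hq : ∀ m, 2 ≤ m → m ≤ 4 * n + 2 → q m = turnIdx (n - 1) m) :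
    Sees n b p 1 (4 * n + 2) q := by
  have hn1 : (1 : ℝ) ≤ n := by exact_mod_cast hn
  have hb := strandSign_le b
  have hsp := sees_spiral b (p := p) (κ := n - 1) (lo := 2) (hi := 4 * n + 2) le_rfl le_rfl him
    (by linarith)
    (fun k _ h2 h3 => by
      have : (k : ℝ) + 1 ≤ n := by exact_mod_cast (show k + 1 ≤ n by omega)
      linarith)
    (fun k _ h2 h3 => by
      obtain rfl : k = n := by omega
      linarith)
  have h2 : q 2 = 2 := by rw [hq 2 le_rfl (by omega), turnIdx_two]
  refine Sees.append ?_ (hsp.congr hq)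
  refine ((sees_start (q := fun _ => 2) b (by linarith) rfl rfl rfl).mono zero_le_one
    le_rfl).congr (fun m h h' => ?_)
  rcases (show m = 1 ∨ m = 2 by omega) with rfl | rfl
  · exact h1
  · exact h2

/-- The other strand is seen like the strand of the point itself, except near the point: there it
passes on the left or on the right, below or above, depending on the strand. -/
theorem sees_other {n j : ℕ} (hj : j < 2 * n) (d : SignType) (b : Bool) :
    Sees n (!b) (spot n d b j) 1 (4 * n + 4) (otherIdx n b j) := by
  obtain ⟨hd, hd'⟩ := signType_mem d
  have hb := strandSign_mem b
  have hnb := strandSign_not b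
  have him := spot_im hj d b
  have hn1 : (1 : ℝ) ≤ n := by exact_mod_cast (show 1 ≤ n by omega)
  rcases position_cases hj with rfl | ⟨rfl, h0⟩ | ⟨k, hk, hkn, h⟩
  · have hre : (spot n d b (2 * n - 1)).re = 16 * n + 1 + d := by rw [spot_last]
    have hsp := sees_inward (n := n) (by omega) (!b) him (by linarith) (by linarith)
      (q := otherIdx n b (2 * n - 1)) (by simp [otherIdx]) (fun m h1 h2 => by
        simp [otherIdx, show m ≠ 1 by omega, show m ≠ 4 * n + 3 by omega,
          show m ≠ 4 * n + 4 by omega])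
    have q2 : otherIdx n b (2 * n - 1) (4 * n + 2) = 4 := by
      simp only [otherIdx, turnIdx]
      split_ifs <;> push_cast <;> omega
    have q3 : otherIdx n b (2 * n - 1) (4 * n + 3) = if b then 3 else 5 := by
      simp [otherIdx]
    have q4 : otherIdx n b (2 * n - 1) (4 * n + 4) = if b then 2 else 6 := by
      simp [otherIdx]
    refine (hsp.append (sees_single (k := 4 * n + 2) ?_ ?_ ?_)).append
      (sees_single (k := 4 * n + 3) ?_ ?_ ?_)
    · rw [q2, inHalf_right (by norm_num), strandVertex_end₃, hnb, Complex.sub_re, hre]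
      simp only
      rcases hb with h | h <;> linarith
    · rw [q3, strandVertex_end₃, hnb, spot_last]
      cases b
      · simp only [Bool.false_eq_true, if_false, strandSign]
        rw [inHalf_below (by norm_num), Complex.sub_im]
        norm_num
      · simp only [if_true, strandSign]
        rw [inHalf_above (by norm_num), Complex.sub_im]
        norm_num
    · rw [q2, q3]
      cases b <;> simp
    · rw [q3, strandVertex_end₄, hnb, spot_last]
      cases b
      · simp only [Bool.false_eq_true, if_false, strandSign]
        rw [inHalf_below (by norm_num), Complex.sub_im]
        norm_num
      · simp only [if_true, strandSign]
        rw [inHalf_above (by norm_num), Complex.sub_im]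
        norm_num
    · rw [q4, inHalf_left (by cases b <;> simp), strandVertex_end₄, Complex.sub_re, hre]
      simp only
      linarith
    · rw [q3, q4]
      cases b <;> simp
  · have hre : (spot n d b 0).re = 7 - d := by rw [spot_first h0]
    have hO : otherDescents n b 0 = 0 := by simp [otherDescents, descents, h0]
    have hn2 : n ≠ 0 := by omega
    have q1 : otherIdx n b 0 1 = if b then 3 else 1 := by simp [otherIdx, h0]
    have q2 : otherIdx n b 0 2 = 2 := by simp [otherIdx, h0, turnIdx]
    refine Sees.append (sees_single (k := 1) ?_ ?_ ?_) (sees_outward (!b) (κ := 0) (by omega) him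
      (by linarith) ?_ ?_ ?_ ?_ ?_ ?_)
    · rw [q1, strandVertex_two, hnb, spot_first h0]
      cases b
      · simp only [Bool.false_eq_true, if_false, strandSign]
        rw [inHalf_below (by norm_num), Complex.sub_im]
        norm_num
      · simp only [if_true, strandSign]
        rw [inHalf_above (by norm_num), Complex.sub_im]
        norm_num
    · rw [q2, inHalf_left (by norm_num), strandVertex_two, Complex.sub_re, hre, hnb]
      simp only
      rcases hb with h | h <;> linarith
    · rw [q1, q2]
      cases b <;> simp
    · rw [hre, hnb]
      rcases hb with h | h <;> push_cast <;> linarith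
    · rw [hre, hnb]
      rcases hb with h | h <;> push_cast <;> linarith
    · intro m h1 h2
      simp [otherIdx, h0, hO, show m ≠ 1 by omega, show ¬ 4 * n + 3 ≤ m by omega]
    · simp [otherIdx, h0, hO]
    · simp [otherIdx, h0, hO]
    · linarith
  · obtain ⟨y, hy, e⟩ := spot_mid hk hkn h d b
    have hre : (spot n d b j).re = 16 * k + 4 + strandSign b := by rw [e]
    have hjl : j ≠ 2 * n - 1 := by omega
    have hj0 : j ≠ 0 := by omega
    have hD : descents n j = k := by
      simp only [descents, hjl, if_false]
      omega
    have hO : otherDescents n b j = if b then k else k - 1 := by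
      simp [otherDescents, hjl, hD]
    have hO' : otherDescents n b j < n := by
      rw [hO]
      split_ifs <;> omega
    have hkn' : (k : ℝ) + 1 ≤ n := by exact_mod_cast hkn
    have hk0 : (1 : ℝ) ≤ k := by exact_mod_cast hk
    have q1 : otherIdx n b j 1 = 2 := by simp [otherIdx, hjl, hj0]
    have q2 : otherIdx n b j 2 = 2 := by
      simp [otherIdx, hjl, show ¬ 4 * n + 3 ≤ 2 by omega, turnIdx_two]
    have hn2 : n ≠ 0 := by omega
    refine Sees.append ?_ (sees_outward (!b) hO' him
      (by rcases hb with h | h <;> linarith) ?_ ?_ ?_ ?_ ?_ ?_)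
    · refine ((sees_start (q := fun _ => 2) (!b) ?_ rfl rfl rfl).mono zero_le_one
        le_rfl).congr (fun m h h' => ?_)
      · rcases hb with h | h <;> linarith
      · rcases (show m = 1 ∨ m = 2 by omega) with rfl | rfl
        · exact q1
        · exact q2
    · rw [hre, hnb, hO]
      cases b
      · simp [strandSign, Nat.cast_sub hk]
        linarith
      · simp [strandSign]
    · rw [hre, hnb, hO]
      cases b
      · simp [strandSign, Nat.cast_sub hk]
      · simp [strandSign]
        linarith
    · intro m h1 h2
      simp [otherIdx, hjl, show m ≠ 1 by omega, show ¬ 4 * n + 3 ≤ m by omega]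
    · simp [otherIdx, hjl]
    · simp [otherIdx, hjl]
    · rcases hb with h | h <;> linarith

/-! ### Following the blue curve between two intersection points -/

/-- The half plane in which the intersection point number `i` of the strand `b` is seen from the
intersection point number `j` of the strand `b'`, if the angle is followed along the blue curve up
to the arrival next to the latter point. -/
def departIdx (n : ℕ) (b b' : Bool) (i j : ℕ) : ℤ :=
  if (i + 1) / 2 < (j + 1) / 2 then (if b = true ∧ b' = false then -2 else 2)
  else if (j + 1) / 2 < (i + 1) / 2 then 4 * (((i + 1) / 2 : ℕ) - ((j + 1) / 2 : ℕ))
  else if b = b' then (if i < j then 3 else 1)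
  else if i = 0 ∨ i = 2 * n - 1 then (if b' then 3 else 1)
  else if b' then 2 else 0

/-- The half plane in which the blue curve, coming from the intersection point number `i` of the
strand `b`, arrives at the intersection point number `j` of the strand `b'`. -/
def arriveIdx (n : ℕ) (b b' : Bool) (i j : ℕ) : ℤ :=
  if b = b' ∧ i < j then (if j = 2 * n - 1 then 4 else 3)
  else if j = 0 ∨ j = 2 * n - 1 then 2 else 1

theorem spot_re {n j : ℕ} (hj : j < 2 * n) (d : SignType) (b : Bool) :
    16 * ((j + 1) / 2 : ℕ) ≤ (spot n d b j).re ∧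
      (spot n d b j).re ≤ 16 * ((j + 1) / 2 : ℕ) + 8 := by
  obtain ⟨hd, hd'⟩ := signType_mem d
  obtain ⟨hb, hb'⟩ := strandSign_le b
  rcases position_cases hj with rfl | ⟨rfl, h0⟩ | ⟨k, hk, hkn, h⟩
  · rw [spot_last, show (2 * n - 1 + 1) / 2 = n by omega]
    constructor <;> simp only <;> linarith
  · rw [spot_first h0]
    constructor <;> simp only <;> norm_num <;> linarith
  · obtain ⟨y, -, e⟩ := spot_mid hk hkn h d b
    rw [e, show (j + 1) / 2 = k by omega]
    constructor <;> simp only <;> linarith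

/-- Points on different turns of the spiral see each other on the left and on the right; the
remaining pairs consist of neighbours on the same side or on parallel sides of the two strands. -/
theorem inHalf_departIdx {n i j : ℕ} {b b' : Bool} (hi : i < 2 * n) (hj : j < 2 * n)
    (hne : ¬ (b = b' ∧ i = j)) (d d' : SignType) :
    InHalf (departIdx n b b' i j) (spot n d b i - spot n d' b' j) := by
  obtain ⟨hd, hd1⟩ := signType_mem d
  obtain ⟨hd', hd1'⟩ := signType_mem d'
  have ri := spot_re hi d b
  have rj := spot_re hj d' b'
  rcases lt_trichotomy ((i + 1) / 2) ((j + 1) / 2) with h | h | h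
  · have h' : (((i + 1) / 2 : ℕ) : ℝ) + 1 ≤ ((j + 1) / 2 : ℕ) := by exact_mod_cast h
    rw [inHalf_left (by simp only [departIdx, h, if_true]; split_ifs <;> rfl), Complex.sub_re]
    linarith
  · have hnn : ¬ (j + 1) / 2 < (j + 1) / 2 := lt_irrefl _
    simp only [departIdx, h, hnn, if_false]
    by_cases hb : b = b'
    · subst hb
      obtain ⟨k, hk, hkn, hik⟩ : ∃ k, 1 ≤ k ∧ k + 1 ≤ n ∧
          ((i = 2 * k - 1 ∧ j = 2 * k) ∨ (j = 2 * k - 1 ∧ i = 2 * k)) :=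
        have hij : i ≠ j := fun e => hne ⟨rfl, e⟩
        ⟨(i + 1) / 2, by omega, by omega, by omega⟩
      simp only [if_true]
      rcases hik with ⟨rfl, rfl⟩ | ⟨rfl, rfl⟩
      · rw [if_pos (by omega), inHalf_above (by norm_num), spot_above hk hkn, spot_below hk,
          Complex.sub_im]
        simp only
        linarith
      · rw [if_neg (by omega), inHalf_below (by norm_num), spot_above hk hkn, spot_below hk,
          Complex.sub_im]
        simp only
        linarith
    · obtain rfl : b = !b' := by
        cases b <;> cases b' <;> simp_all
      rw [if_neg (by simp)]
      rcases position_cases hj with rfl | ⟨rfl, h0⟩ | ⟨k, hk, hkn, hjk⟩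
      · obtain rfl : i = 2 * n - 1 := by omega
        rw [if_pos (Or.inr rfl), spot_last, spot_last]
        cases b'
        · rw [if_neg (by simp), inHalf_below (by norm_num), Complex.sub_im]
          norm_num [strandSign]
        · rw [if_pos rfl, inHalf_above (by norm_num), Complex.sub_im]
          norm_num [strandSign]
      · obtain rfl : i = 0 := by omega
        rw [if_pos (Or.inl rfl), spot_first h0, spot_first h0]
        cases b'
        · rw [if_neg (by simp), inHalf_below (by norm_num), Complex.sub_im]
          norm_num [strandSign]
        · rw [if_pos rfl, inHalf_above (by norm_num), Complex.sub_im]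
          norm_num [strandSign]
      · obtain ⟨y, -, e⟩ := spot_mid hk hkn hjk d' b'
        obtain ⟨y', -, e'⟩ := spot_mid hk hkn (show i = 2 * k - 1 ∨ i = 2 * k by omega) d (!b')
        rw [if_neg (by omega), e, e']
        cases b'
        · rw [if_neg (by simp), inHalf_right (by norm_num), Complex.sub_re]
          norm_num [strandSign]
        · rw [if_pos rfl, inHalf_left (by norm_num), Complex.sub_re]
          norm_num [strandSign]
  · have h' : (((j + 1) / 2 : ℕ) : ℝ) + 1 ≤ ((i + 1) / 2 : ℕ) := by exact_mod_cast h
    rw [inHalf_right (by simp only [departIdx, h, h.not_gt, if_true, if_false]; omega),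
      Complex.sub_re]
    linarith

theorem side_le_side {n i j : ℕ} (hij : i ≤ j) (hj : j < 2 * n) : side n i ≤ side n j := by
  simp only [side]
  split_ifs <;> omega

/-- The half plane of an earlier point of the same strand. -/
theorem beforeIdx_eq {n i j : ℕ} (hij : i < j) (hj : j < 2 * n) (b : Bool) :
    beforeIdx n j (side n i) = departIdx n b b i j := by
  rcases position_cases (hij.trans hj) with rfl | ⟨rfl, h0⟩ | ⟨k, hk, hkn, h⟩
  · omega
  · have : 0 < (j + 1) / 2 := by omega
    cases b <;> simp [side_first h0, beforeIdx, departIdx, this]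
  · rw [side_mid hk hkn h]
    simp only [beforeIdx, departIdx, descents, side, turnIdx, show (i + 1) / 2 = k by omega]
    rcases position_cases hj with rfl | ⟨rfl, h0⟩ | ⟨l, hl, hln, h'⟩
    · simp only [if_true]
      split_ifs <;> first | omega | simp_all
    · omega
    · simp only [show (j + 1) / 2 = l by omega, show j ≠ 2 * n - 1 by omega, show j ≠ 0 by omega,
        if_false, if_true]
      split_ifs <;> first | omega | simp_all

/-- The half plane of a later point of the same strand. -/
theorem afterIdx_eq {n i j : ℕ} (hij : j < i) (hi : i < 2 * n) (b : Bool) :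
    afterIdx n j (side n i) = departIdx n b b i j := by
  have hjl : j ≠ 2 * n - 1 := by omega
  rcases position_cases hi with rfl | ⟨rfl, h0⟩ | ⟨k, hk, hkn, h⟩
  · rw [side_last]
    simp only [afterIdx, departIdx, descents, side, hjl, if_false, if_true,
      show (2 * n - 1 + 1) / 2 = n by omega]
    split_ifs <;> omega
  · omega
  · rw [side_mid hk hkn h]
    simp only [afterIdx, departIdx, descents, side, turnIdx, hjl, if_false, if_true,
      show (i + 1) / 2 = k by omega]
    split_ifs <;> omega

/-- Seen from an intersection point, the two strands arrive at their common end with angles that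
differ by this number of full turns. -/
def tipShift (b : Bool) (j : ℕ) : ℤ := if b ∨ j = 0 then 0 else 1

/-- The half plane of a point of the other strand. The full turns `tipShift` bring the branches of
the two strands to agreement at their common end, see `otherIdx_tip`. -/
theorem otherIdx_eq {n i j : ℕ} (hi : i < 2 * n) (hj : j < 2 * n) (b : Bool) :
    otherIdx n b j (side n i) = departIdx n (!b) b i j + 4 * tipShift b j := by
  rcases position_cases hi with rfl | ⟨rfl, h0⟩ | ⟨k, hk, hkn, h⟩
  · rw [side_last]
    simp only [otherIdx, otherDescents, departIdx, descents, tipShift,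
      show (2 * n - 1 + 1) / 2 = n by omega]
    cases b <;> simp <;> split_ifs <;> omega
  · rw [side_first h0]
    simp only [otherIdx, otherDescents, departIdx, descents, tipShift]
    cases b <;> simp <;> split_ifs <;> omega
  · rw [side_mid hk hkn h]
    simp only [otherIdx, otherDescents, departIdx, descents, tipShift, turnIdx,
      show (i + 1) / 2 = k by omega]
    cases b <;> simp <;> split_ifs <;> omega

theorem otherIdx_tip {n j : ℕ} (hj : j < 2 * n) (b : Bool) :
    otherIdx n b j (4 * n + 4) = afterIdx n j (4 * n + 4) + 4 * tipShift b j := by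
  simp only [otherIdx, otherDescents, afterIdx, descents, tipShift, side]
  cases b <;> simp <;> split_ifs <;> omega

theorem afterIdx_side {n j : ℕ} (b b' : Bool) (i : ℕ) (h : ¬ (b = b' ∧ i < j)) :
    afterIdx n j (side n j) = arriveIdx n b b' i j := by
  simp only [afterIdx, arriveIdx, h, if_false, if_true]
  split_ifs <;> omega

theorem beforeIdx_side {n i j : ℕ} (b : Bool) (hij : i < j) :
    beforeIdx n j (side n j) = arriveIdx n b b i j := by
  have : side n j ≠ 1 := by
    simp only [side]
    split_ifs <;> omega
  simp [beforeIdx, arriveIdx, this, hij]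

theorem strandCurve_tip (n : ℕ) (b : Bool) : strandCurve n b (4 * n + 5) = ⟨16 * n - 2, 0⟩ := by
  have h := polyline_apply (strandVertex n b) (m := 4 * n + 5) (k := 4 * n + 4) (by omega)
    (t := 4 * n + 5) (x := 1) (by push_cast; ring) zero_le_one le_rfl
  rw [strandCurve, h, show 4 * n + 4 + 1 = 4 * n + 5 by ring, strandVertex_end]
  simp

theorem inHalf_afterIdx_tip {n j : ℕ} (hj : j < 2 * n) (d : SignType) (b : Bool) :
    InHalf (afterIdx n j (4 * n + 4)) (⟨16 * n - 2, 0⟩ - spot n d b j) := by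
  obtain ⟨hd, hd1⟩ := signType_mem d
  have r := spot_re hj d b
  by_cases h : j = 2 * n - 1
  · subst h
    rw [inHalf_left (by simp [afterIdx]), spot_last, Complex.sub_re]
    simp only
    linarith
  · have h' : (((j + 1) / 2 : ℕ) : ℝ) + 1 ≤ n := by
      exact_mod_cast (show (j + 1) / 2 + 1 ≤ n by omega)
    rw [inHalf_right, Complex.sub_re]
    · simp only
      linarith
    · simp only [afterIdx, descents, side]
      split_ifs <;> omega

theorem Turns.add_turns {f : ℝ → ℂ} {s t x y : ℝ} (h : Turns f s t x y) (m : ℤ) :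
    Turns f s t (x + 2 * Real.pi * m) (y + 2 * Real.pi * m) := by
  obtain ⟨θ, h1, h2, h3, h4⟩ := h
  exact ⟨fun u => θ u + 2 * Real.pi * m, h1.add continuousOn_const,
    fun u hu => (h2 u hu).add_turns m, by simp [h3], by simp [h4]⟩

/-- The blue curve runs through one strand forwards and through the other one backwards. -/
theorem turns_blue_of_strand {n : ℕ} {b : Bool} {p : ℂ} {s t x y : ℝ}
    (h : Turns (fun u => strandCurve n b u - p) s t x y) (hs : 0 ≤ s) (ht : 0 ≤ t)
    (hs' : s ≤ 4 * n + 5) (ht' : t ≤ 4 * n + 5) :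
    Turns (fun u => blue n u - p) (blueTime n b s) (blueTime n b t) x y := by
  have e : ∀ u, blueTime n b u = (if b then 0 else 8 * n + 10) + (if b then 1 else -1) * u := by
    intro u
    cases b <;> simp [blueTime]
    ring
  rw [e, e]
  refine h.comp_affine _ _ (fun u hu => ?_) (by cases b <;> simp)
  have h0 : 0 ≤ u := (le_min hs ht).trans hu.1
  have h1 : u ≤ 4 * n + 5 := hu.2.trans (max_le hs' ht')
  rw [← e, blue_blueTime n b h0 h1]

/-- From one strand to the other through their common end. -/
theorem turns_blue_of_strands {n : ℕ} {b : Bool} {p : ℂ} {s t x y w : ℝ}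
    (h : Turns (fun u => strandCurve n (!b) u - p) s (4 * n + 5) x w)
    (h' : Turns (fun u => strandCurve n b u - p) t (4 * n + 5) y w) (hs : 0 ≤ s) (ht : 0 ≤ t)
    (hs' : s ≤ 4 * n + 5) (ht' : t ≤ 4 * n + 5) :
    Turns (fun u => blue n u - p) (blueTime n (!b) s) (blueTime n b t) x y := by
  have hn : (0 : ℝ) ≤ n := Nat.cast_nonneg n
  have k := turns_blue_of_strand h hs (by linarith) hs' le_rfl
  have k' := (turns_blue_of_strand h' ht (by linarith) ht' le_rfl).symm
  have e : ∀ b, blueTime n b (4 * n + 5) = 4 * n + 5 := by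
    intro b
    cases b <;> simp [blueTime]
    ring
  rw [e] at k k'
  refine k.trans k' ?_
  rw [Set.mem_uIcc]
  cases b
  · left
    simp only [blueTime]
    constructor <;> simp <;> linarith
  · right
    simp only [blueTime]
    constructor <;> simp <;> linarith

/-- The angle under which an intersection point sees the blue curve on the way from another
intersection point to itself, or rather to its copy on a parallel red curve. -/
theorem blue_turns {n i j : ℕ} {b b' : Bool} (hi : i < 2 * n) (hj : j < 2 * n)
    (hne : ¬ (b = b' ∧ i = j)) (d d₁ d₂ : SignType)
    (h : InHalf (arriveIdx n b b' i j) (spot n d₂ b' j - spot n d₁ b' j)) :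
    Turns (fun u => blue n u - spot n d₁ b' j) (blueTime n b (strandParam n d b i))
      (blueTime n b' (strandParam n d₂ b' j))
      (ang (departIdx n b b' i j) (spot n d b i - spot n d₁ b' j))
      (ang (arriveIdx n b b' i j) (spot n d₂ b' j - spot n d₁ b' j)) := by
  obtain ⟨i1, i2, i3⟩ := strandParam_spec hi d b
  obtain ⟨j1, j2, j3⟩ := strandParam_spec hj d₂ b'
  obtain ⟨si, ti⟩ := strandParam_mem hi d b
  obtain ⟨sj, tj⟩ := strandParam_mem hj d₂ b'
  have li := side_le hi
  have lj := side_le hj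
  have dep := inHalf_departIdx hi hj hne d d₁
  by_cases hb : b = b'
  · subst hb
    refine turns_blue_of_strand ?_ (by linarith) (by linarith) (by linarith) (by linarith)
    rcases lt_or_gt_of_ne (fun h => hne ⟨rfl, h⟩) with hij | hij
    · rw [← beforeIdx_side b hij] at h ⊢
      rw [← beforeIdx_eq hij hj] at dep ⊢
      exact ((sees_before hj (by omega) d₁ b).mono li.1 le_rfl).turns (side_le_side hij.le hj)
        (by omega) i1 i2 j1 j2 (strandParam_lt hij hj d d₂ b).le i3 j3 dep h
    · rw [← afterIdx_side b b i (by omega)] at h ⊢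
      rw [← afterIdx_eq hij hi] at dep ⊢
      exact (((sees_after hj d₁ b).mono le_rfl (by omega)).turns (side_le_side hij.le hi)
        (by omega) j1 j2 i1 i2 (strandParam_lt hij hi d₂ d b).le j3 i3 h dep).symm
  · obtain rfl : b = !b' := by
      cases b <;> cases b' <;> simp_all
    rw [← afterIdx_side (!b') b' i (by simp)] at h ⊢
    have tip := inHalf_afterIdx_tip hj d₁ b'
    have own := (sees_after hj d₁ b').turns (by omega) le_rfl j1 j2
      (t := 4 * n + 5) (by push_cast; linarith) (by push_cast; linarith) (by linarith)
      j3 (strandCurve_tip n b') h tip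
    have oth := ((sees_other hj d₁ b').mono li.1 le_rfl).turns (by omega) le_rfl i1 i2
      (t := 4 * n + 5) (by push_cast; linarith) (by push_cast; linarith) (by linarith)
      i3 (strandCurve_tip n (!b'))
      (by
        rw [otherIdx_eq hi hj]
        exact (inHalf_congr (by omega) _).mpr dep)
      (by
        rw [otherIdx_tip hj]
        exact (inHalf_congr (by omega) _).mpr tip)
    rw [otherIdx_eq hi hj, otherIdx_tip hj, ang_add_four_mul, ang_add_four_mul] at oth
    have oth' := oth.add_turns (-tipShift b' j)
    push_cast at oth'
    simp only [mul_neg, add_neg_cancel_right] at oth'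
    exact turns_blue_of_strands oth' own (by linarith) (by linarith) (by linarith) (by linarith)

/-! ### The red curve -/

/-- The number of the side of the red curve on which an intersection point lies. -/
def redSide (n : ℕ) (b : Bool) (j : ℕ) : ℕ :=
  if j = 2 * n - 1 then (if b then 0 else 4) else if j = 0 then 2 else if j % 2 = 1 then 3 else 1

/-- The order of two intersection points on the red curve, run through clockwise from its hole. -/
def redBefore (n : ℕ) (b b' : Bool) (i j : ℕ) : Prop :=
  redSide n b i < redSide n b' j ∨ (redSide n b i = redSide n b' j ∧
    ((redSide n b i = 1 ∧ (j < i ∨ (i = j ∧ b = true ∧ b' = false))) ∨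
      (redSide n b i = 2 ∧ b = true ∧ b' = false) ∨
      (redSide n b i = 3 ∧ (i < j ∨ (i = j ∧ b = false ∧ b' = true)))))

theorem redSide_lt (n : ℕ) (b : Bool) (j : ℕ) : redSide n b j < 5 := by
  simp only [redSide]
  split_ifs <;> omega

theorem redParam_mem {n : ℕ} (hn : 1 ≤ n) (d : SignType) (x : LinkIdx n) :
    redSide n (strand n x) (position n x) < redParam n d x ∧
      redParam n d x < redSide n (strand n x) (position n x) + 1 := by
  obtain ⟨hd, hd'⟩ := signType_mem d
  obtain ⟨he, he'⟩ := strandSign_le (strand n x)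
  have hj := position_lt hn x
  simp only [redParam, redSide]
  generalize strand n x = b at *
  generalize position n x = j at *
  have h3 : (0 : ℝ) < 3 + d := by linarith
  rcases position_cases hj with rfl | ⟨rfl, h0⟩ | ⟨k, hk, hkn, h⟩
  · have x0 : 0 < 1 / (3 + (d : ℝ)) := by positivity
    have x1 : 1 / (3 + (d : ℝ)) < 1 := by
      rw [div_lt_one h3]
      linarith
    cases b <;> simp only [if_true, Bool.false_eq_true, if_false] <;> push_cast <;>
      constructor <;> linarith
  · have x0 : 0 < (3 + d - strandSign b) / (2 * (3 + d)) := div_pos (by linarith) (by linarith)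
    have x1 : (3 + d - strandSign b) / (2 * (3 + d)) < 1 := by
      rw [div_lt_one (by linarith)]
      linarith
    simp only [h0, if_false, if_true]
    push_cast
    constructor <;> linarith
  · have hk1 : (1 : ℝ) ≤ k := by exact_mod_cast hk
    have hkn1 : (k : ℝ) + 1 ≤ n := by exact_mod_cast hkn
    have hw : (0 : ℝ) < 16 * n - 6 + 2 * d := by linarith
    simp only [show j ≠ 2 * n - 1 by omega, show j ≠ 0 by omega, show (j + 1) / 2 = k by omega,
      if_false]
    rcases h with rfl | rfl
    · have x0 : 0 < (16 * k - 3 + strandSign b + d) / (16 * n - 6 + 2 * d) :=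
        div_pos (by linarith) hw
      have x1 : (16 * k - 3 + strandSign b + d) / (16 * n - 6 + 2 * d) < 1 := by
        rw [div_lt_one hw]
        linarith
      simp only [show (2 * k - 1) % 2 = 1 by omega, if_true]
      push_cast
      constructor <;> linarith
    · have x0 : 0 < (16 * n - 3 - 16 * k - strandSign b + d) / (16 * n - 6 + 2 * d) :=
        div_pos (by linarith) hw
      have x1 : (16 * n - 3 - 16 * k - strandSign b + d) / (16 * n - 6 + 2 * d) < 1 := by
        rw [div_lt_one hw]
        linarith
      simp only [show ¬ (2 * k) % 2 = 1 by omega, if_false]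
      push_cast
      constructor <;> linarith

theorem redSide_eq_one {n j : ℕ} {b : Bool} (h : redSide n b j = 1) :
    j ≠ 2 * n - 1 ∧ j ≠ 0 ∧ ¬ j % 2 = 1 := by
  simp only [redSide] at h
  split_ifs at h <;> omega

theorem redSide_eq_two {n j : ℕ} {b : Bool} (h : redSide n b j = 2) : j ≠ 2 * n - 1 ∧ j = 0 := by
  simp only [redSide] at h
  split_ifs at h <;> omega

theorem redSide_eq_three {n j : ℕ} {b : Bool} (h : redSide n b j = 3) :
    j ≠ 2 * n - 1 ∧ j ≠ 0 ∧ j % 2 = 1 := by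
  simp only [redSide] at h
  split_ifs at h <;> omega

/-- The combinatorial order of the intersection points is their order on the red curve. -/
theorem redParam_zero_lt {n : ℕ} (hn : 1 ≤ n) {x y : LinkIdx n}
    (h : redBefore n (strand n x) (strand n y) (position n x) (position n y)) :
    redParam n 0 x < redParam n 0 y := by
  rcases h with h | ⟨hs, h⟩
  · have h' : (redSide n (strand n x) (position n x) : ℝ) + 1 ≤
        redSide n (strand n y) (position n y) := by exact_mod_cast h
    linarith [(redParam_mem hn 0 x).2, (redParam_mem hn 0 y).1]
  · simp only [redParam]
    generalize strand n x = b at *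
    generalize position n x = i at *
    generalize strand n y = b' at *
    generalize position n y = j at *
    have hn1 : (1 : ℝ) ≤ n := by exact_mod_cast hn
    have hw : (0 : ℝ) < 16 * n - 6 := by linarith
    have hb := strandSign_le b
    have hb' := strandSign_le b'
    rcases h with ⟨h1, h⟩ | ⟨h1, rfl, rfl⟩ | ⟨h1, h⟩
    · have a := redSide_eq_one h1
      have a' := redSide_eq_one (hs.symm.trans h1)
      simp only [a, a', if_false, SignType.coe_zero, mul_zero, add_zero]
      refine add_lt_add_right (div_lt_div_of_pos_right ?_ hw) _
      rcases h with h | ⟨rfl, rfl, rfl⟩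
      · have : (((j + 1) / 2 : ℕ) : ℝ) + 1 ≤ ((i + 1) / 2 : ℕ) := by
          exact_mod_cast (show (j + 1) / 2 + 1 ≤ (i + 1) / 2 by omega)
        linarith
      · simp [strandSign]
        linarith
    · have a := redSide_eq_two h1
      have a' := redSide_eq_two (hs.symm.trans h1)
      rw [if_neg a.1, if_pos a.2, if_neg a'.1, if_pos a'.2]
      norm_num [strandSign]
    · have a := redSide_eq_three h1
      have a' := redSide_eq_three (hs.symm.trans h1)
      simp only [a, a', if_false, if_true, SignType.coe_zero, mul_zero, add_zero]
      refine add_lt_add_right (div_lt_div_of_pos_right ?_ hw) _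
      rcases h with h | ⟨rfl, rfl, rfl⟩
      · have : (((i + 1) / 2 : ℕ) : ℝ) + 1 ≤ ((j + 1) / 2 : ℕ) := by
          exact_mod_cast (show (i + 1) / 2 + 1 ≤ (j + 1) / 2 by omega)
        linarith
      · simp [strandSign]

/-- Different intersection points have different positions on the red curve. -/
theorem redBefore_total {n : ℕ} {b b' : Bool} {i j : ℕ} (hne : ¬ (b = b' ∧ i = j)) :
    redBefore n b b' i j ∨ redBefore n b' b j i := by
  have key : redSide n b i = redSide n b' j → redBefore n b b' i j ∨ redBefore n b' b j i := by
    intro hs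
    simp only [redBefore, hs, lt_irrefl, true_and, false_or]
    simp only [redSide] at hs ⊢
    cases b <;> cases b' <;> split_ifs at hs ⊢ <;> simp_all <;> omega
  rcases lt_trichotomy (redSide n b i) (redSide n b' j) with h | h | h
  · exact Or.inl (Or.inl h)
  · exact key h
  · exact Or.inr (Or.inl h)

theorem position_strand_inj {n : ℕ} {x y : LinkIdx n} (h : x ≠ y) :
    ¬ (strand n x = strand n y ∧ position n x = position n y) := by
  rintro ⟨h1, h2⟩
  apply h
  rcases x with (⟨i, hi⟩ | ⟨i, hi⟩) | i | i <;> rcases y with (⟨j, hj⟩ | ⟨j, hj⟩) | j | j <;>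
    simp [strand, position] at h1 h2 ⊢ <;> omega

open Classical in
theorem linkCopy_eq {n : ℕ} (hn : 1 ≤ n) {x y : LinkIdx n} (h : x ≠ y) : linkCopy n x y =
    if redBefore n (strand n x) (strand n y) (position n x) (position n y) then 1 else -1 := by
  rw [linkCopy]
  split_ifs with h1 h2 h2
  · rfl
  · rcases redBefore_total (position_strand_inj h) with h3 | h3
    · exact absurd h3 h2
    · exact absurd h1 (redParam_zero_lt hn h3).not_gt
  · exact absurd (redParam_zero_lt hn h2) h1
  · rfl

/-- `p` lies inside copy `d` of the red curve. -/
def InsideRed (n : ℕ) (d : SignType) (p : ℂ) : Prop :=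
  7 - d < p.re ∧ p.re < 16 * n + 1 + d ∧ |p.im| < 3 + d

/-- The sides of the red curve are seen from inside it in the half planes right, below, left, above
and right, in this order. -/
theorem InsideRed.inHalf {n : ℕ} {d : SignType} {p : ℂ} (hp : InsideRed n d p) {k : ℕ} (hk : k < 5)
    {t : ℝ} (h0 : k ≤ t) (h1 : t ≤ k + 1) : InHalf k (red n d t - p) := by
  obtain ⟨p1, p2, p3⟩ := hp
  rw [abs_lt] at p3
  have e := fun m => (Complex.eta (redVertex n d m)).symm
  rw [red_side n d (e k) (e (k + 1)) hk (x := t - k) (by ring) (by linarith) (by linarith)]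
  interval_cases k
  · rw [inHalf_right (by norm_num), Complex.sub_re]
    simp only [redVertex]
    linarith
  · rw [inHalf_below (by norm_num), Complex.sub_im]
    simp only [redVertex]
    linarith
  · rw [inHalf_left (by norm_num), Complex.sub_re]
    simp only [redVertex]
    linarith
  · rw [inHalf_above (by norm_num), Complex.sub_im]
    simp only [redVertex]
    linarith
  · rw [inHalf_right (by norm_num), Complex.sub_re]
    simp only [redVertex]
    linarith

/-- From inside, the cut red curve is seen once around. -/
theorem InsideRed.turns {n : ℕ} {d : SignType} {p : ℂ} (hp : InsideRed n d p) {k l : ℕ} (hk : k < 5)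
    (hl : l < 5) {s t : ℝ} (hs0 : k ≤ s) (hs1 : s ≤ k + 1) (ht0 : l ≤ t) (ht1 : t ≤ l + 1) :
    Turns (fun u => red n d u - p) s t (ang k (red n d s - p)) (ang l (red n d t - p)) := by
  have key : ∀ {k l : ℕ}, k < 5 → l < 5 → ∀ {s t : ℝ}, k ≤ s → s ≤ k + 1 → l ≤ t → t ≤ l + 1 →
      k ≤ l → s ≤ t →
      Turns (fun u => red n d u - p) s t (ang k (red n d s - p)) (ang l (red n d t - p)) := by
    intro k l hk hl s t hs0 hs1 ht0 ht1 hkl hst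
    refine turns_polyline (redVertex n d) p (fun m => (m : ℤ)) hkl hl hs0 hs1 ht0 ht1 hst
      (hp.inHalf hk hs0 hs1) (hp.inHalf hl ht0 ht1) (fun m h1 h2 => ?_)
    have e : redVertex n d (m + 1) = red n d (m + 1 : ℕ) := by
      rw [red, polyline_apply _ (show m < 5 by omega) (x := 1) (by push_cast; ring) zero_le_one
        le_rfl]
      simp
    rw [e]
    refine ⟨hp.inHalf (by omega) (by push_cast; linarith) (by push_cast; linarith),
      hp.inHalf (by omega) le_rfl (by linarith), ?_⟩
    push_cast
    rw [show (m : ℤ) - (m + 1) = -1 by ring]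
    norm_num
  rcases lt_trichotomy k l with h | rfl | h
  · have h' : (k : ℝ) + 1 ≤ l := by exact_mod_cast h
    exact key hk hl hs0 hs1 ht0 ht1 h.le (by linarith)
  · rcases le_total s t with h | h
    · exact key hk hl hs0 hs1 ht0 ht1 le_rfl h
    · exact (key hl hk ht0 ht1 hs0 hs1 le_rfl h).symm
  · have h' : (l : ℝ) + 1 ≤ k := by exact_mod_cast h
    exact (key hl hk ht0 ht1 hs0 hs1 h.le (by linarith)).symm

/-- A half plane that contains the four corners contains the red curve. -/
theorem red_inHalf {n : ℕ} {d : SignType} {p : ℂ} {a : ℤ}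
    (h : ∀ m ≤ 5, InHalf a (redVertex n d m - p)) (t : ℝ) : InHalf a (red n d t - p) := by
  obtain ⟨k, hk, x, h0, h1, e⟩ := polyline_mem_side (redVertex n d) (show 0 < 5 by norm_num) t
  have e' : red n d t - p = ((1 - x : ℝ) : ℂ) * (redVertex n d k - p) +
      (x : ℂ) * (redVertex n d (k + 1) - p) := by
    rw [red, e]
    push_cast
    ring
  rw [e']
  exact (h k hk.le).convexComb (h (k + 1) hk) (by linarith) h0 (by ring)

theorem Lifts.cast {X : Type*} [TopologicalSpace X] {g : X → ℂ} {a b a' b' : X} {γ : Path a b}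
    {x y x' y' : ℝ} (h : Lifts g γ x y) (ha : a' = a) (hb : b' = b) (hx : x' = x) (hy : y' = y) :
    Lifts g (γ.cast ha hb) x' y' := by
  subst hx hy
  exact h

theorem InsideRed.lifts {n : ℕ} (hn : 1 ≤ n) {d : SignType} {p : ℂ} (hp : InsideRed n d p)
    (x y : LinkIdx n) : Lifts (fun z => z - p) (redPath n d x y)
      (ang (redSide n (strand n x) (position n x)) (blue n (blueParam n d x) - p))
      (ang (redSide n (strand n y) (position n y)) (blue n (blueParam n d y) - p)) := by
  have hx := redParam_mem hn d x
  have hy := redParam_mem hn d y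
  exact (hp.turns (redSide_lt _ _ _) (redSide_lt _ _ _) hx.1.le hx.2.le hy.1.le hy.2.le).lifts.cast
    (blue_blueParam n d x) (blue_blueParam n d y) (by rw [blue_blueParam]) (by rw [blue_blueParam])

theorem InsideRed.inHalf_blueParam {n : ℕ} (hn : 1 ≤ n) {d : SignType} {p : ℂ}
    (hp : InsideRed n d p) (x : LinkIdx n) :
    InHalf (redSide n (strand n x) (position n x)) (blue n (blueParam n d x) - p) := by
  rw [blue_blueParam]
  have hx := redParam_mem hn d x
  exact hp.inHalf (redSide_lt _ _ _) hx.1.le hx.2.le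

/-- From a point that sees the whole red curve in one half plane, its return paths do not wind. -/
theorem redPath_lifts {n : ℕ} {d : SignType} {p : ℂ} {a : ℤ}
    (h : ∀ m ≤ 5, InHalf a (redVertex n d m - p)) (x y : LinkIdx n) :
    Lifts (fun z => z - p) (redPath n d x y) (ang a (blue n (blueParam n d x) - p))
      (ang a (blue n (blueParam n d y) - p)) :=
  lifts_of_inHalf (by fun_prop) fun _ => red_inHalf h _

/-- The intersection points on the inner copy of the red curve lie inside the outer copy. -/
theorem insideRed_spot {n j : ℕ} (hj : j < 2 * n) (b : Bool) : InsideRed n 1 (spot n (-1) b j) := by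
  obtain ⟨hb, hb'⟩ := strandSign_le b
  have hn1 : (1 : ℝ) ≤ n := by exact_mod_cast (show 1 ≤ n by omega)
  rcases position_cases hj with rfl | ⟨rfl, h0⟩ | ⟨k, hk, hkn, rfl | rfl⟩
  · rw [spot_last]
    refine ⟨?_, ?_, abs_lt.mpr ⟨?_, ?_⟩⟩ <;> simp <;> linarith
  · rw [spot_first h0]
    refine ⟨?_, ?_, abs_lt.mpr ⟨?_, ?_⟩⟩ <;> simp <;> linarith
  · have hk1 : (1 : ℝ) ≤ k := by exact_mod_cast hk
    have hkn1 : (k : ℝ) + 1 ≤ n := by exact_mod_cast hkn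
    rw [spot_above hk hkn]
    refine ⟨?_, ?_, abs_lt.mpr ⟨?_, ?_⟩⟩ <;> simp <;> linarith
  · have hk1 : (1 : ℝ) ≤ k := by exact_mod_cast hk
    have hkn1 : (k : ℝ) + 1 ≤ n := by exact_mod_cast hkn
    rw [spot_below hk]
    refine ⟨?_, ?_, abs_lt.mpr ⟨?_, ?_⟩⟩ <;> simp <;> linarith

/-- A point of the outer copy of the red curve sees the inner copy in one half plane. -/
theorem inHalf_redVertex {n j : ℕ} (hj : j < 2 * n) (b : Bool) {m : ℕ} (hm : m ≤ 5) :
    InHalf (redSide n b j + 2) (redVertex n (-1) m - spot n 1 b j) := by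
  have hn1 : (1 : ℝ) ≤ n := by exact_mod_cast (show 1 ≤ n by omega)
  rcases position_cases hj with rfl | ⟨rfl, h0⟩ | ⟨k, hk, hkn, rfl | rfl⟩
  · rw [spot_last, inHalf_left (by simp only [redSide]; split_ifs <;> simp), Complex.sub_re]
    interval_cases m <;> simp [redVertex] <;> linarith
  · rw [spot_first h0, inHalf_right (by simp [redSide, h0]), Complex.sub_re]
    interval_cases m <;> simp [redVertex] <;> linarith
  · rw [spot_above hk hkn, inHalf_below (by
      simp [redSide, show 2 * k - 1 ≠ 2 * n - 1 by omega, show 2 * k - 1 ≠ 0 by omega,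
        show (2 * k - 1) % 2 = 1 by omega]), Complex.sub_im]
    interval_cases m <;> simp [redVertex] <;> linarith
  · rw [spot_below hk, inHalf_above (by
      simp [redSide, show 2 * k ≠ 2 * n - 1 by omega, show k ≠ 0 by omega]), Complex.sub_im]
    interval_cases m <;> simp [redVertex] <;> linarith

/-! ### The exchange loops of the link -/

/-- `Φ` of the loop in `Conf²` belonging to the intersection points number `i` and `j` of the
strands `b` and `b'`. -/
def linkPhi (n : ℕ) (b b' : Bool) (i j : ℕ) : ℤ :=
  if b = b' then
    (if j < i then j - i - (if b = true ∧ i = 2 * n - 1 then 1 else 0)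
    else if b = true ∧ j = 2 * n - 1 then 1 else 0)
  else if b then
    (if i = 2 * n - 1 then j - i - 1 else if i < j then 1 else j - i)
  else if j = 2 * n - 1 then 0 else if j < i then j - i else -1

/-- An intersection point is reached in one of the two half planes orthogonal to the red curve. -/
theorem arriveIdx_emod {n i j : ℕ} {b b' : Bool} :
    arriveIdx n b b' i j % 2 = (redSide n b' j : ℤ) % 2 := by
  simp only [arriveIdx, redSide]
  split_ifs <;> omega

/-- The intersection points of the two parallel copies with one strand follow each other in a
direction orthogonal to the red curve. -/
theorem inHalf_arriveIdx {n i j : ℕ} (hj : j < 2 * n) (b b' : Bool) {d d' : SignType}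
    (hd : (d = 1 ∧ d' = -1) ∨ (d = -1 ∧ d' = 1)) :
    InHalf (arriveIdx n b b' i j) (spot n d b' j - spot n d' b' j) ∨
      InHalf (arriveIdx n b b' i j) (spot n d' b' j - spot n d b' j) := by
  have e : ∀ z w : ℂ, (∃ a, arriveIdx n b b' i j % 2 = a % 2 ∧ InHalf a (z - w)) →
      InHalf (arriveIdx n b b' i j) (z - w) ∨ InHalf (arriveIdx n b b' i j) (w - z) := by
    rintro z w ⟨a, ha, h⟩
    rcases (show arriveIdx n b b' i j % 4 = a % 4 ∨ arriveIdx n b b' i j % 4 = (a + 2) % 4 by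
      omega) with h4 | h4
    · exact Or.inl ((inHalf_congr h4 _).mpr h)
    · refine Or.inr ((inHalf_congr h4 _).mpr ?_)
      rw [← neg_sub, inHalf_neg]
      exact h
  have key : InHalf (redSide n b' j) (spot n 1 b' j - spot n (-1) b' j) := by
    rcases position_cases hj with rfl | ⟨rfl, h0⟩ | ⟨k, hk, hkn, rfl | rfl⟩
    · rw [inHalf_right (by simp only [redSide]; split_ifs <;> simp), spot_last, spot_last,
        Complex.sub_re]
      norm_num
      linarith
    · rw [inHalf_left (by simp [redSide, h0]), spot_first h0, spot_first h0, Complex.sub_re]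
      norm_num
    · rw [spot_above hk hkn, spot_above hk hkn, inHalf_above (by
        simp [redSide, show 2 * k - 1 ≠ 2 * n - 1 by omega, show 2 * k - 1 ≠ 0 by omega,
          show (2 * k - 1) % 2 = 1 by omega]), Complex.sub_im]
      norm_num
    · rw [spot_below hk, spot_below hk, inHalf_below (by
        simp [redSide, show 2 * k ≠ 2 * n - 1 by omega, show k ≠ 0 by omega]), Complex.sub_im]
      norm_num
  rcases hd with ⟨rfl, rfl⟩ | ⟨rfl, rfl⟩
  · exact e _ _ ⟨_, arriveIdx_emod, key⟩
  · exact (e _ _ ⟨_, arriveIdx_emod, key⟩).symm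

/-- The four kinds of intersection points: last, first, odd and even. -/
theorem position_kinds {n i : ℕ} (hi : i < 2 * n) :
    ((i = 2 * n - 1) = True ∧ (i = 0) = False ∧ (i % 2 = 1) = True) ∨
    ((i = 2 * n - 1) = False ∧ (i = 0) = True ∧ (i % 2 = 1) = False) ∨
    ((i = 2 * n - 1) = False ∧ (i = 0) = False ∧ (i % 2 = 1) = True) ∨
    ((i = 2 * n - 1) = False ∧ (i = 0) = False ∧ (i % 2 = 1) = False) := by
  simp only [eq_iff_iff, iff_true, iff_false]
  omega

set_option maxHeartbeats 1000000 in
/-- The formula of `linkLoop₂_phi_aux` if the moving point is on the outer copy, which is seen from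
inside by the resting one. Only the kinds of the two points, their order along the strands and the
order of their descending sides matter. -/
theorem linkPhi_eq_of_before {n i j : ℕ} {b b' : Bool} (hi : i < 2 * n) (hj : j < 2 * n)
    (hne : ¬ (b = b' ∧ i = j)) (h : redBefore n b b' i j) :
    (arriveIdx n b b' i j + (redSide n b i : ℤ) - (redSide n b' j : ℤ) - (departIdx n b b' i j +
      ((redSide n b i : ℤ) - departIdx n b b' i j + 1) % 4 - 1)) / 2 = linkPhi n b b' i j := by
  simp only [redBefore, redSide, arriveIdx, departIdx, linkPhi] at h ⊢
  rcases position_kinds hi with c | c | c | c <;> obtain ⟨c1, c2, c3⟩ := c <;>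
    rcases position_kinds hj with k | k | k | k <;> obtain ⟨k1, k2, k3⟩ := k <;>
    have p := And.intro c1 (And.intro c2 (And.intro c3 (And.intro k1 (And.intro k2 k3)))) <;>
    simp only [eq_iff_iff, iff_true, iff_false] at p <;>
    rcases lt_trichotomy ((i + 1) / 2) ((j + 1) / 2) with hD | hD | hD <;>
    rcases lt_trichotomy i j with hI | hI | hI <;>
    try (exfalso; omega)
  -- the conditions are replaced by their truth values in each of the remaining cases
  all_goals
    have f1 := eq_true hD
    have f2 := eq_true hI
    have f3 := eq_false hI.not_gt
    have f4 := eq_false hD.not_gt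
    simp only [c1, c2, c3, k1, k2, k3, f1, f2, f3, f4] at h ⊢
    cases b <;> cases b' <;> simp only [reduceCtorEq, true_and, and_true, false_and, and_false,
      if_true, if_false, false_or, or_false, or_true, Nat.reduceLT, Nat.reduceEqDiff] at hne h ⊢
  all_goals omega

set_option maxHeartbeats 1000000 in
/-- The formula of `linkLoop₂_phi_aux` if the moving point is on the inner copy, which is seen by
the resting one in a single half plane. -/
theorem linkPhi_eq_of_after {n i j : ℕ} {b b' : Bool} (hi : i < 2 * n) (hj : j < 2 * n)
    (hne : ¬ (b = b' ∧ i = j)) (h : redBefore n b' b j i) :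
    (arriveIdx n b b' i j - (departIdx n b b' i j +
      ((redSide n b' j : ℤ) + 2 - departIdx n b b' i j + 1) % 4 - 1)) / 2 = linkPhi n b b' i j := by
  simp only [redBefore, redSide, arriveIdx, departIdx, linkPhi] at h ⊢
  rcases position_kinds hi with c | c | c | c <;> obtain ⟨c1, c2, c3⟩ := c <;>
    rcases position_kinds hj with k | k | k | k <;> obtain ⟨k1, k2, k3⟩ := k <;>
    have p := And.intro c1 (And.intro c2 (And.intro c3 (And.intro k1 (And.intro k2 k3)))) <;>
    simp only [eq_iff_iff, iff_true, iff_false] at p <;>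
    rcases lt_trichotomy ((i + 1) / 2) ((j + 1) / 2) with hD | hD | hD <;>
    rcases lt_trichotomy i j with hI | hI | hI <;>
    try (exfalso; omega)
  -- the conditions are replaced by their truth values in each of the remaining cases
  all_goals
    have f1 := eq_true hD
    have f2 := eq_true hI
    have f3 := eq_false hI.not_gt
    have f4 := eq_false hD.not_gt
    simp only [c1, c2, c3, k1, k2, k3, f1, f2, f3, f4] at h ⊢
    cases b <;> cases b' <;> simp only [reduceCtorEq, true_and, and_true, false_and, and_false,
      if_true, if_false, false_or, or_false, or_true, Nat.reduceLT, Nat.reduceEqDiff] at hne h ⊢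
  all_goals omega

/-- `Φ` of an exchange loop in terms of the half planes `r` and `r'` at the ends of its return path.
The term `b + (r' - b + 1) % 4 - 1` is the one among `b - 1, …, b + 2` that is congruent to `r'`: it
numbers the half plane `r'`, and its branch of the angle agrees with that of `b`. -/
theorem linkLoop₂_phi_aux {n : ℕ} (hn : 1 ≤ n) {x y : LinkIdx n} (hxy : x ≠ y) {d d' : SignType}
    (hd : (d = 1 ∧ d' = -1) ∨ (d = -1 ∧ d' = 1)) {r r' : ℤ}
    (hret : Lifts (fun z => z - blue n (blueParam n d' y)) (redPath n d y x)
      (ang r (blue n (blueParam n d y) - blue n (blueParam n d' y)))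
      (ang r' (blue n (blueParam n d x) - blue n (blueParam n d' y))))
    (hr : InHalf r (blue n (blueParam n d y) - blue n (blueParam n d' y)))
    (hr' : InHalf r' (blue n (blueParam n d x) - blue n (blueParam n d' y)))
    (her : r % 2 = (redSide n (strand n y) (position n y) : ℤ) % 2) :
    let e := arriveIdx n (strand n x) (strand n y) (position n x) (position n y)
    let b := departIdx n (strand n x) (strand n y) (position n x) (position n y)
    let l := twoPointLoop (blue n) (blueParam n d x) (blueParam n d y) (blueParam n d' y)
      (redPath n d y x)
    (∀ t, (l t).1 ≠ (l t).2) ∧ phi l = (e + r' - r - (b + (r' - b + 1) % 4 - 1)) / 2 := by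
  have hi := position_lt hn x
  have hj := position_lt hn y
  have hne := position_strand_inj hxy
  obtain ⟨j1, j2, j3⟩ := strandParam_spec hj d (strand n y)
  obtain ⟨j1', j2', j3'⟩ := strandParam_spec hj d' (strand n y)
  obtain ⟨si, ti⟩ := strandParam_mem hi d (strand n x)
  obtain ⟨sj, tj⟩ := strandParam_mem hj d (strand n y)
  obtain ⟨sj', tj'⟩ := strandParam_mem hj d' (strand n y)
  have lj := side_le hj
  intro e b l
  refine twoPointLoop_phi (b := b) (e := e) (r := r) (r' := r')
    ?_ ?_ ?_ ?_ ?_ hret hr hr' ?_ ?_ ?_ ?_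
  · -- both copies of the second point lie on the same side of the first one
    simp only [blueParam_eq]
    by_cases hs : strand n x = strand n y
    · rw [← hs]
      rcases lt_or_gt_of_ne (fun h => hne ⟨hs, h⟩) with h | h
      · have h1 := strandParam_lt h hj d d (strand n x)
        have h2 := strandParam_lt h hj d d' (strand n x)
        generalize strand n x = bx at h1 h2 ⊢
        cases bx <;> simp [blueTime, h1, h2]
      · have h1 := strandParam_lt h hi d d (strand n x)
        have h2 := strandParam_lt h hi d' d (strand n x)
        generalize strand n x = bx at h1 h2 ⊢
        cases bx <;> simp [blueTime, h1, h2]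
    · generalize strand n x = bx at *
      generalize strand n y = bt at *
      cases bx <;> cases bt <;> simp_all [blueTime]
      · right
        constructor <;> linarith
      · left
        constructor <;> linarith
  · rw [blue_spot hn, blue_spot hn]
    exact inHalf_arriveIdx hj _ _ hd
  · rw [blue_spot hn, blue_spot hn, blue_spot hn]
    intro h
    exact blue_turns hi hj hne d d' d h
  · rw [blue_spot hn, blue_spot hn, blue_spot hn]
    intro h
    exact blue_turns hi hj hne d d d' h
  · have h : InHalf (b + 2) (spot n d (strand n y) (position n y) -
        spot n d (strand n x) (position n x)) := by
      rw [← neg_sub, inHalf_neg]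
      exact inHalf_departIdx hi hj hne d d
    have h' : InHalf (b + 2) (spot n d' (strand n y) (position n y) -
        spot n d (strand n x) (position n x)) := by
      rw [← neg_sub, inHalf_neg]
      exact inHalf_departIdx hi hj hne d d'
    rw [blue_spot hn, blue_spot hn, blue_spot hn, blueParam_eq, blueParam_eq]
    have T := turns_side (strandVertex n (strand n y))
      (spot n d (strand n x) (position n x)) (b + 2)
      (M := 4 * n + 5) (k := side n (position n y)) (by omega) j1' j2' j1 j2
      (by rw [← j3'] at h'; exact h') (by rw [← j3] at h; exact h)
    rw [← j3, ← j3']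
    exact turns_blue_of_strand T (by linarith) (by linarith) (by linarith) (by linarith)
  · rw [blue_spot hn, blue_spot hn]
    exact inHalf_departIdx hi hj hne d d'
  · rw [her]
    exact arriveIdx_emod
  · omega
  · rw [abs_le]
    omega

open Classical in
/-- The exchange loops of the link lie in `Conf²`, with classes in `Br₂` given by `linkPhi`. -/
theorem linkLoop₂_phi {n : ℕ} (hn : 1 ≤ n) {x y : LinkIdx n} (hxy : x ≠ y) :
    (∀ t, (linkLoop₂ n x y t).1 ≠ (linkLoop₂ n x y t).2) ∧
      phi (linkLoop₂ n x y) =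
        linkPhi n (strand n x) (strand n y) (position n x) (position n y) := by
  have hi := position_lt hn x
  have hj := position_lt hn y
  have hne := position_strand_inj hxy
  rw [linkLoop₂, linkCopy_eq hn hxy, linkCopy_eq hn hxy.symm]
  by_cases hB : redBefore n (strand n x) (strand n y) (position n x) (position n y)
  · have hB' : ¬ redBefore n (strand n y) (strand n x) (position n y) (position n x) :=
      fun h => (redParam_zero_lt hn hB).not_gt (redParam_zero_lt hn h)
    rw [if_pos hB, if_neg hB']
    have hin : InsideRed n 1 (blue n (blueParam n (-1) y)) := by
      rw [blue_spot hn]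
      exact insideRed_spot hj _
    obtain ⟨h1, h2⟩ := linkLoop₂_phi_aux hn hxy (Or.inl ⟨rfl, rfl⟩) (hin.lifts hn y x)
      (hin.inHalf_blueParam hn y) (hin.inHalf_blueParam hn x) rfl
    refine ⟨h1, h2.trans ?_⟩
    exact linkPhi_eq_of_before hi hj hne hB
  · have hB' : redBefore n (strand n y) (strand n x) (position n y) (position n x) :=
      (redBefore_total hne).resolve_left hB
    rw [if_neg hB, if_pos hB']
    have hout : ∀ m ≤ 5, InHalf (redSide n (strand n y) (position n y) + 2)
        (redVertex n (-1) m - blue n (blueParam n 1 y)) := by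
      intro m hm
      rw [blue_spot hn]
      exact inHalf_redVertex hj _ hm
    obtain ⟨h1, h2⟩ := linkLoop₂_phi_aux hn hxy (Or.inr ⟨rfl, rfl⟩) (redPath_lifts hout y x)
      (by rw [blue_blueParam]; exact red_inHalf hout _)
      (by rw [blue_blueParam]; exact red_inHalf hout _) (by omega)
    refine ⟨h1, h2.trans ?_⟩
    rw [add_sub_cancel_right]
    exact linkPhi_eq_of_after hi hj hne hB'

/-! ### The link seen from the punctures -/

/-- The half planes in which the sides of the strand `b`, after the first one, are seen from a
puncture; the branches for the two strands agree at their common end. -/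
def lookIdx (n : ℕ) : Puncture → Bool → ℕ → ℤ
  | .Y, _, m => if m ≤ 2 then 0 else if 4 * n + 3 ≤ m then 4 * n else turnIdx 0 m
  | .Xminus, b, m =>
    if m = 1 then (if b then 1 else 3) else if 4 * n + 3 ≤ m then 4 * n else turnIdx 0 m
  | .Xplus, b, m => (if b then 0 else 4) +
    if m = 1 then 2 else if m = 4 * n + 3 then (if b then 5 else 3)
    else if m = 4 * n + 4 then (if b then 6 else 2) else turnIdx (n - 1) m

/-- The half plane in which an intersection point is seen along the red curve from a puncture. -/
def redLook (n : ℕ) : Puncture → Bool → ℕ → ℤ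
  | .Y, _, _ => 0
  | _, b, j => redSide n b j

/-- The number of full turns by which the angles of an intersection point seen from a puncture
differ along the blue curve and along the red curve. -/
def sheet (n : ℕ) : Puncture → Bool → ℕ → ℤ
  | .Y, _, j => ((j + 1) / 2 : ℕ)
  | .Xminus, b, j => if b = true ∧ j = 2 * n - 1 then n else (j / 2 : ℕ)
  | .Xplus, b, j => if b = true ∧ j ≠ 2 * n - 1 then 0 else 1

theorem Sees.add_turns {n : ℕ} {b : Bool} {p : ℂ} {lo hi : ℕ} {q : ℕ → ℤ}
    (h : Sees n b p lo hi q) (c : ℤ) : Sees n b p lo hi fun m => 4 * c + q m := by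
  intro m h1 h2
  obtain ⟨k1, k2, k3⟩ := h m h1 h2
  refine ⟨(inHalf_congr (Int.mul_add_emod_self_left _ _ _) _).mpr k1,
    (inHalf_congr (Int.mul_add_emod_self_left _ _ _) _).mpr k2, ?_⟩
  rwa [show 4 * c + q m - (4 * c + q (m + 1)) = q m - q (m + 1) by ring]

/-- From `Y` and `X⁻` a strand is seen as a spiral outwards that winds around the puncture; the
right puncture sees it on the left up to its last turn. -/
theorem sees_lookIdx {n : ℕ} (hn : 1 ≤ n) (V : Puncture) (b : Bool) :
    Sees n b (linkLoc n V) 1 (4 * n + 4) (lookIdx n V b) := by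
  have hn1 : (1 : ℝ) ≤ n := by exact_mod_cast hn
  have hn0 : n ≠ 0 := by omega
  obtain ⟨hb, hb'⟩ := strandSign_le b
  cases V
  · have hre : (linkLoc n .Xminus).re = 9 := by simp [linkLoc]
    have him : (linkLoc n .Xminus).im = 0 := by simp [linkLoc]
    refine Sees.append (sees_single (k := 1) ?_ ?_ ?_) (sees_outward b (κ := 0) (by omega)
      (by rw [him]; norm_num) (by rw [hre]; norm_num) (by rw [hre]; push_cast; linarith)
      (by rw [hre]; push_cast; linarith) ?_ ?_ ?_ (by rw [hre]; linarith))
    · rw [strandVertex_two]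
      cases b
      · simp only [lookIdx, if_true, Bool.false_eq_true, if_false, strandSign]
        rw [inHalf_above (by norm_num), Complex.sub_im, him]
        norm_num
      · simp only [lookIdx, if_true, strandSign]
        rw [inHalf_below (by norm_num), Complex.sub_im, him]
        norm_num
    · rw [strandVertex_two, inHalf_left (by simp [lookIdx, turnIdx]), Complex.sub_re, hre]
      simp only
      linarith
    · cases b <;> simp [lookIdx, turnIdx]
    · intro m h1 h2
      simp [lookIdx, show m ≠ 1 by omega, show ¬ 4 * n + 3 ≤ m by omega]
    · simp [lookIdx]
    · simp [lookIdx]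
  · have hre : (linkLoc n .Xplus).re = 16 * n - 1 := by simp [linkLoc]
    have him : (linkLoc n .Xplus).im = 0 := by simp [linkLoc]
    have key := (sees_inward (n := n) hn b (p := linkLoc n .Xplus) (by rw [him]; norm_num)
      (by rw [hre]; linarith) (by rw [hre]; linarith) (q := fun m => if m = 1 then 2
        else if m = 4 * n + 3 then (if b then 5 else 3)
        else if m = 4 * n + 4 then (if b then 6 else 2) else turnIdx (n - 1) m) rfl (by
        intro m h1 h2
        simp [show m ≠ 1 by omega, show m ≠ 4 * n + 3 by omega, show m ≠ 4 * n + 4 by omega]))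
    have q2 : turnIdx (n - 1) (4 * n + 2) = 4 := by
      simp only [turnIdx]
      split_ifs <;> omega
    refine (((key.append (sees_single (k := 4 * n + 2) ?_ ?_ ?_)).append
      (sees_single (k := 4 * n + 3) ?_ ?_ ?_)).add_turns (if b then 0 else 1)).congr ?_
    · simp only [show 4 * n + 2 ≠ 1 by omega, show 4 * n + 2 ≠ 4 * n + 3 by omega,
        show 4 * n + 2 ≠ 4 * n + 4 by omega, if_false, q2]
      rw [strandVertex_end₃, inHalf_right (by norm_num), Complex.sub_re, hre]
      simp only
      linarith
    · rw [strandVertex_end₃]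
      cases b
      · simp only [show 4 * n + 2 + 1 ≠ 1 by omega, if_false, if_true, Bool.false_eq_true,
          strandSign]
        rw [inHalf_above (by norm_num), Complex.sub_im, him]
        norm_num
      · simp only [show 4 * n + 2 + 1 ≠ 1 by omega, if_false, if_true, strandSign]
        rw [inHalf_below (by norm_num), Complex.sub_im, him]
        norm_num
    · simp only [show 4 * n + 2 ≠ 1 by omega, show 4 * n + 2 ≠ 4 * n + 3 by omega,
        show 4 * n + 2 ≠ 4 * n + 4 by omega, if_false, q2]
      cases b <;> simp
    · rw [strandVertex_end₄]
      cases b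
      · simp only [show 4 * n + 3 ≠ 1 by omega, if_false, if_true, Bool.false_eq_true, strandSign]
        rw [inHalf_above (by norm_num), Complex.sub_im, him]
        norm_num
      · simp only [show 4 * n + 3 ≠ 1 by omega, if_false, if_true, strandSign]
        rw [inHalf_below (by norm_num), Complex.sub_im, him]
        norm_num
    · rw [strandVertex_end₄, inHalf_left (by cases b <;> simp), Complex.sub_re, hre]
      simp only
      linarith
    · cases b <;> simp
    · intro m h1 h2
      cases b <;> simp [lookIdx]
  · have hre : (linkLoc n .Y).re = 0 := by simp [linkLoc]
    have him : (linkLoc n .Y).im = 0 := by simp [linkLoc]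
    have hsp := sees_spiral b (p := linkLoc n .Y) (κ := 0) (lo := 3) (hi := 4 * n + 2) (by norm_num)
      le_rfl (by rw [him]; norm_num) (by rw [hre]) (fun k h1 _ h3 => by omega) (fun k _ _ h3 => by
        have : (1 : ℝ) ≤ k := by exact_mod_cast h3
        rw [hre]
        linarith)
    refine (((sees_single (k := 1) ?_ ?_ ?_).append (sees_single (k := 2) ?_ ?_ ?_)).append
      (hsp.congr fun m h1 h2 => ?_)).append (sees_end b (e := 4 * n) (by rw [hre]; linarith)
        (by omega) ?_ ?_ ?_)
    · rw [inHalf_right (by simp [lookIdx]), strandVertex_two, Complex.sub_re, hre]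
      simp only
      linarith
    · rw [inHalf_right (by simp [lookIdx]), strandVertex_two, Complex.sub_re, hre]
      simp only
      linarith
    · simp [lookIdx]
    · have := strandVertex_below b (n := n) (k := 0) (by omega)
      rw [inHalf_right (by simp [lookIdx]), show 2 + 1 = 4 * 0 + 3 by norm_num, this,
        Complex.sub_re, hre]
      simp
      linarith
    · have := strandVertex_below b (n := n) (k := 0) (by omega)
      rw [inHalf_below (by simp [lookIdx, turnIdx, hn0]), show 2 + 1 = 4 * 0 + 3 by norm_num, this,
        Complex.sub_im, him]
      simp
      linarith
    · simp [lookIdx, turnIdx, hn0]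
    · simp [lookIdx, show ¬ m ≤ 2 by omega, show ¬ 4 * n + 3 ≤ m by omega]
    · simp only [lookIdx, turnIdx]
      split_ifs <;> push_cast <;> omega
    · simp [lookIdx]
    · simp [lookIdx]

theorem inHalf_lookIdx_tip {n : ℕ} (hn : 1 ≤ n) (V : Puncture) (b : Bool) :
    InHalf (lookIdx n V b (4 * n + 4)) (⟨16 * n - 2, 0⟩ - linkLoc n V) := by
  have hn1 : (1 : ℝ) ≤ n := by exact_mod_cast hn
  cases V
  · rw [inHalf_right (by simp [lookIdx])]
    simp [linkLoc]
    linarith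
  · rw [inHalf_left (by cases b <;> simp [lookIdx])]
    simp [linkLoc]
  · rw [inHalf_right (by simp [lookIdx])]
    simp [linkLoc]
    linarith

theorem inHalf_lookIdx_one {n : ℕ} (hn : 1 ≤ n) (V : Puncture) (b : Bool) :
    InHalf (lookIdx n V b 1) (strandVertex n b 1 - linkLoc n V) := by
  have hn1 : (1 : ℝ) ≤ n := by exact_mod_cast hn
  rw [strandVertex_one]
  cases V
  · cases b
    · rw [inHalf_above (by simp [lookIdx])]
      simp [linkLoc, strandSign]
    · rw [inHalf_below (by simp [lookIdx])]
      simp [linkLoc, strandSign]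
  · rw [inHalf_left (by cases b <;> simp [lookIdx])]
    simp [linkLoc]
    linarith
  · rw [inHalf_right (by simp [lookIdx])]
    simp [linkLoc]

theorem inHalf_lookIdx {n j : ℕ} (hj : j < 2 * n) (V : Puncture) (b : Bool) :
    InHalf (lookIdx n V b (side n j)) (spot n 0 b j - linkLoc n V) := by
  have hn1 : (1 : ℝ) ≤ n := by exact_mod_cast (show 1 ≤ n by omega)
  obtain ⟨hb, hb'⟩ := strandSign_le b
  rcases position_cases hj with rfl | ⟨rfl, h0⟩ | ⟨k, hk, hkn, h⟩
  · rw [side_last, spot_last]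
    cases V
    · rw [inHalf_right (by simp [lookIdx])]
      simp [linkLoc]
      linarith
    · cases b
      · rw [inHalf_above (by simp [lookIdx])]
        simp [linkLoc, strandSign]
      · rw [inHalf_below (by simp [lookIdx])]
        simp [linkLoc, strandSign]
    · rw [inHalf_right (by simp [lookIdx])]
      simp [linkLoc]
      linarith
  · rw [side_first h0, spot_first h0]
    cases V
    · cases b
      · rw [inHalf_above (by simp [lookIdx])]
        simp [linkLoc, strandSign]
      · rw [inHalf_below (by simp [lookIdx])]
        simp [linkLoc, strandSign]
    · rw [inHalf_left (by cases b <;> simp [lookIdx])]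
      simp [linkLoc]
      linarith
    · rw [inHalf_right (by simp [lookIdx])]
      simp [linkLoc]
  · obtain ⟨y, -, e⟩ := spot_mid hk hkn h 0 b
    have hk1 : (1 : ℝ) ≤ k := by exact_mod_cast hk
    have hkn1 : (k : ℝ) + 1 ≤ n := by exact_mod_cast hkn
    rw [side_mid hk hkn h, e]
    cases V
    · rw [inHalf_right (by simp only [lookIdx, turnIdx]; split_ifs <;> omega)]
      simp [linkLoc]
      linarith
    · rw [inHalf_left (by
        simp only [lookIdx, turnIdx]
        cases b <;> simp only [if_true, if_false, Bool.false_eq_true] <;> split_ifs <;> omega)]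
      simp [linkLoc]
      linarith
    · rw [inHalf_right (by simp only [lookIdx, turnIdx]; split_ifs <;> omega)]
      simp [linkLoc]
      linarith

/-- The half planes of an intersection point along the blue curve and along the red curve differ by
`sheet` full turns, up to the overlap of half planes. -/
theorem abs_lookIdx_sub_le {n j : ℕ} (hj : j < 2 * n) (V : Puncture) (b : Bool) :
    |lookIdx n V b (side n j) - (redLook n V b j + 4 * sheet n V b j)| ≤ 2 := by
  rw [abs_le]
  rcases position_cases hj with rfl | ⟨rfl, h0⟩ | ⟨k, hk, hkn, h⟩
  · rw [side_last]
    cases V <;> cases b <;> simp only [lookIdx, redLook, sheet, redSide, if_true, if_false,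
      Bool.false_eq_true, true_and, false_and, ne_eq, not_true] <;> split_ifs <;> omega
  · rw [side_first h0]
    cases V <;> cases b <;> simp [lookIdx, redLook, sheet, redSide, h0]
  · rw [side_mid hk hkn h]
    cases V <;> cases b <;> simp only [lookIdx, redLook, sheet, redSide, turnIdx, if_true, if_false,
      Bool.false_eq_true, true_and, false_and] <;> split_ifs <;> omega

theorem strandCurve_one (n : ℕ) (b : Bool) : strandCurve n b 1 = strandVertex n b 1 := by
  have h := polyline_apply (strandVertex n b) (m := 4 * n + 5) (k := 0) (by omega)
    (t := 1) (x := 1) (by push_cast; ring) zero_le_one le_rfl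
  rw [strandCurve, h]
  simp

theorem lookIdx_tip (n : ℕ) (V : Puncture) (b : Bool) :
    lookIdx n V b (4 * n + 4) = lookIdx n V true (4 * n + 4) := by
  cases V <;> cases b <;> simp [lookIdx]

theorem insideRed_linkLoc {n : ℕ} (hn : 1 ≤ n) (d : SignType) {V : Puncture} (hV : V ≠ .Y) :
    InsideRed n d (linkLoc n V) := by
  obtain ⟨hd, hd'⟩ := signType_mem d
  have hn1 : (1 : ℝ) ≤ n := by exact_mod_cast hn
  cases V
  · refine ⟨?_, ?_, ?_⟩ <;> simp [linkLoc] <;> linarith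
  · refine ⟨?_, ?_, ?_⟩ <;> simp [linkLoc] <;> linarith
  · exact absurd rfl hV

theorem inHalf_redVertex_Y {n : ℕ} (hn : 1 ≤ n) (d : SignType) :
    ∀ m ≤ 5, InHalf 0 (redVertex n d m - linkLoc n .Y) := by
  obtain ⟨hd, hd'⟩ := signType_mem d
  have hn1 : (1 : ℝ) ≤ n := by exact_mod_cast hn
  intro m hm
  rw [inHalf_right (by norm_num), Complex.sub_re]
  interval_cases m <;> simp [redVertex, linkLoc] <;> linarith

theorem redPath_lifts_linkLoc {n : ℕ} (hn : 1 ≤ n) (V : Puncture) (d : SignType) (x y : LinkIdx n) :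
    Lifts (fun z => z - linkLoc n V) (redPath n d x y)
      (ang (redLook n V (strand n x) (position n x)) (blue n (blueParam n d x) - linkLoc n V))
      (ang (redLook n V (strand n y) (position n y)) (blue n (blueParam n d y) - linkLoc n V)) := by
  cases V
  · exact (insideRed_linkLoc hn d (by simp)).lifts hn x y
  · exact (insideRed_linkLoc hn d (by simp)).lifts hn x y
  · exact redPath_lifts (inHalf_redVertex_Y hn d) x y

theorem inHalf_redLook {n : ℕ} (hn : 1 ≤ n) (V : Puncture) (d : SignType) (x : LinkIdx n) :
    InHalf (redLook n V (strand n x) (position n x))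
      (blue n (blueParam n d x) - linkLoc n V) := by
  cases V
  · exact (insideRed_linkLoc hn d (by simp)).inHalf_blueParam hn x
  · exact (insideRed_linkLoc hn d (by simp)).inHalf_blueParam hn x
  · rw [blue_blueParam]
    exact red_inHalf (inHalf_redVertex_Y hn d) _

theorem blue_turns_linkLoc {n : ℕ} (hn : 1 ≤ n) (V : Puncture) (x y : LinkIdx n) :
    Turns (fun u => blue n u - linkLoc n V) (blueParam n 0 x) (blueParam n 0 y)
      (ang (lookIdx n V (strand n x) (side n (position n x)))
        (blue n (blueParam n 0 x) - linkLoc n V))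
      (ang (lookIdx n V (strand n y) (side n (position n y)))
        (blue n (blueParam n 0 y) - linkLoc n V)) := by
  rw [blue_spot hn, blue_spot hn, blueParam_eq, blueParam_eq]
  have hi := position_lt hn x
  have hj := position_lt hn y
  generalize strand n x = b at *
  generalize position n x = i at *
  generalize strand n y = b' at *
  generalize position n y = j at *
  obtain ⟨si, ti⟩ := strandParam_mem hi 0 b
  obtain ⟨sj, tj⟩ := strandParam_mem hj 0 b'
  by_cases hb : b = b'
  · subst hb
    have key : ∀ i j, i ≤ j → j < 2 * n → Turns (fun u => strandCurve n b u - linkLoc n V)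
        (strandParam n 0 b i) (strandParam n 0 b j)
        (ang (lookIdx n V b (side n i)) (spot n 0 b i - linkLoc n V))
        (ang (lookIdx n V b (side n j)) (spot n 0 b j - linkLoc n V)) := by
      intro i j hij hj
      have hi := hij.trans_lt hj
      obtain ⟨i1, i2, i3⟩ := strandParam_spec hi 0 b
      obtain ⟨j1, j2, j3⟩ := strandParam_spec hj 0 b
      have hle : strandParam n 0 b i ≤ strandParam n 0 b j := by
        rcases hij.eq_or_lt with rfl | h
        · exact le_rfl
        · exact (strandParam_lt h hj 0 0 b).le
      have li := side_le hi
      have lj := side_le hj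
      exact ((sees_lookIdx hn V b).mono li.1 (by omega)).turns (side_le_side hij hj) (by omega)
        i1 i2 j1 j2 hle i3 j3 (inHalf_lookIdx hi V b) (inHalf_lookIdx hj V b)
    refine turns_blue_of_strand ?_ (by linarith) (by linarith) (by linarith) (by linarith)
    rcases le_total i j with h | h
    · exact key i j h hj
    · exact (key j i h hi).symm
  · obtain rfl : b = !b' := by
      cases b <;> cases b' <;> simp_all
    have key : ∀ b i, i < 2 * n → Turns (fun u => strandCurve n b u - linkLoc n V)
        (strandParam n 0 b i) (4 * n + 5)
        (ang (lookIdx n V b (side n i)) (spot n 0 b i - linkLoc n V))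
        (ang (lookIdx n V true (4 * n + 4)) (⟨16 * n - 2, 0⟩ - linkLoc n V)) := by
      intro b i hi
      obtain ⟨i1, i2, i3⟩ := strandParam_spec hi 0 b
      obtain ⟨-, ti⟩ := strandParam_mem hi 0 b
      have li := side_le hi
      rw [← lookIdx_tip n V b]
      exact ((sees_lookIdx hn V b).mono li.1 le_rfl).turns (by omega) le_rfl
        i1 i2 (by push_cast; linarith) (by push_cast; linarith) (by linarith) i3
        (strandCurve_tip n b) (inHalf_lookIdx hi V b) (inHalf_lookIdx_tip hn V b)
    exact turns_blue_of_strands (key _ _ hi) (key _ _ hj) (by linarith) (by linarith) (by linarith)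
      (by linarith)

/-- The loop from one intersection point to another and back winds around a puncture as often as the
sheets of the two points differ. -/
theorem linkLoop_lifts {n : ℕ} (hn : 1 ≤ n) (V : Puncture) (x y : LinkIdx n) :
    Lifts (fun z => z - linkLoc n V) (linkLoop n x y)
      (ang (lookIdx n V (strand n x) (side n (position n x))) (lam n x - linkLoc n V))
      (ang (lookIdx n V (strand n x) (side n (position n x)) +
        4 * (sheet n V (strand n y) (position n y) - sheet n V (strand n x) (position n x)))
        (lam n x - linkLoc n V)) := by
  have e : ∀ x : LinkIdx n, ang (lookIdx n V (strand n x) (side n (position n x)))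
      (blue n (blueParam n 0 x) - linkLoc n V) =
      ang (redLook n V (strand n x) (position n x)) (blue n (blueParam n 0 x) - linkLoc n V) +
        2 * Real.pi * sheet n V (strand n x) (position n x) := by
    intro x
    rw [← ang_add_four_mul]
    refine ang_eq ?_ ((inHalf_congr (by omega) _).mpr (inHalf_redLook hn V 0 x))
      (abs_lookIdx_sub_le (position_lt hn x) V _)
    rw [blue_spot hn]
    exact inHalf_lookIdx (position_lt hn x) V _
  have h1 := (blue_turns_linkLoc hn V x y).lifts
  have h2 := (redPath_lifts_linkLoc hn V 0 y x).add_turns (sheet n V (strand n y) (position n y))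
  rw [← e y] at h2
  have h3 : Lifts (fun z => z - linkLoc n V) (linkLoop n x y)
      (ang (lookIdx n V (strand n x) (side n (position n x))) (lam n x - linkLoc n V))
      (ang (redLook n V (strand n x) (position n x)) (lam n x - linkLoc n V) +
        2 * Real.pi * sheet n V (strand n y) (position n y)) := h1.trans h2
  have hx := e x
  change ang _ (lam n x - _) = ang _ (lam n x - _) + _ at hx
  rw [ang_add_four_mul]
  convert h3 using 1
  rw [hx]
  push_cast
  ring

theorem psi_linkLoop {n : ℕ} (hn : 1 ≤ n) (W : Finset Puncture) (x y : LinkIdx n) :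
    psi (linkLoc n) W (linkLoop n x y) = ∑ V ∈ W,
      (sheet n V (strand n y) (position n y) - sheet n V (strand n x) (position n x)) := by
  have h : ∀ V ∈ W, psiOne (linkLoc n V) (linkLoop n x y) =
      2 * (sheet n V (strand n y) (position n y) - sheet n V (strand n x) (position n x)) :=
    fun V _ => psiOne_eq (linkLoop_lifts hn V x y)
  rw [psi, Finset.sum_congr rfl h, ← Finset.mul_sum]
  omega

/-! ### The matrix of the link -/

theorem mu₃Aux_replicate (u v k : ℕ) : mu₃Aux .UP u v (List.replicate k .T) = 0 := by
  induction k generalizing u v with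
  | zero => rfl
  | succ k ih => exact ih (u + v) v

/-- All twists that build the tangle are top twists of `UP` tangles, which are not counted. -/
theorem mu₃_eq (n : ℕ) : mu₃ n = 0 := mu₃Aux_replicate 0 1 _

/-- The entries of the matrix of the link. The sheets of the base point `λ_ω` are `n`, `n` and `1`.
-/
theorem linkMatrix_eq {n : ℕ} (hn : 1 ≤ n) (x y : LinkIdx n) : linkMatrix n x y =
    2 * n - sheet n .Xminus (strand n x) (position n x) - sheet n .Y (strand n x) (position n x)
      - 3 * (1 - sheet n .Xplus (strand n x) (position n x)) +
      if x = y then 0 else linkPhi n (strand n y) (strand n x) (position n y) (position n x) -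
        2 * (sheet n .Xplus (strand n x) (position n x) -
          sheet n .Xplus (strand n y) (position n y)) := by
  have e1 : sheet n .Xminus (strand n (.inr (.inr 0))) (position n (.inr (.inr 0))) = n := by
    simp [sheet, strand, position]
  have e2 : sheet n .Y (strand n (.inr (.inr 0))) (position n (.inr (.inr 0))) = n := by
    simp only [sheet, position]
    omega
  have e3 : sheet n .Xplus (strand n (.inr (.inr 0))) (position n (.inr (.inr 0))) = 1 := by
    simp [sheet, strand, position]
  simp only [linkMatrix, psi_linkLoop hn, mu₃_eq, Finset.sum_singleton,
    Finset.sum_pair (show Puncture.Xminus ≠ Puncture.Y by simp), e1, e2, e3]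
  split_ifs with h
  · ring
  · rw [(linkLoop₂_phi hn (Ne.symm h)).2]
    ring

theorem linkMatrix_eq_closureMatrix {n : ℕ} (hn : 1 ≤ n) : linkMatrix n = closureMatrix n hn := by
  ext x y
  rw [linkMatrix_eq hn]
  have h1 : 1 ≤ 2 * n - 1 := by omega
  have h2 : (2 * n - 1) % 2 = 1 := by omega
  have hc : ((2 * n - 1 : ℕ) : ℤ) = 2 * n - 1 := by omega
  have T := tangleMatrix_eq h2 h1
  rcases x with (⟨i, hi⟩ | ⟨i, hi⟩) | ⟨i, hi⟩ | ⟨i, hi⟩ <;>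
    rcases y with (⟨j, hj⟩ | ⟨j, hj⟩) | ⟨j, hj⟩ | ⟨j, hj⟩ <;>
    simp only [closureMatrix, closureUP, Matrix.fromBlocks_apply₁₁, Matrix.fromBlocks_apply₁₂,
      Matrix.fromBlocks_apply₂₁, Matrix.fromBlocks_apply₂₂, Matrix.add_apply, Matrix.sub_apply,
      Matrix.smul_apply, show (2 • (1 : ℤ)) = 2 from rfl, Matrix.toBlocks₁₁, Matrix.toBlocks₁₂,
      Matrix.toBlocks₂₁, Matrix.toBlocks₂₂, Matrix.of_apply, T, rank, ones, upper, lower, sheet,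
      strand, position, linkPhi, Sum.inl.injEq, Sum.inr.injEq, reduceCtorEq, Fin.mk.injEq,
      Fin.mk_lt_mk, if_true, if_false, Bool.false_eq_true, true_and, false_and] <;>
    split_ifs <;> omega

/-! ### The intersection points of the blue curve and the red curve -/

/-- The red curve lies on the boundary of a rectangle. -/
theorem red_zero_cases {n : ℕ} (hn : 1 ≤ n) (t : ℝ) :
    |(red n 0 t).im| ≤ 3 ∧ ((red n 0 t).re = 7 ∨ (red n 0 t).re = 16 * n + 1 ∨
      (red n 0 t).im = 3 ∨ (red n 0 t).im = -3) ∧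
      7 ≤ (red n 0 t).re ∧ (red n 0 t).re ≤ 16 * n + 1 := by
  have hn1 : (1 : ℝ) ≤ n := by exact_mod_cast hn
  obtain ⟨k, hk, x, h0, h1, e⟩ := polyline_mem_side (redVertex n 0) (show 0 < 5 by norm_num) t
  have eta := fun k => (Complex.eta (redVertex n 0 k)).symm
  rw [red, e, abs_le]
  interval_cases k <;> simp [redVertex] <;> (repeat' apply And.intro) <;> nlinarith

/-- Every point of the blue curve lies on a side of one of the strands. -/
theorem blue_mem_strand {n : ℕ} (s : ℝ) : ∃ b, ∃ m < 4 * n + 5, ∃ x : ℝ, 0 ≤ x ∧ x ≤ 1 ∧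
    blue n s = strandVertex n b m + x * (strandVertex n b (m + 1) - strandVertex n b m) := by
  obtain ⟨k, hk, x, h0, h1, e⟩ := polyline_mem_side (fun m => if m ≤ 4 * n + 5 then
    strandVertex n true m else strandVertex n false (8 * n + 10 - m))
    (show 0 < 8 * n + 10 by omega) s
  rw [blue, e]
  rcases lt_or_ge k (4 * n + 5) with h | h
  · exact ⟨true, k, h, x, h0, h1, by simp [h.le, show k + 1 ≤ 4 * n + 5 by omega]⟩
  · refine ⟨false, 8 * n + 9 - k, by omega, 1 - x, by linarith, by linarith, ?_⟩
    have e1 : (if k ≤ 4 * n + 5 then strandVertex n true k else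
        strandVertex n false (8 * n + 10 - k)) = strandVertex n false (8 * n + 9 - k + 1) := by
      rw [show 8 * n + 9 - k + 1 = 8 * n + 10 - k by omega]
      split_ifs with hk'
      · obtain rfl : k = 4 * n + 5 := by omega
        rw [show 8 * n + 10 - (4 * n + 5) = 4 * n + 5 by omega, strandVertex_end, strandVertex_end]
      · rfl
    simp only [e1, show ¬ k + 1 ≤ 4 * n + 5 by omega, if_false,
      show 8 * n + 10 - (k + 1) = 8 * n + 9 - k by omega]
    push_cast
    ring

/-- The points of a strand that lie on the red curve are its listed intersection points. -/
theorem eq_spot_of_mem {n : ℕ} (hn : 1 ≤ n) {b : Bool} {m : ℕ} (hm : m < 4 * n + 5) {x : ℝ}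
    (h0 : 0 ≤ x) (h1 : x ≤ 1) {z : ℂ}
    (hz : z = strandVertex n b m + x * (strandVertex n b (m + 1) - strandVertex n b m))
    (him : |z.im| ≤ 3) (h : z.re = 7 ∨ z.re = 16 * n + 1 ∨ z.im = 3 ∨ z.im = -3)
    (hre : 7 ≤ z.re) (hre' : z.re ≤ 16 * n + 1) : ∃ j < 2 * n, z = spot n 0 b j := by
  have hn1 : (1 : ℝ) ≤ n := by exact_mod_cast hn
  have he := strandSign_mem b
  have key : ∀ {a c a' c' : ℝ}, strandVertex n b m = ⟨a, c⟩ → strandVertex n b (m + 1) = ⟨a', c'⟩ →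
      z.re = a + x * (a' - a) ∧ z.im = c + x * (c' - c) := by
    intro a c a' c' e e'
    rw [hz, e, e']
    simp
  rw [abs_le] at him
  obtain rfl | rfl | rfl | ⟨k, hk, hm'⟩ | rfl | rfl | rfl : m = 0 ∨ m = 1 ∨ m = 2 ∨
      (∃ k < n, m = 4 * k + 3 ∨ m = 4 * k + 4 ∨ m = 4 * k + 5 ∨ (k + 1 < n ∧ m = 4 * k + 6)) ∨
      m = 4 * n + 2 ∨ m = 4 * n + 3 ∨ m = 4 * n + 4 := by
    by_cases h3 : m < 3
    · omega
    · by_cases h4 : m < 4 * n + 2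
      · exact Or.inr (Or.inr (Or.inr (Or.inl ⟨(m - 3) / 4, by omega, by omega⟩)))
      · omega
  · exfalso
    obtain ⟨e1, e2⟩ := key (strandVertex_zero n b) (strandVertex_one n b)
    rcases he with he | he <;> rw [he] at e2 <;> rcases h with h | h | h | h <;> linarith
  · obtain ⟨e1, e2⟩ := key (strandVertex_one n b) (strandVertex_two n b)
    have h7 : z.re = 7 := by
      rcases he with he | he <;> rw [he] at e1 e2 <;> rcases h with h | h | h | h <;> linarith
    refine ⟨0, by omega, ?_⟩
    rw [spot_first (by omega)]
    apply Complex.ext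
    · simp [h7]
    · simp [e2]
  · exfalso
    obtain ⟨e1, e2⟩ := key (strandVertex_two n b) (strandVertex_below b (k := 0) (by omega))
    norm_num at e1
    rcases he with he | he <;> rw [he] at e1 <;> linarith
  · have hk0 : (0 : ℝ) ≤ k := Nat.cast_nonneg k
    rcases hm' with rfl | rfl | rfl | ⟨hk1, rfl⟩
    · exfalso
      obtain ⟨e1, e2⟩ := key (strandVertex_below b hk) (strandVertex_below_left b hk)
      rcases he with he | he <;> rw [he] at e2 <;> linarith
    · exfalso
      obtain ⟨e1, e2⟩ := key (strandVertex_below_left b hk) (strandVertex_above_left b hk)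
      rcases he with he | he <;> rw [he] at e1 <;> linarith
    · exfalso
      obtain ⟨e1, e2⟩ := key (strandVertex_above_left b hk) (strandVertex_above b hk)
      rcases he with he | he <;> rw [he] at e2 <;> linarith
    · have hk1' : (k : ℝ) + 2 ≤ n := by exact_mod_cast (show k + 2 ≤ n by omega)
      obtain ⟨e1, e2⟩ := key (strandVertex_above b hk) (strandVertex_below b hk1)
      push_cast at e1
      have e1' : z.re = 16 * (k + 1 : ℕ) + 4 + strandSign b := by
        rw [e1]
        push_cast
        ring
      rcases h with h | h | h | h
      · exfalso
        rcases he with he | he <;> rw [he] at e1 <;> linarith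
      · exfalso
        rcases he with he | he <;> rw [he] at e1 <;> linarith
      · refine ⟨2 * (k + 1) - 1, by omega, ?_⟩
        rw [spot_above (by omega) (by omega)]
        apply Complex.ext
        · exact e1'
        · simp [h]
      · refine ⟨2 * (k + 1), by omega, ?_⟩
        rw [spot_below (by omega)]
        apply Complex.ext
        · exact e1'
        · simp [h]
  · exfalso
    have hv := strandVertex_above b (n := n) (k := n - 1) (by omega)
    rw [show 4 * (n - 1) + 6 = 4 * n + 2 by omega, Nat.cast_sub hn] at hv
    obtain ⟨e1, e2⟩ := key hv (strandVertex_end₃ n b)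
    push_cast at e1
    rcases he with he | he <;> rw [he] at e1 <;> linarith
  · obtain ⟨e1, e2⟩ := key (strandVertex_end₃ n b) (strandVertex_end₄ n b)
    have h7 : z.re = 16 * n + 1 := by
      rcases he with he | he <;> rw [he] at e1 e2 <;> rcases h with h | h | h | h <;> linarith
    refine ⟨2 * n - 1, by omega, ?_⟩
    rw [spot_last]
    apply Complex.ext
    · simp [h7]
    · simp [e2]
  · exfalso
    obtain ⟨e1, e2⟩ := key (strandVertex_end₄ n b) (strandVertex_end n b)
    rcases he with he | he <;> rw [he] at e2 <;> rcases h with h | h | h | h <;> linarith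

theorem exists_linkIdx {n j : ℕ} (hj : j < 2 * n) (b : Bool) :
    ∃ x : LinkIdx n, strand n x = b ∧ position n x = j := by
  by_cases h : j = 2 * n - 1
  · cases b
    · exact ⟨.inr (.inl 0), rfl, h.symm⟩
    · exact ⟨.inr (.inr 0), rfl, h.symm⟩
  · cases b
    · exact ⟨.inl (.inr ⟨j, by omega⟩), rfl, rfl⟩
    · exact ⟨.inl (.inl ⟨j, by omega⟩), rfl, rfl⟩

theorem lam_eq_spot {n : ℕ} (hn : 1 ≤ n) (x : LinkIdx n) :
    lam n x = spot n 0 (strand n x) (position n x) := blue_spot hn 0 x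

theorem lam_bijOn {n : ℕ} (hn : 1 ≤ n) :
    Set.BijOn (lam n) Set.univ (Set.range (blue n) ∩ Set.range (red n 0)) := by
  refine ⟨fun x _ => ⟨⟨_, rfl⟩, ⟨redParam n 0 x, (blue_blueParam n 0 x).symm⟩⟩, ?_, ?_⟩
  · intro x _ y _ h
    by_contra hxy
    have := (inHalf_departIdx (position_lt hn x) (position_lt hn y) (position_strand_inj hxy)
      0 0).ne_zero
    rw [← lam_eq_spot hn, ← lam_eq_spot hn, h, sub_self] at this
    exact this rfl
  · rintro z ⟨⟨s, rfl⟩, ⟨t, ht⟩⟩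
    obtain ⟨r1, r2, r3, r4⟩ := red_zero_cases hn t
    rw [ht] at r1 r2 r3 r4
    obtain ⟨b, m, hm, x, h0, h1, e⟩ := blue_mem_strand (n := n) s
    obtain ⟨j, hj, h⟩ := eq_spot_of_mem hn hm h0 h1 e r1 r2 r3 r4
    obtain ⟨y, rfl, rfl⟩ := exists_linkIdx hj b
    exact ⟨y, trivial, (lam_eq_spot hn y).trans h.symm⟩

theorem blueParam_mem_Icc {n : ℕ} (hn : 1 ≤ n) (d : SignType) (x : LinkIdx n) :
    blueParam n d x ∈ Set.Icc (1 : ℝ) (8 * n + 9) := by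
  have h := strandParam_mem (position_lt hn x) d (strand n x)
  have hn0 : (0 : ℝ) ≤ n := Nat.cast_nonneg n
  rw [blueParam_eq]
  generalize strand n x = b at *
  cases b <;> simp only [blueTime, if_true, Bool.false_eq_true, if_false] <;> constructor <;>
    linarith

theorem blue_mem_puncturedPlane {n : ℕ} (hn : 1 ≤ n) {s : ℝ}
    (hs : s ∈ Set.Icc (1 : ℝ) (8 * n + 9)) : blue n s ∈ puncturedPlane (linkLoc n) := by
  intro V
  have hn0 : (0 : ℝ) ≤ n := Nat.cast_nonneg n
  have T := fun b => (sees_lookIdx hn V b).turns (s := 1) (t := 4 * n + 5) (by omega) le_rfl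
    (by norm_num) (by norm_num) (by push_cast; linarith) (by push_cast; linarith) (by linarith)
    (strandCurve_one n b) (strandCurve_tip n b) (inHalf_lookIdx_one hn V b)
    (inHalf_lookIdx_tip hn V b)
  have T1 := T false
  rw [lookIdx_tip] at T1
  have h := turns_blue_of_strands (b := true) T1 (T true) zero_le_one zero_le_one (by linarith)
    (by linarith)
  refine sub_ne_zero.mp (h.ne_zero (u := s) ?_)
  rw [Set.uIcc_comm, Set.uIcc_of_le] <;> simp [blueTime]
  · constructor <;> linarith [hs.1, hs.2]
  · linarith

theorem redPath_mem_puncturedPlane {n : ℕ} (hn : 1 ≤ n) (d : SignType) (x y : LinkIdx n) (t : I) :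
    redPath n d x y t ∈ puncturedPlane (linkLoc n) :=
  fun V => sub_ne_zero.mp ((redPath_lifts_linkLoc hn V d x y).ne_zero t)

theorem linkWellPosed {n : ℕ} (hn : 1 ≤ n) : LinkWellPosed n := by
  refine ⟨lam_bijOn hn, fun x y t V => sub_ne_zero.mp ((linkLoop_lifts hn V x y).ne_zero t),
    fun x y hxy t => ?_⟩
  obtain ⟨h1, h2⟩ := twoPointLoop_mem (P := puncturedPlane (linkLoc n)) Set.ordConnected_Icc
    (blueParam_mem_Icc hn (linkCopy n x y) x) (blueParam_mem_Icc hn (linkCopy n x y) y)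
    (blueParam_mem_Icc hn (linkCopy n y x) y) (fun s => blue_mem_puncturedPlane hn)
    (redPath_mem_puncturedPlane hn (linkCopy n x y) y x) t
  exact ⟨h1, h2, (linkLoop₂_phi hn hxy).1 t⟩

end RationalTorusLink

end

theorem mainTheorem5 (n : ℕ) (hn : 1 ≤ n) :
    RationalTorusLink.TangleWellPosed (2 * n - 1) (by omega) ∧
    RationalTorusLink.LinkWellPosed n ∧
    RationalTorusLink.linkMatrix n = RationalTorusLink.closureMatrix n hn :=
  ⟨RationalTorusLink.tangleWellPosed (by omega) (by omega), RationalTorusLink.linkWellPosed hn,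
    RationalTorusLink.linkMatrix_eq_closureMatrix hn⟩
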